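/- **Theorem (Universality in the Gaussian case).** Let $\nu:[-1,1]\to\mathbb R$ be smooth ($C^\infty$) with $\nu(0)=0$ and $\nu(1)=1$. For each $N$ let $(H_N(\sigma))_{\sigma\in\{-1,1\}^N}$ be a centered (jointly) Gaussian family with $\mathrm{cov}(H_N(\sigma),H_N(\sigma'))=\nu(R(\sigma,\sigma'))$, where $R(\sigma,\sigma')=\frac1N\sum_{i=1}^N\sigma_i\sigma'_i$. Let $M=M(N)$ be real numbers with $\log N=o(2^{M})$, and such that $M=o(\sqrt N)$ if $\nu'(0)\neq0$, and $M=o(N)$ if $\nu'(0)=0$. For each $N$ let $(X_\sigma)_{\sigma\in\{-1,1\}^N}$ be i.i.d. Bernoulli variables with $\mathrm P(X_\sigma=1)=2^{M}/2^{N}$ (the variables for all $N$ being defined on one probability space with measure $\mathrm P$, independently of the Hamiltonians), and let $X=\{\sigma: X_\sigma=1\}$. Put $$b_N=\sqrt{1/M},\qquad a_N=\sqrt{2M\log 2+2\log b_N-\log 2},\qquad \mathcal P_N=\sum_{\sigma\in X}\delta_{(H_N(\sigma)-a_N)/b_N}.$$ Then, for $\mathrm P$-almost every realization of the random clouds $X$,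 the distribution of the point process $\mathcal P_N$ (under the law of $H_N$, with $X$ fixed) converges weakly as $N\to\infty$, in the space of locally finite measures on $\mathbb R$ with the vague topology, to the distribution of a Poisson point process on $\mathbb R$ with intensity measure $\mu(dt)=\frac{1}{\sqrt\pi}\,e^{-t\sqrt{2\log 2}}\,dt$. -/

import Mathlib

open MeasureTheory ProbabilityTheory Filter Asymptotics
open scoped ContDiff CompactlySupported

noncomputable section

namespace REM

/-! ### The hypercube and the overlap -/

/-- The hypercube `{-1, 1}^N`. -/
abbrev Hypercube (N : ℕ) : Type := Fin N → ℤˣ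

/-- The overlap `R(σ, σ') = N⁻¹ ∑ i, σ i * σ' i` (equal to `0` on the one-point cube `N = 0`). -/
def overlap {N : ℕ} (σ σ' : Hypercube N) : ℝ :=
  (1 / (N : ℝ)) * ∑ i, (((σ i : ℤˣ) : ℤ) : ℝ) * (((σ' i : ℤˣ) : ℤ) : ℝ)

/-! ### Gaussian Hamiltonians and Bernoulli clouds -/

/-- `H` is a centered Gaussian Hamiltonian on `{-1, 1}^N` with covariance `ν (R(σ, σ'))`:
the family `(H σ)` is jointly Gaussian under `Q`, with mean zero and that covariance. -/
structure IsGaussianHamiltonian {Ω : Type*} [MeasurableSpace Ω] (Q : Measure Ω) (ν : ℝ → ℝ)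
    {N : ℕ} (H : Hypercube N → Ω → ℝ) : Prop where
  gaussian : IsGaussianProcess H Q
  centered : ∀ σ, ∫ w, H σ w ∂Q = 0
  covariance_eq : ∀ σ σ', covariance (H σ) (H σ') Q = ν (overlap σ σ')

/-- The indicators `(X σ)` are i.i.d. Bernoulli variables with `P (X σ = 1) = p`. The random cloud
is the random set `{σ | X σ = 1}`. -/
structure IsBernoulliCloud {Ω : Type*} [MeasurableSpace Ω] (P : Measure Ω) (p : ℝ)
    {N : ℕ} (X : Hypercube N → Ω → Bool) : Prop where
  measurable : ∀ σ, Measurable (X σ)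
  indep : iIndepFun X P
  prob : ∀ σ, P.real {w | X σ w = true} = p

/-- The realization of the random cloud at `w`. -/
def cloud {Ω : Type*} {N : ℕ} (X : Hypercube N → Ω → Bool) (w : Ω) : Finset (Hypercube N) :=
  Finset.univ.filter fun σ => X σ w = true

/-! ### The normalization -/

/-- `b_N = √(1 / M)`. -/
def scaleB (M : ℝ) : ℝ := √(1 / M)

/-- `a_N = √(2 M log 2 + 2 log b_N - log 2)`. -/
def centerA (M : ℝ) : ℝ := √(2 * M * Real.log 2 + 2 * Real.log (scaleB M) - Real.log 2)

/-! ### Locally finite measures with the vague topology, and point processes -/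

/-- The space of locally finite Borel measures on `ℝ`. -/
def LocFinMeasure : Type := {m : Measure ℝ // IsLocallyFiniteMeasure m}

/-- The vague topology: the coarsest topology that makes `m ↦ ∫ f dm` continuous for every
continuous compactly supported `f : ℝ → ℝ`. -/
instance : TopologicalSpace LocFinMeasure :=
  TopologicalSpace.induced
    (fun (m : LocFinMeasure) (f : C_c(ℝ, ℝ)) => ∫ x, f x ∂m.1) Pi.topologicalSpace

/-- The Borel sigma-algebra of the vague topology. -/
instance : MeasurableSpace LocFinMeasure := borel LocFinMeasure

instance : BorelSpace LocFinMeasure := ⟨rfl⟩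

/-- The point measure `∑ i ∈ s, δ_{x i}`. -/
def pointMeasure {ι : Type*} (s : Finset ι) (x : ι → ℝ) : LocFinMeasure :=
  ⟨∑ i ∈ s, Measure.dirac (x i), inferInstance⟩

/-- `L` is the law of a Poisson point process on `ℝ` with intensity measure `μ`: the counts of
pairwise disjoint Borel sets of finite `μ`-measure are independent, and the count of such a set `B`
has the Poisson distribution with parameter `μ B`. -/
structure IsPoissonPointProcessLaw (μ : Measure ℝ) (L : Measure LocFinMeasure) : Prop where
  poisson : ∀ B : Set ℝ, MeasurableSet B → μ B ≠ ⊤ →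
    HasLaw (fun m : LocFinMeasure => m.1 B)
      ((poissonMeasure (μ B).toNNReal).map (fun n : ℕ => (n : ENNReal))) L
  indep : ∀ (n : ℕ) (B : Fin n → Set ℝ), (∀ i, MeasurableSet (B i)) → (∀ i, μ (B i) ≠ ⊤) →
    Pairwise (fun i j => Disjoint (B i) (B j)) →
    iIndepFun (fun i (m : LocFinMeasure) => m.1 (B i)) L

/-- The limiting intensity measure `π^{-1/2} exp(-t √(2 log 2)) dt`. -/
def limitIntensity : Measure ℝ :=
  volume.withDensity fun t =>
    ENNReal.ofReal (1 / √Real.pi * Real.exp (-t * √(2 * Real.log 2)))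

/-- The point process `∑_{σ ∈ X} δ_{(H σ - a_N) / b_N}`, for a fixed realization `S` of the cloud,
as a random element on the probability space of the Hamiltonian. -/
def levelProcess {Ω : Type*} {N : ℕ} (M : ℝ) (S : Finset (Hypercube N))
    (H : Hypercube N → Ω → ℝ) (w : Ω) : LocFinMeasure :=
  pointMeasure S fun σ => (H σ w - centerA M) / scaleB M

end REM

end

/-!
The vague topology on locally finite measures is second countable, and weak convergence of laws on
this space follows from convergence of the characteristic functionals `E exp (i ∫ f dm)`, `f`
continuous with compact support (`REM.LocFinMeasure.tendsto_of_charFunctional`). The limit law is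
obtained by superposing independent Poisson processes on bounded cells; its characteristic
functional is `exp (∫ (exp (i f) - 1) dμ)` (`REM.PoissonProcess.charFunctional_law`).

For independent energies the characteristic functional of the level process is the `|X|`-th power
of `1 + z`, where `2 ^ M * z` converges to `∫ (exp (i f) - 1) dμ` since `2 ^ M` times the rescaled
Gaussian density converges pointwise to the limit density (`REM.tendsto_integral_phase_iid`).

Correlated energies are compared with independent ones by Gaussian interpolation along a quarter
circle (`REM.Gaussian.norm_integral_phase_sub_le`). Only pairs `σ ≠ σ'` contribute, each with its
covariance `c = ν (R(σ, σ'))` times the probability that both energies lie in the support of the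
rescaled test function, which is at most `2 ^ (-2 M) exp (2 log 2 M |c|)` up to constants and a factor
`M`. It thus suffices that the total `REM.interaction` vanishes and that `|X| ~ 2 ^ M`
(`REM.tendsto_integral_phase`).

Both are almost sure properties of the clouds, proved by Borel–Cantelli. Chernoff's bound and
`log N = o(2 ^ M)` give the size. For the interaction, the key fact is
`2 ^ (-N) ∑_{σ'} exp (N R(σ, σ')² / 4) ≤ √2` (`REM.sum_exp_overlap_sq_le`). If `2 ^ M ≤ N ^ 4`, it
shows that the largest overlap in the cloud is of order `√(log N / N)`, so that every pair is
negligible. If `2 ^ M > N ^ 4`, the growth conditions on `M` bound the energy of a pair by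
`o(1) exp (N R² / 8)` (`REM.exists_rate`, `REM.mul_exp_le`), and a second moment computation bounds
the sum of `exp (N R² / 8)` over the pairs of the cloud by a multiple of `2 ^ (2 M)`
(`REM.ae_eventually_sum_exp_le`).
-/

namespace REM

open scoped Topology ENNReal NNReal

/-! ### The vague topology -/

namespace LocFinMeasure

instance (m : LocFinMeasure) : IsLocallyFiniteMeasure m.1 := m.2

lemma continuous_integral (f : C_c(ℝ, ℝ)) :
    Continuous fun m : LocFinMeasure => ∫ x, f x ∂m.1 := by
  have h : Continuous fun (m : LocFinMeasure) (f : C_c(ℝ, ℝ)) => ∫ x, f x ∂m.1 :=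
    continuous_induced_dom
  exact (continuous_apply f).comp h

/-- A continuous plateau function: it is `1` on `[-n, n]`, vanishes outside `[-(n+1), n+1]`. -/
def plateau (n : ℕ) : C_c(ℝ, ℝ) where
  toFun x := max 0 (min 1 (n + 1 - |x|))
  continuous_toFun := by fun_prop
  hasCompactSupport' := by
    refine HasCompactSupport.intro (K := Set.Icc (-(n + 1 : ℝ)) (n + 1)) isCompact_Icc ?_
    intro x hx
    have : (n : ℝ) + 1 < |x| := by
      by_contra h
      exact hx (abs_le.1 (not_lt.1 h))
    rw [max_eq_left]
    exact (min_le_right _ _).trans (by linarith)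

lemma plateau_apply (n : ℕ) (x : ℝ) : plateau n x = max 0 (min 1 (n + 1 - |x|)) := rfl

lemma plateau_nonneg (n : ℕ) (x : ℝ) : 0 ≤ plateau n x := le_max_left _ _

lemma plateau_eq_one {n : ℕ} {x : ℝ} (hx : |x| ≤ n) : plateau n x = 1 := by
  rw [plateau_apply, min_eq_left (by linarith), max_eq_right zero_le_one]

lemma exists_abs_le_of_ne_zero (f : C_c(ℝ, ℝ)) : ∃ n : ℕ, ∀ x, f x ≠ 0 → |x| ≤ n := by
  obtain ⟨C, hC⟩ := f.hasCompactSupport.isCompact.isBounded.exists_norm_le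
  obtain ⟨n, hn⟩ := exists_nat_ge C
  exact ⟨n, fun x hx => (hC x (subset_tsupport _ hx)).trans hn⟩

lemma integrable (f : C_c(ℝ, ℝ)) (m : LocFinMeasure) : Integrable f m.1 :=
  f.continuous.integrable_of_hasCompactSupport f.hasCompactSupport

/-- If `f` and `g` are supported in `[-n, n]` and uniformly `δ`-close, their integrals differ by at
most `δ` times the integral of the plateau function. -/
lemma abs_integral_sub_le {n : ℕ} {f g : C_c(ℝ, ℝ)} (hf : ∀ x : ℝ, f x ≠ 0 → |x| ≤ n)
    (hg : ∀ x : ℝ, g x ≠ 0 → |x| ≤ n) {δ : ℝ} (h : ∀ x : ℝ, |x| ≤ n → |f x - g x| ≤ δ)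
    (m : LocFinMeasure) :
    |∫ x, f x ∂m.1 - ∫ x, g x ∂m.1| ≤ δ * ∫ x, plateau n x ∂m.1 := by
  rw [← integral_sub (integrable f m) (integrable g m), ← integral_const_mul, ← Real.norm_eq_abs]
  refine norm_integral_le_of_norm_le ((integrable (plateau n) m).const_mul δ) (ae_of_all _ ?_)
  intro x
  by_cases hx : |x| ≤ n
  · rw [plateau_eq_one hx, mul_one]
    exact h x hx
  · have h1 : f x = 0 := by by_contra h'; exact hx (hf x h')
    have h2 : g x = 0 := by by_contra h'; exact hx (hg x h')
    have hδ : 0 ≤ δ := (abs_nonneg _).trans (h 0 (by simp))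
    rw [h1, h2, sub_zero, norm_zero]
    exact mul_nonneg hδ (plateau_nonneg n x)

/-- For functions supported in `[-n, n]`, countably many are uniformly dense. -/
lemma exists_dense_seq (n : ℕ) : ∃ g : ℕ → C_c(ℝ, ℝ), (∀ k (x : ℝ), g k x ≠ 0 → |x| ≤ n) ∧
    ∀ f : C_c(ℝ, ℝ), (∀ x : ℝ, f x ≠ 0 → |x| ≤ n) →
      ∀ δ > 0, ∃ k, ∀ x : ℝ, |x| ≤ n → |f x - g k x| ≤ δ := by
  let K : Set ℝ := Set.Icc (-(n : ℝ)) n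
  have : CompactSpace K := isCompact_iff_compactSpace.1 isCompact_Icc
  let r : {f : C_c(ℝ, ℝ) // ∀ x : ℝ, f x ≠ 0 → |x| ≤ n} → C(K, ℝ) :=
    fun f => f.1.toContinuousMap.restrict K
  have : Nonempty (Set.range r) := ⟨⟨r ⟨0, by simp⟩, ⟨_, rfl⟩⟩⟩
  let d : ℕ → Set.range r := TopologicalSpace.denseSeq (Set.range r)
  choose g hg using fun k => (d k).2
  refine ⟨fun k => (g k).1, fun k => (g k).2, fun f hf δ hδ => ?_⟩
  obtain ⟨k, hk⟩ := (TopologicalSpace.denseRange_denseSeq (Set.range r)).exists_dist_lt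
    ⟨r ⟨f, hf⟩, ⟨_, rfl⟩⟩ hδ
  refine ⟨k, fun x hx => ?_⟩
  have h1 : dist (r ⟨f, hf⟩) (r (g k)) < δ := by
    rw [hg k]
    exact hk
  have h2 := (ContinuousMap.dist_apply_le_dist (f := r ⟨f, hf⟩) (g := r (g k))
    ⟨x, abs_le.1 hx⟩).trans h1.le
  rwa [Real.dist_eq] at h2

/-- Countably many test functions already generate the vague topology. -/
lemma exists_seq_induced : ∃ D : ℕ → C_c(ℝ, ℝ),
    instTopologicalSpaceLocFinMeasure =
      TopologicalSpace.induced (fun (m : LocFinMeasure) (k : ℕ) => ∫ x, D k x ∂m.1)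
        Pi.topologicalSpace := by
  choose g hg0 hg using exists_dense_seq
  let D' : ℕ ⊕ ℕ × ℕ → C_c(ℝ, ℝ) := Sum.elim plateau fun p => g p.1 p.2
  let e : ℕ ≃ ℕ ⊕ ℕ × ℕ := (Denumerable.eqv _).symm
  refine ⟨fun k => D' (e k), le_antisymm ?_ ?_⟩
  · rw [← continuous_iff_le_induced]
    exact continuous_pi fun k => continuous_integral _
  · set t := TopologicalSpace.induced
      (fun (m : LocFinMeasure) (k : ℕ) => ∫ x, D' (e k) x ∂m.1) Pi.topologicalSpace with ht
    have hD : ∀ j, @Continuous _ _ t _ fun m : LocFinMeasure => ∫ x, D' j x ∂m.1 := by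
      intro j
      have h1 : @Continuous _ _ t _ (fun (m : LocFinMeasure) (k : ℕ) => ∫ x, D' (e k) x ∂m.1) :=
        continuous_induced_dom
      have h2 := (continuous_apply (A := fun _ : ℕ => ℝ) (e.symm j)).comp h1
      simpa [Function.comp_def] using h2
    change t ≤ TopologicalSpace.induced
      (fun (m : LocFinMeasure) (f : C_c(ℝ, ℝ)) => ∫ x, f x ∂m.1) Pi.topologicalSpace
    rw [← continuous_iff_le_induced]
    refine continuous_pi fun f => ?_
    rw [continuous_iff_continuousAt]
    intro m₀
    obtain ⟨n, hn⟩ := exists_abs_le_of_ne_zero f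
    rw [ContinuousAt, Metric.tendsto_nhds]
    intro ε hε
    set C := ∫ x, plateau n x ∂m₀.1 with hC
    have hC0 : 0 ≤ C := integral_nonneg (plateau_nonneg n)
    obtain ⟨k, hk⟩ := hg n f hn (ε / (4 * (C + 1))) (by positivity)
    have e1 : ∀ᶠ m in 𝓝 m₀, ∫ x, plateau n x ∂m.1 < C + 1 :=
      (hD (Sum.inl n)).continuousAt.eventually_lt continuousAt_const (by simp [D', ← hC])
    have e2 : ∀ᶠ m in 𝓝 m₀, dist (∫ x, g n k x ∂m.1) (∫ x, g n k x ∂m₀.1) < ε / 4 :=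
      Metric.tendsto_nhds.1 (hD (Sum.inr (n, k))).continuousAt _ (by positivity)
    filter_upwards [e1, e2] with m h1 h2
    have b1 := abs_integral_sub_le hn (hg0 n k) hk m
    have b2 := abs_integral_sub_le hn (hg0 n k) hk m₀
    rw [← hC] at b2
    have b3 : ε / (4 * (C + 1)) * (∫ x, plateau n x ∂m.1) ≤ ε / 4 := by
      calc _ ≤ ε / (4 * (C + 1)) * (C + 1) := by gcongr
        _ = ε / 4 := by field_simp
    have b4 : ε / (4 * (C + 1)) * C ≤ ε / 4 := by
      calc _ ≤ ε / (4 * (C + 1)) * (C + 1) := by gcongr; linarith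
        _ = ε / 4 := by field_simp
    rw [Real.dist_eq] at h2 ⊢
    have := abs_le.1 (b1.trans b3)
    have := abs_le.1 (b2.trans b4)
    have := abs_lt.1 h2
    rw [abs_lt]
    constructor <;> linarith

instance : SecondCountableTopology LocFinMeasure := by
  obtain ⟨D, hD⟩ := exists_seq_induced
  have := TopologicalSpace.secondCountableTopology_induced LocFinMeasure (ℕ → ℝ)
    (fun m k => ∫ x, D k x ∂m.1)
  rwa [← hD] at this

/-- A map into the space of locally finite measures is measurable as soon as its integrals against
test functions are. -/
lemma measurable_of_integral {Ω : Type*} [MeasurableSpace Ω] {η : Ω → LocFinMeasure}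
    (h : ∀ f : C_c(ℝ, ℝ), Measurable fun w => ∫ x, f x ∂(η w).1) : Measurable η := by
  obtain ⟨D, hD⟩ := exists_seq_induced
  have hb : instMeasurableSpaceLocFinMeasure =
      MeasurableSpace.comap (fun (m : LocFinMeasure) (k : ℕ) => ∫ x, D k x ∂m.1)
        MeasurableSpace.pi := by
    have h1 : instMeasurableSpaceLocFinMeasure =
      @borel LocFinMeasure instTopologicalSpaceLocFinMeasure := rfl
    rw [h1, hD, BorelSpace.measurable_eq (α := ℕ → ℝ), borel_comap]
  rw [hb]
  exact measurable_comap_iff.2 (measurable_pi_lambda _ fun k => h (D k))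

/-- The indicator of a bounded open set is an increasing limit of test functions. -/
lemma measurable_measure_isOpen_bounded {U : Set ℝ} (hU : IsOpen U) (hb : Bornology.IsBounded U) :
    Measurable fun m : LocFinMeasure => m.1 U := by
  have hne : (Uᶜ).Nonempty := by
    by_contra h
    rw [Set.not_nonempty_iff_eq_empty, Set.compl_empty_iff] at h
    exact NormedSpace.unbounded_univ ℝ ℝ (h ▸ hb)
  let φ : ℕ → C_c(ℝ, ℝ) := fun k =>
    { toFun := fun x => min 1 (k * Metric.infDist x Uᶜ)
      continuous_toFun := by fun_prop
      hasCompactSupport' := by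
        refine HasCompactSupport.intro hb.isCompact_closure ?_
        intro x hx
        have : x ∈ Uᶜ := fun h => hx (subset_closure h)
        rw [Metric.infDist_zero_of_mem this]
        simp }
  have hφ : ∀ k x, φ k x = min 1 (k * Metric.infDist x Uᶜ) := fun _ _ => rfl
  have hlim : ∀ m : LocFinMeasure, Tendsto (fun k => ∫ x, φ k x ∂m.1) atTop
      (𝓝 (m.1.real U)) := by
    intro m
    have hfin : m.1 U ≠ ⊤ :=
      ((measure_mono subset_closure).trans_lt hb.isCompact_closure.measure_lt_top).ne
    rw [← integral_indicator_one hU.measurableSet]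
    refine tendsto_integral_of_dominated_convergence (U.indicator 1)
      (fun k => (φ k).continuous.aestronglyMeasurable) ?_ ?_ ?_
    · exact (integrable_indicator_iff hU.measurableSet).2 (integrableOn_const hfin)
    · intro k
      refine ae_of_all _ fun x => ?_
      by_cases hx : x ∈ U
      · rw [Set.indicator_of_mem hx, hφ, Real.norm_of_nonneg]
        · exact min_le_left _ _
        · have := Metric.infDist_nonneg (x := x) (s := Uᶜ)
          positivity
      · rw [Set.indicator_of_notMem hx, hφ, Metric.infDist_zero_of_mem hx]
        simp
    · refine ae_of_all _ fun x => ?_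
      by_cases hx : x ∈ U
      · have hpos : 0 < Metric.infDist x Uᶜ := by
          rw [← hU.isClosed_compl.notMem_iff_infDist_pos hne]
          exact fun h => h hx
        rw [Set.indicator_of_mem hx]
        refine tendsto_const_nhds.congr' ?_
        obtain ⟨k₀, hk₀⟩ := exists_nat_ge (1 / Metric.infDist x Uᶜ)
        filter_upwards [eventually_ge_atTop k₀] with k hk
        rw [hφ, min_eq_left]
        · rfl
        · rw [← div_le_iff₀ hpos]
          exact hk₀.trans (by exact_mod_cast hk)
      · rw [Set.indicator_of_notMem hx]
        refine tendsto_const_nhds.congr fun k => ?_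
        rw [hφ, Metric.infDist_zero_of_mem hx]
        simp
  have hmeas : Measurable fun m : LocFinMeasure => m.1.real U :=
    measurable_of_tendsto_metrizable (fun k => (continuous_integral (φ k)).measurable)
      (tendsto_pi_nhds.2 hlim)
  have : (fun m : LocFinMeasure => m.1 U) = fun m => ENNReal.ofReal (m.1.real U) := by
    funext m
    exact (ofReal_measureReal
      ((measure_mono subset_closure).trans_lt hb.isCompact_closure.measure_lt_top).ne).symm
  rw [this]
  exact hmeas.ennreal_ofReal

lemma measurable_measure {B : Set ℝ} (hB : MeasurableSet B) :
    Measurable fun m : LocFinMeasure => m.1 B := by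
  let I : ℕ → Set ℝ := fun n => Metric.ball 0 n
  have h1 : ∀ n, Measurable fun m : LocFinMeasure => m.1.restrict (I n) B := by
    intro n
    have : ∀ m : LocFinMeasure, IsFiniteMeasure (m.1.restrict (I n)) := fun m =>
      ⟨by
        rw [Measure.restrict_apply_univ]
        exact Metric.isBounded_ball.measure_lt_top⟩
    have h2 : Measurable fun m : LocFinMeasure => m.1.restrict (I n) := by
      refine Measurable.measure_of_isPiSystem (S := {s | IsOpen s})
        (BorelSpace.measurable_eq (α := ℝ)) isPiSystem_isOpen ?_ ?_
      · intro s hs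
        have hs : IsOpen s := hs
        simp_rw [Measure.restrict_apply hs.measurableSet]
        exact measurable_measure_isOpen_bounded (hs.inter Metric.isOpen_ball)
          (Metric.isBounded_ball.subset Set.inter_subset_right)
      · simp_rw [Measure.restrict_apply_univ]
        exact measurable_measure_isOpen_bounded Metric.isOpen_ball Metric.isBounded_ball
    exact (Measure.measurable_coe hB).comp h2
  have h3 : (fun m : LocFinMeasure => m.1 B) = fun m => ⨆ n, m.1.restrict (I n) B := by
    funext m
    simp_rw [Measure.restrict_apply hB]
    have hmono : Monotone fun n => B ∩ I n := fun a b hab =>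
      Set.inter_subset_inter_right _ (Metric.ball_subset_ball (by exact_mod_cast hab))
    rw [← hmono.measure_iUnion, ← Set.inter_iUnion, Metric.iUnion_ball_nat, Set.inter_univ]
  rw [h3]
  exact Measurable.iSup h1

/-! ### Weak convergence from characteristic functionals -/

/-- The characteristic functional `f ↦ E exp (i ∫ f dm)` of the law `L` of a random locally finite
measure. -/
noncomputable def charFunctional (L : Measure LocFinMeasure) (f : C_c(ℝ, ℝ)) : ℂ :=
  ∫ m, Complex.exp (((∫ x, f x ∂m.1 : ℝ) : ℂ) * Complex.I) ∂L

/-- Convergence of characteristic functionals yields convergence of the laws of finitely many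
integrals, by Lévy's theorem. -/
lemma le_liminf_of_cylinder {μ : ℕ → ProbabilityMeasure LocFinMeasure}
    {L : ProbabilityMeasure LocFinMeasure}
    (h : ∀ f, Tendsto (fun N => charFunctional (μ N) f) atTop (𝓝 (charFunctional L f)))
    {k : ℕ} (D : Fin k → C_c(ℝ, ℝ)) {V : Set (EuclideanSpace ℝ (Fin k))} (hV : IsOpen V) :
    (L : Measure LocFinMeasure)
        ((fun m => WithLp.toLp 2 fun i => ∫ x, D i x ∂m.1) ⁻¹' V) ≤
      atTop.liminf fun N => (μ N : Measure LocFinMeasure)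
        ((fun m => WithLp.toLp 2 fun i => ∫ x, D i x ∂m.1) ⁻¹' V) := by
  set Φ : LocFinMeasure → EuclideanSpace ℝ (Fin k) :=
    fun m => WithLp.toLp 2 fun i => ∫ x, D i x ∂m.1 with hΦ
  have hΦc : Continuous Φ :=
    (PiLp.continuous_toLp 2 _).comp (continuous_pi fun i => continuous_integral (D i))
  have hΦm : Measurable Φ := hΦc.measurable
  have hchar : ∀ (ρ : ProbabilityMeasure LocFinMeasure) (t : EuclideanSpace ℝ (Fin k)),
      charFun ((ρ : Measure LocFinMeasure).map Φ) t
        = charFunctional ρ (∑ i, t i • D i) := by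
    intro ρ t
    rw [charFun_apply, integral_map hΦm.aemeasurable (by fun_prop), charFunctional]
    refine integral_congr_ae (ae_of_all _ fun m => ?_)
    have : ∫ x, (∑ i, t i • D i : C_c(ℝ, ℝ)) x ∂m.1 = inner ℝ (Φ m) t := by
      simp only [CompactlySupportedContinuousMap.sum_apply,
        CompactlySupportedContinuousMap.smul_apply, smul_eq_mul]
      rw [integral_finsetSum _ fun i _ => (integrable (D i) m).const_mul _]
      simp [hΦ, PiLp.inner_apply, integral_const_mul]
    simp only [this]
  have hlim : Tendsto (fun N => (μ N).map hΦm.aemeasurable) atTop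
      (𝓝 (L.map hΦm.aemeasurable)) := by
    refine ProbabilityMeasure.tendsto_of_tendsto_charFun fun t => ?_
    simp only [ProbabilityMeasure.toMeasure_map, hchar]
    exact h _
  have := ProbabilityMeasure.le_liminf_measure_open_of_tendsto hlim hV
  simpa only [ProbabilityMeasure.toMeasure_map, Measure.map_apply hΦm hV.measurableSet] using this

/-- A sequence of laws of random locally finite measures converges weakly to a law `L` when the
characteristic functionals converge. No tightness is needed: `L` is given, and an open set is an
increasing union of cylinders over open sets because the vague topology is second countable. -/
theorem tendsto_of_charFunctional {μ : ℕ → ProbabilityMeasure LocFinMeasure}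
    {L : ProbabilityMeasure LocFinMeasure}
    (h : ∀ f, Tendsto (fun N => charFunctional (μ N) f) atTop (𝓝 (charFunctional L f))) :
    Tendsto μ atTop (𝓝 L) := by
  refine tendsto_of_forall_isOpen_le_liminf' fun G hG => ?_
  obtain ⟨D, hD⟩ := exists_seq_induced
  have hG' : IsOpen[TopologicalSpace.induced
      (fun (m : LocFinMeasure) (k : ℕ) => ∫ x, D k x ∂m.1) Pi.topologicalSpace] G := by
    rw [← hD]
    exact hG
  obtain ⟨W, hW, rfl⟩ := isOpen_induced_iff.1 hG'
  let r : (k : ℕ) → (ℕ → ℝ) → EuclideanSpace ℝ (Fin k) := fun k y => WithLp.toLp 2 fun i => y i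
  -- The largest open set of `ℝ ^ k` whose cylinder is contained in `W`: it makes the cylinders
  -- increase with `k`, which an arbitrary choice of cylinders covering `W` would not.
  let V : (k : ℕ) → Set (EuclideanSpace ℝ (Fin k)) := fun k =>
    ⋃₀ {A | IsOpen A ∧ r k ⁻¹' A ⊆ W}
  have hV : ∀ k, IsOpen (V k) := fun k => isOpen_sUnion fun A hA => hA.1
  have hVW : ∀ k, r k ⁻¹' V k ⊆ W := by
    intro k y hy
    obtain ⟨A, hA, hyA⟩ := hy
    exact hA.2 hyA
  let s : (k l : ℕ) → (hkl : k ≤ l) → EuclideanSpace ℝ (Fin l) → EuclideanSpace ℝ (Fin k) :=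
    fun k l hkl y => WithLp.toLp 2 fun i => y (Fin.castLE hkl i)
  have hmono : Monotone fun k => r k ⁻¹' V k := by
    intro k l hkl y hy
    obtain ⟨A, hA, hyA⟩ := hy
    refine ⟨s k l hkl ⁻¹' A, ⟨hA.1.preimage ?_, ?_⟩, hyA⟩
    · exact (PiLp.continuous_toLp 2 _).comp (by fun_prop)
    · exact fun z hz => hA.2 hz
  have hunion : ⋃ k, r k ⁻¹' V k = W := by
    refine Set.Subset.antisymm (Set.iUnion_subset hVW) fun y hy => ?_
    obtain ⟨I, u, hu, huW⟩ := isOpen_pi_iff.1 hW y hy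
    obtain ⟨k, hk⟩ : ∃ k, ∀ i ∈ I, i < k :=
      ⟨I.sup id + 1, fun i hi => Nat.lt_succ_of_le (Finset.le_sup (f := id) hi)⟩
    refine Set.mem_iUnion.2 ⟨k, {z | ∀ i : Fin k, (i : ℕ) ∈ I → z i ∈ u i}, ⟨?_, ?_⟩, ?_⟩
    · simp only [Set.ofPred_forall]
      refine isOpen_iInter_of_finite fun i => isOpen_iInter_of_finite fun hi => ?_
      exact (hu i hi).1.preimage (by fun_prop)
    · intro z hz
      refine huW fun i hi => ?_
      exact hz ⟨i, hk i hi⟩ hi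
    · exact fun i hi => (hu i hi).2
  set Ψ : LocFinMeasure → ℕ → ℝ := fun m k => ∫ x, D k x ∂m.1 with hΨ
  have hcyl : ∀ k, (L : Measure LocFinMeasure) (Ψ ⁻¹' (r k ⁻¹' V k)) ≤
      atTop.liminf fun N => (μ N : Measure LocFinMeasure) (Ψ ⁻¹' W) := by
    intro k
    refine (le_liminf_of_cylinder h (fun i : Fin k => D i) (hV k)).trans ?_
    exact liminf_le_liminf (Eventually.of_forall fun N =>
      measure_mono (Set.preimage_mono (f := Ψ) (hVW k)))
  calc (L : Measure LocFinMeasure) (Ψ ⁻¹' W)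
      = (L : Measure LocFinMeasure) (⋃ k, Ψ ⁻¹' (r k ⁻¹' V k)) := by
        rw [← Set.preimage_iUnion, hunion]
    _ = ⨆ k, (L : Measure LocFinMeasure) (Ψ ⁻¹' (r k ⁻¹' V k)) :=
        Monotone.measure_iUnion fun a b hab => Set.preimage_mono (hmono hab)
    _ ≤ _ := iSup_le hcyl

end LocFinMeasure

/-! ### Construction of the Poisson point process -/

namespace PoissonProcess

/-- The law of a Poisson number of points together with an i.i.d. sequence of positions, from which
a Poisson process with finite intensity `ρ` is built by keeping that many of the positions. -/
noncomputable def cellLaw (ρ : FiniteMeasure ℝ) : Measure (ℕ × (ℕ → ℝ)) :=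
  (poissonMeasure ρ.mass).prod (Measure.infinitePi fun _ : ℕ => (ρ.normalize : Measure ℝ))

instance (ρ : FiniteMeasure ℝ) : IsProbabilityMeasure (cellLaw ρ) := by
  unfold cellLaw
  infer_instance

lemma measurable_cellSum {E : Type*} [AddCommMonoid E] [MeasurableSpace E] [MeasurableAdd₂ E]
    {g : ℝ → E} (hg : Measurable g) :
    Measurable fun c : ℕ × (ℕ → ℝ) => ∑ i ∈ Finset.range c.1, g (c.2 i) := by
  refine measurable_from_prod_countable_right fun n => ?_
  exact Finset.measurable_fun_sum (Finset.range n) fun i _ => hg.comp (measurable_pi_apply i)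

lemma toMeasure_eq (ρ : FiniteMeasure ℝ) :
    (ρ : Measure ℝ) = (ρ.mass : ℝ≥0∞) • (ρ.normalize : Measure ℝ) := by
  conv_lhs => rw [ρ.self_eq_mass_smul_normalize]
  rfl

lemma integrable_cexp_ofReal_mul_I {Ω : Type*} [MeasurableSpace Ω] {P : Measure Ω}
    [IsFiniteMeasure P] {Y : Ω → ℝ} (hY : AEMeasurable Y P) :
    Integrable (fun w => Complex.exp ((Y w : ℂ) * Complex.I)) P := by
  refine Integrable.of_bound (C := 1) (by fun_prop) (ae_of_all _ fun w => ?_)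
  rw [Complex.norm_exp_ofReal_mul_I]

lemma integral_comp_eval_infinitePi {ι : Type*} {X : ι → Type*} [∀ i, MeasurableSpace (X i)]
    (P : (i : ι) → Measure (X i)) [∀ i, IsProbabilityMeasure (P i)] (i : ι) {f : X i → ℂ}
    (hf : Measurable f) : ∫ x, f (x i) ∂Measure.infinitePi P = ∫ y, f y ∂P i := by
  have h := integral_map (μ := Measure.infinitePi P) (measurable_pi_apply i).aemeasurable
    hf.aestronglyMeasurable
  rw [Measure.infinitePi_map_eval] at h
  exact h.symm

lemma lintegral_comp_eval_infinitePi {ι : Type*} {X : ι → Type*} [∀ i, MeasurableSpace (X i)]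
    (P : (i : ι) → Measure (X i)) [∀ i, IsProbabilityMeasure (P i)] (i : ι) {f : X i → ℝ≥0∞}
    (hf : Measurable f) : ∫⁻ x, f (x i) ∂Measure.infinitePi P = ∫⁻ y, f y ∂P i := by
  have h := lintegral_map (μ := Measure.infinitePi P) hf (measurable_pi_apply i)
  rw [Measure.infinitePi_map_eval] at h
  exact h.symm

lemma integral_cexp_cellSum (ρ : FiniteMeasure ℝ) {g : ℝ → ℝ} (hg : Measurable g) :
    ∫ c, Complex.exp (((∑ i ∈ Finset.range c.1, g (c.2 i) : ℝ) : ℂ) * Complex.I) ∂cellLaw ρ =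
      Complex.exp (∫ x, (Complex.exp ((g x : ℂ) * Complex.I) - 1) ∂(ρ : Measure ℝ)) := by
  set p : Measure ℝ := (ρ.normalize : Measure ℝ) with hp
  set φ : ℂ := ∫ x, Complex.exp ((g x : ℂ) * Complex.I) ∂p with hφ
  have h1 : ∀ n : ℕ, ∫ x, Complex.exp (((∑ i ∈ Finset.range n, g (x i) : ℝ) : ℂ) * Complex.I)
      ∂(Measure.infinitePi fun _ : ℕ => p) = φ ^ n := by
    intro n
    have hind : iIndepFun (fun (i : Fin n) (x : ℕ → ℝ) =>
        Complex.exp ((g (x i) : ℂ) * Complex.I)) (Measure.infinitePi fun _ : ℕ => p) :=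
      (iIndepFun_infinitePi (P := fun _ : ℕ => p)
        (X := fun _ y => Complex.exp ((g y : ℂ) * Complex.I))
        (fun _ => by fun_prop)).precomp Fin.val_injective
    have := hind.integral_fun_prod_eq_prod_integral fun i =>
      Measurable.aestronglyMeasurable (by fun_prop)
    calc _ = ∫ x, ∏ i : Fin n, Complex.exp ((g (x i) : ℂ) * Complex.I)
          ∂(Measure.infinitePi fun _ : ℕ => p) := by
          refine integral_congr_ae (ae_of_all _ fun x => ?_)
          simp only
          rw [← Complex.exp_sum, Finset.sum_range, Complex.ofReal_sum, Finset.sum_mul]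
      _ = ∏ i : Fin n, φ := by
          rw [this]
          refine Finset.prod_congr rfl fun i _ => ?_
          exact integral_comp_eval_infinitePi (fun _ : ℕ => p) (i : ℕ)
            (f := fun y => Complex.exp ((g y : ℂ) * Complex.I)) (by fun_prop)
      _ = φ ^ n := by simp
  have hφ1 : ∫ x, (Complex.exp ((g x : ℂ) * Complex.I) - 1) ∂(ρ : Measure ℝ) =
      (ρ.mass : ℂ) * (φ - 1) := by
    rw [toMeasure_eq, integral_smul_measure, integral_sub
      (integrable_cexp_ofReal_mul_I hg.aemeasurable) (integrable_const _)]
    simp only [ENNReal.coe_toReal, integral_const, probReal_univ, one_smul, Complex.real_smul, hφ,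
      hp]
  rw [hφ1, cellLaw, integral_prod]
  · refine (integral_congr_ae (ae_of_all _ h1)).trans ?_
    rw [integral_poissonMeasure]
    calc ∑' n : ℕ, (Real.exp (-ρ.mass) * (ρ.mass : ℝ) ^ n / (n.factorial : ℝ)) • φ ^ n
        = ∑' n : ℕ, Complex.exp (-ρ.mass) * ((ρ.mass * φ) ^ n / (n.factorial : ℂ)) := by
          congr with n
          rw [Complex.real_smul]
          push_cast
          ring
      _ = Complex.exp (-ρ.mass) * Complex.exp (ρ.mass * φ) := by
          rw [tsum_mul_left, (NormedSpace.expSeries_div_hasSum_exp ((ρ.mass : ℂ) * φ)).tsum_eq,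
            Complex.exp_eq_exp_ℂ]
      _ = _ := by
          rw [← Complex.exp_add]
          ring_nf
  · exact integrable_cexp_ofReal_mul_I (measurable_cellSum hg).aemeasurable

lemma lintegral_natCast_poissonMeasure (r : ℝ≥0) :
    ∫⁻ n : ℕ, (n : ℝ≥0∞) ∂poissonMeasure r = r := by
  have h : HasSum (fun n : ℕ => Real.exp (-r) * r ^ n / n.factorial * n) (r : ℝ) := by
    rw [← hasSum_nat_add_iff' 1]
    have h := (hasSum_one_poissonMeasure r).mul_left (r : ℝ)
    simp only [Finset.range_one, Finset.sum_singleton, CharP.cast_eq_zero, mul_zero, sub_zero]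
    rw [mul_one] at h
    refine h.congr_fun fun n => ?_
    rw [Nat.factorial_succ]
    push_cast
    field_simp
    ring
  rw [poissonMeasure, lintegral_sum_measure]
  simp_rw [lintegral_smul_measure, lintegral_dirac, smul_eq_mul]
  have h2 := ENNReal.ofReal_tsum_of_nonneg (fun n => by positivity) h.summable
  rw [h.tsum_eq, ENNReal.ofReal_coe_nnreal] at h2
  rw [h2]
  congr with n
  rw [ENNReal.ofReal_mul (by positivity), ENNReal.ofReal_natCast]

lemma lintegral_cellSum (ρ : FiniteMeasure ℝ) {h : ℝ → ℝ≥0∞} (hh : Measurable h) :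
    ∫⁻ c, ∑ i ∈ Finset.range c.1, h (c.2 i) ∂cellLaw ρ = ∫⁻ x, h x ∂(ρ : Measure ℝ) := by
  rw [cellLaw, lintegral_prod _ (measurable_cellSum hh).aemeasurable, toMeasure_eq,
    lintegral_smul_measure]
  have : ∀ n : ℕ, ∫⁻ x, ∑ i ∈ Finset.range n, h (x i)
      ∂(Measure.infinitePi fun _ : ℕ => (ρ.normalize : Measure ℝ)) =
      n * ∫⁻ x, h x ∂(ρ.normalize : Measure ℝ) := by
    intro n
    rw [lintegral_finsetSum (Finset.range n) (f := fun i (x : ℕ → ℝ) => h (x i))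
      fun i _ => hh.comp (measurable_pi_apply i)]
    simp [lintegral_comp_eval_infinitePi (fun _ : ℕ => (ρ.normalize : Measure ℝ)) _ hh]
  simp_rw [this]
  rw [lintegral_mul_const _ (measurable_of_countable _), lintegral_natCast_poissonMeasure,
    smul_eq_mul]

/-- The bounded cells `{x | k ≤ |x| < k + 1}`, which partition the line. -/
def cell (k : ℕ) : Set ℝ := {x | ⌊|x|⌋₊ = k}

lemma measurableSet_cell (k : ℕ) : MeasurableSet (cell k) :=
  (Nat.measurable_floor.comp measurable_abs) (measurableSet_singleton k)

lemma pairwise_disjoint_cell : Pairwise (Function.onFun Disjoint cell) := by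
  intro k l hkl
  refine Set.disjoint_left.2 fun x hx hy => hkl ?_
  exact (show ⌊|x|⌋₊ = k from hx).symm.trans hy

lemma iUnion_cell : ⋃ k, cell k = Set.univ :=
  Set.eq_univ_of_forall fun _ => Set.mem_iUnion.2 ⟨_, rfl⟩

lemma isBounded_cell (k : ℕ) : Bornology.IsBounded (cell k) := by
  refine (Metric.isBounded_ball (x := (0 : ℝ)) (r := k + 1)).subset fun x hx => ?_
  have : ⌊|x|⌋₊ = k := hx
  rw [mem_ball_zero_iff, Real.norm_eq_abs, ← this]
  exact Nat.lt_floor_add_one _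

variable (μ : Measure ℝ) [IsLocallyFiniteMeasure μ]

/-- The restriction of the intensity to a cell. -/
noncomputable def cellIntensity (k : ℕ) : FiniteMeasure ℝ :=
  ⟨μ.restrict (cell k), ⟨by
    rw [Measure.restrict_apply_univ]
    exact (isBounded_cell k).measure_lt_top⟩⟩

/-- The probability space carrying the Poisson process: independent data in the cells. -/
noncomputable def baseLaw : Measure (ℕ → ℕ × (ℕ → ℝ)) :=
  Measure.infinitePi fun k => cellLaw (cellIntensity μ k)

instance : IsProbabilityMeasure (baseLaw μ) := by
  unfold baseLaw
  infer_instance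

/-- The points falling in one cell. Restricting to the cell does not change anything almost surely,
but makes the superposition locally finite everywhere. -/
noncomputable def cellMeasure (k : ℕ) (c : ℕ × (ℕ → ℝ)) : Measure ℝ :=
  (∑ i ∈ Finset.range c.1, Measure.dirac (c.2 i)).restrict (cell k)

/-- The Poisson process, as a superposition over the cells. -/
noncomputable def process (w : ℕ → ℕ × (ℕ → ℝ)) : LocFinMeasure :=
  ⟨Measure.sum fun k => cellMeasure k (w k), by
    refine ⟨fun x => ⟨Metric.ball x 1, Metric.ball_mem_nhds x one_pos, ?_⟩⟩
    rw [Measure.sum_apply _ measurableSet_ball]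
    obtain ⟨K, hK⟩ := exists_nat_ge (|x| + 1)
    have h0 : ∀ k ∉ Finset.range (K + 1), cellMeasure k (w k) (Metric.ball x 1) = 0 := by
      intro k hk
      rw [cellMeasure, Measure.restrict_apply measurableSet_ball]
      have : Metric.ball x 1 ∩ cell k = ∅ := by
        refine Set.eq_empty_of_forall_notMem fun y hy => hk ?_
        have h1 : |y - x| < 1 := by simpa [Real.dist_eq] using hy.1
        have h2 : ⌊|y|⌋₊ = k := hy.2
        have h3 : |y| ≤ K := by
          have := abs_sub_abs_le_abs_sub y x
          linarith
        rw [Finset.mem_range, ← h2]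
        exact Nat.lt_succ_of_le (Nat.floor_le_of_le h3)
      rw [this, measure_empty]
    rw [tsum_eq_sum h0, ENNReal.sum_lt_top]
    exact fun k _ => by
      rw [cellMeasure]
      exact measure_lt_top _ _⟩

lemma integral_cellMeasure {E : Type*} [NormedAddCommGroup E] [NormedSpace ℝ E] [CompleteSpace E]
    (k : ℕ) (c : ℕ × (ℕ → ℝ)) {g : ℝ → E} (hg : StronglyMeasurable g) :
    ∫ x, g x ∂cellMeasure k c = ∑ i ∈ Finset.range c.1, (cell k).indicator g (c.2 i) := by
  rw [cellMeasure, ← integral_indicator (measurableSet_cell k), integral_finsetSum_measure]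
  · simp_rw [integral_dirac' _ _ (hg.indicator (measurableSet_cell k))]
  · exact fun i _ => integrable_dirac' (hg.indicator (measurableSet_cell k)) (by finiteness)

lemma lintegral_cellMeasure (k : ℕ) (c : ℕ × (ℕ → ℝ)) {h : ℝ → ℝ≥0∞} (hh : Measurable h) :
    ∫⁻ x, h x ∂cellMeasure k c = ∑ i ∈ Finset.range c.1, (cell k).indicator h (c.2 i) := by
  rw [cellMeasure, ← lintegral_indicator (measurableSet_cell k), lintegral_finsetSum_measure]
  simp_rw [lintegral_dirac' _ (hh.indicator (measurableSet_cell k))]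

lemma lintegral_process (w : ℕ → ℕ × (ℕ → ℝ)) {h : ℝ → ℝ≥0∞} (hh : Measurable h) :
    ∫⁻ x, h x ∂(process w).1 =
      ∑' k, ∑ i ∈ Finset.range (w k).1, (cell k).indicator h ((w k).2 i) := by
  simp only [process, lintegral_sum_measure, lintegral_cellMeasure _ _ hh]

lemma measurable_lintegral_process {h : ℝ → ℝ≥0∞} (hh : Measurable h) :
    Measurable fun w => ∫⁻ x, h x ∂(process w).1 := by
  simp_rw [lintegral_process _ hh]
  exact Measurable.tsum fun k =>
    (measurable_cellSum (hh.indicator (measurableSet_cell k))).comp (measurable_pi_apply k)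

/-- Campbell's formula. -/
lemma lintegral_lintegral_process {h : ℝ → ℝ≥0∞} (hh : Measurable h) :
    ∫⁻ w, ∫⁻ x, h x ∂(process w).1 ∂baseLaw μ = ∫⁻ x, h x ∂μ := by
  simp_rw [lintegral_process _ hh]
  have hm := fun k => measurable_cellSum (hh.indicator (measurableSet_cell k))
  rw [lintegral_tsum (f := fun k (w : ℕ → ℕ × (ℕ → ℝ)) => ∑ i ∈ Finset.range (w k).1,
    (cell k).indicator h ((w k).2 i)) fun k => ((hm k).comp (measurable_pi_apply k)).aemeasurable]
  have : ∀ k, ∫⁻ w : ℕ → ℕ × (ℕ → ℝ), ∑ i ∈ Finset.range (w k).1,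
      (cell k).indicator h ((w k).2 i) ∂baseLaw μ = ∫⁻ x in cell k, h x ∂μ := by
    intro k
    rw [baseLaw, lintegral_comp_eval_infinitePi (fun k => cellLaw (cellIntensity μ k)) k
      (f := fun c => ∑ i ∈ Finset.range c.1, (cell k).indicator h (c.2 i)) (hm k),
      lintegral_cellSum _ (hh.indicator (measurableSet_cell k)),
      lintegral_indicator (measurableSet_cell k)]
    simp [cellIntensity, Measure.restrict_restrict (measurableSet_cell k)]
  simp_rw [this]
  rw [← lintegral_iUnion measurableSet_cell pairwise_disjoint_cell, iUnion_cell,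
    setLIntegral_univ]

variable {μ}

lemma ae_integrable_process {g : ℝ → ℝ} (hg : Measurable g) (hi : Integrable g μ) :
    ∀ᵐ w ∂baseLaw μ, Integrable g (process w).1 := by
  have h1 : ∫⁻ w, ∫⁻ x, ‖g x‖ₑ ∂(process w).1 ∂baseLaw μ ≠ ⊤ := by
    rw [lintegral_lintegral_process μ hg.enorm]
    exact hi.2.ne
  filter_upwards [ae_lt_top (measurable_lintegral_process hg.enorm) h1] with w hw
  exact ⟨hg.aestronglyMeasurable, hw⟩

lemma tendsto_integral_process {g : ℝ → ℝ} (hg : Measurable g) {w : ℕ → ℕ × (ℕ → ℝ)}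
    (hi : Integrable g (process w).1) :
    Tendsto (fun K => ∑ k ∈ Finset.range K,
        ∑ i ∈ Finset.range (w k).1, (cell k).indicator g ((w k).2 i)) atTop
      (𝓝 (∫ x, g x ∂(process w).1)) := by
  have := (hasSum_integral_measure (μ := fun k => cellMeasure k (w k)) hi).tendsto_sum_nat
  simpa only [integral_cellMeasure _ _ hg.stronglyMeasurable, process] using this

lemma measurable_process : Measurable process := by
  refine LocFinMeasure.measurable_of_integral fun f => ?_
  have hf : Measurable f := f.continuous.measurable
  refine measurable_of_tendsto_metrizable (fun K => ?_)
    (tendsto_pi_nhds.2 fun w =>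
      tendsto_integral_process hf (LocFinMeasure.integrable f (process w)))
  exact Finset.measurable_fun_sum _ fun k _ =>
    (measurable_cellSum (hf.indicator (measurableSet_cell k))).comp (measurable_pi_apply k)

/-- The characteristic functional of the Poisson process, for every integrable function. -/
theorem integral_cexp_process {g : ℝ → ℝ} (hg : Measurable g) (hi : Integrable g μ) :
    ∫ w, Complex.exp (((∫ x, g x ∂(process w).1 : ℝ) : ℂ) * Complex.I) ∂baseLaw μ =
      Complex.exp (∫ x, (Complex.exp ((g x : ℂ) * Complex.I) - 1) ∂μ) := by
  let Y : ℕ → (ℕ → ℕ × (ℕ → ℝ)) → ℝ := fun k w =>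
    ∑ i ∈ Finset.range (w k).1, (cell k).indicator g ((w k).2 i)
  have hm := fun k => measurable_cellSum (hg.indicator (measurableSet_cell k))
  have hY : ∀ k, Measurable (Y k) := fun k => (hm k).comp (measurable_pi_apply k)
  have hlim : Tendsto (fun K => ∫ w, Complex.exp (((∑ k ∈ Finset.range K, Y k w : ℝ) : ℂ) *
      Complex.I) ∂baseLaw μ) atTop
      (𝓝 (∫ w, Complex.exp (((∫ x, g x ∂(process w).1 : ℝ) : ℂ) * Complex.I) ∂baseLaw μ)) := by
    refine tendsto_integral_of_dominated_convergence (fun _ => 1) (fun K => ?_)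
      (integrable_const _) (fun K => ae_of_all _ fun w => ?_) ?_
    · exact Measurable.aestronglyMeasurable (by fun_prop)
    · rw [Complex.norm_exp_ofReal_mul_I]
    · filter_upwards [ae_integrable_process hg hi] with w hw
      have h1 := tendsto_integral_process hg hw
      have h2 : Continuous fun y : ℝ => Complex.exp ((y : ℂ) * Complex.I) := by fun_prop
      exact (h2.tendsto _).comp h1
  have hind : ∀ K : ℕ, ∫ w, Complex.exp (((∑ k ∈ Finset.range K, Y k w : ℝ) : ℂ) *
      Complex.I) ∂baseLaw μ = Complex.exp (∑ k ∈ Finset.range K,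
        ∫ x in cell k, (Complex.exp ((g x : ℂ) * Complex.I) - 1) ∂μ) := by
    intro K
    have h1 : iIndepFun (fun (k : Fin K) w => Complex.exp ((Y k w : ℂ) * Complex.I))
        (baseLaw μ) :=
      (iIndepFun_infinitePi (P := fun k => cellLaw (cellIntensity μ k))
        (X := fun k c => Complex.exp (((∑ i ∈ Finset.range c.1,
          (cell k).indicator g (c.2 i) : ℝ) : ℂ) * Complex.I))
        (fun k => by have := hm k; fun_prop)).precomp Fin.val_injective
    have h2 := h1.integral_fun_prod_eq_prod_integral fun i =>
      Measurable.aestronglyMeasurable (by fun_prop)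
    calc _ = ∫ w, ∏ k : Fin K, Complex.exp ((Y k w : ℂ) * Complex.I) ∂baseLaw μ := by
          refine integral_congr_ae (ae_of_all _ fun x => ?_)
          simp only
          rw [← Complex.exp_sum, Finset.sum_range, Complex.ofReal_sum, Finset.sum_mul]
      _ = ∏ k : Fin K, Complex.exp
          (∫ x in cell k, (Complex.exp ((g x : ℂ) * Complex.I) - 1) ∂μ) := by
          rw [h2]
          refine Finset.prod_congr rfl fun k _ => ?_
          have h3 := integral_cexp_cellSum (cellIntensity μ k)
            (hg.indicator (measurableSet_cell k))
          rw [← integral_comp_eval_infinitePi (fun k => cellLaw (cellIntensity μ k)) (k : ℕ)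
            (f := fun c => Complex.exp (((∑ i ∈ Finset.range c.1,
              (cell k).indicator g (c.2 i) : ℝ) : ℂ) * Complex.I))
            (by have := hm k; fun_prop)] at h3
          refine Eq.trans h3 ?_
          congr 1
          refine setIntegral_congr_fun (measurableSet_cell k) fun x hx => ?_
          simp only [Set.indicator_of_mem hx]
      _ = _ := by rw [← Complex.exp_sum, Finset.sum_range]
  have hlim2 : Tendsto (fun K => Complex.exp (∑ k ∈ Finset.range K,
        ∫ x in cell k, (Complex.exp ((g x : ℂ) * Complex.I) - 1) ∂μ)) atTop
      (𝓝 (Complex.exp (∫ x, (Complex.exp ((g x : ℂ) * Complex.I) - 1) ∂μ))) := by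
    refine (Complex.continuous_exp.tendsto _).comp ?_
    have hint : Integrable (fun x => Complex.exp ((g x : ℂ) * Complex.I) - 1) μ := by
      refine hi.mono (by fun_prop) (ae_of_all _ fun x => ?_)
      rw [mul_comm]
      exact Real.norm_exp_I_mul_ofReal_sub_one_le
    have := (hasSum_integral_iUnion measurableSet_cell pairwise_disjoint_cell
      (hint.integrableOn (s := ⋃ k, cell k))).tendsto_sum_nat
    rwa [iUnion_cell, setIntegral_univ] at this
  simp_rw [hind] at hlim
  exact tendsto_nhds_unique hlim hlim2

/-- The joint characteristic function of the counts of disjoint sets. -/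
lemma integral_cexp_counts {n : ℕ} {B : Fin n → Set ℝ} (hB : ∀ i, MeasurableSet (B i))
    (hμ : ∀ i, μ (B i) ≠ ⊤) (hd : Pairwise fun i j => Disjoint (B i) (B j)) (t : Fin n → ℝ) :
    ∫ w, Complex.exp (((∑ i, t i * (process w).1.real (B i) : ℝ) : ℂ) * Complex.I) ∂baseLaw μ =
      ∏ i, Complex.exp ((μ (B i)).toNNReal * (Complex.exp (t i * Complex.I) - 1)) := by
  let g : ℝ → ℝ := fun x => ∑ i, (B i).indicator (fun _ => t i) x
  have hg : Measurable g :=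
    Finset.measurable_fun_sum _ fun i _ => measurable_const.indicator (hB i)
  have hgi : ∀ i, Integrable ((B i).indicator fun _ => t i) μ := fun i =>
    (integrable_indicator_iff (hB i)).2 (integrableOn_const (hμ i))
  have hint : Integrable g μ := integrable_finsetSum _ fun i _ => hgi i
  have h1 : ∀ᵐ w ∂baseLaw μ, ∫ x, g x ∂(process w).1 =
      ∑ i, t i * (process w).1.real (B i) := by
    have : ∀ i, ∀ᵐ w ∂baseLaw μ, Integrable ((B i).indicator fun _ => t i) (process w).1 :=
      fun i => ae_integrable_process (measurable_const.indicator (hB i)) (hgi i)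
    filter_upwards [ae_all_iff.2 this] with w hw
    rw [integral_finsetSum _ fun i _ => hw i]
    refine Finset.sum_congr rfl fun i _ => ?_
    rw [integral_indicator (hB i), setIntegral_const, smul_eq_mul, mul_comm]
  have h2 : ∀ x, Complex.exp ((g x : ℂ) * Complex.I) - 1 =
      ∑ i, (B i).indicator (fun _ => Complex.exp (t i * Complex.I) - 1) x := by
    intro x
    by_cases hx : ∃ i, x ∈ B i
    · obtain ⟨i, hi⟩ := hx
      have hj : ∀ j, j ≠ i → x ∉ B j := fun j hj hxj =>
        Set.disjoint_left.1 (hd hj) hxj hi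
      have e1 : g x = t i := by
        simp only [g]
        rw [Finset.sum_eq_single i (fun j _ hji => Set.indicator_of_notMem (hj j hji) _)
          (by simp), Set.indicator_of_mem hi]
      rw [Finset.sum_eq_single i (fun j _ hji => Set.indicator_of_notMem (hj j hji) _)
          (by simp), Set.indicator_of_mem hi, e1]
    · push Not at hx
      have e1 : g x = 0 :=
        Finset.sum_eq_zero fun i _ => Set.indicator_of_notMem (hx i) _
      rw [Finset.sum_eq_zero fun i _ => Set.indicator_of_notMem (hx i) _, e1]
      simp
  calc _ = ∫ w, Complex.exp (((∫ x, g x ∂(process w).1 : ℝ) : ℂ) * Complex.I) ∂baseLaw μ := by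
        refine integral_congr_ae ?_
        filter_upwards [h1] with w hw
        rw [hw]
    _ = _ := by
        rw [integral_cexp_process hg hint]
        simp_rw [h2]
        rw [integral_finsetSum, Complex.exp_sum]
        · refine Finset.prod_congr rfl fun i _ => ?_
          rw [integral_indicator (hB i), setIntegral_const, Complex.real_smul]
          rfl
        · exact fun i _ => (integrable_indicator_iff (hB i)).2 (integrableOn_const (hμ i))

variable (μ) in
/-- The law of the Poisson process with intensity `μ`. -/
noncomputable def law : Measure LocFinMeasure := (baseLaw μ).map process

instance : IsProbabilityMeasure (law μ) :=
  Measure.isProbabilityMeasure_map measurable_process.aemeasurable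

lemma measurable_measureReal {B : Set ℝ} (hB : MeasurableSet B) :
    Measurable fun m : LocFinMeasure => m.1.real B :=
  (LocFinMeasure.measurable_measure hB).ennreal_toReal

lemma integral_law {F : LocFinMeasure → ℂ} (hF : Measurable F) :
    ∫ m, F m ∂law μ = ∫ w, F (process w) ∂baseLaw μ :=
  integral_map measurable_process.aemeasurable hF.aestronglyMeasurable

lemma map_measureReal_law {B : Set ℝ} (hB : MeasurableSet B) (hμ : μ B ≠ ⊤) :
    (law μ).map (fun m => m.1.real B) =
      (poissonMeasure (μ B).toNNReal).map (fun n : ℕ => (n : ℝ)) := by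
  have := Measure.isProbabilityMeasure_map (μ := law μ) (measurable_measureReal hB).aemeasurable
  refine Measure.ext_of_charFun (funext fun t => ?_)
  rw [charFun_map_cast_poissonMeasure, charFun_apply, integral_map
    (measurable_measureReal hB).aemeasurable (by fun_prop),
    integral_law (by have := measurable_measureReal hB; fun_prop)]
  have := integral_cexp_counts (n := 1) (B := fun _ => B) (fun _ => hB) (fun _ => hμ)
    (fun i j hij => (hij (Subsingleton.elim i j)).elim) (fun _ => t)
  simpa [mul_comm] using this

lemma ae_measure_ne_top {B : Set ℝ} (hB : MeasurableSet B) (hμ : μ B ≠ ⊤) :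
    ∀ᵐ m ∂law μ, m.1 B ≠ ⊤ := by
  refine (ae_map_iff measurable_process.aemeasurable
    (LocFinMeasure.measurable_measure hB (measurableSet_singleton ⊤)).compl).2 ?_
  have h1 : Measurable (B.indicator (1 : ℝ → ℝ≥0∞)) := measurable_one.indicator hB
  have h2 : ∫⁻ w, ∫⁻ x, B.indicator 1 x ∂(process w).1 ∂baseLaw μ ≠ ⊤ := by
    rwa [lintegral_lintegral_process μ h1, lintegral_indicator_one hB]
  filter_upwards [ae_lt_top (measurable_lintegral_process h1) h2] with w hw
  rw [lintegral_indicator_one hB] at hw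
  exact hw.ne

lemma ae_eq_ofReal {B : Set ℝ} (hB : MeasurableSet B) (hμ : μ B ≠ ⊤) :
    (fun m : LocFinMeasure => ENNReal.ofReal (m.1.real B)) =ᵐ[law μ] fun m => m.1 B := by
  filter_upwards [ae_measure_ne_top hB hμ] with m hm
  exact ofReal_measureReal hm

/-- The superposition has the defining properties of a Poisson point process. -/
theorem isPoissonPointProcessLaw_law : IsPoissonPointProcessLaw μ (law μ) where
  poisson B hB hμ := by
    refine ⟨(LocFinMeasure.measurable_measure hB).aemeasurable, ?_⟩
    rw [← Measure.map_congr (ae_eq_ofReal hB hμ)]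
    have h := Measure.map_map (μ := law μ) ENNReal.measurable_ofReal (measurable_measureReal hB)
    rw [map_measureReal_law hB hμ, Measure.map_map ENNReal.measurable_ofReal
      (measurable_of_countable _)] at h
    rw [← Function.comp_def, ← h]
    congr 1
    funext n
    simp
  indep n B hB hμ hd := by
    have h1 : iIndepFun (fun i (m : LocFinMeasure) => m.1.real (B i)) (law μ) := by
      rw [iIndepFun_iff_charFun_pi fun i => (measurable_measureReal (hB i)).aemeasurable]
      intro t
      have hm : Measurable fun m : LocFinMeasure =>
          WithLp.toLp 2 fun i => m.1.real (B i) :=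
        (WithLp.measurable_toLp 2 _).comp
          (measurable_pi_lambda _ fun i => measurable_measureReal (hB i))
      have h2 := integral_cexp_counts hB hμ hd t
      rw [charFun_apply, integral_map hm.aemeasurable (by fun_prop), integral_law (by fun_prop)]
      refine Eq.trans ?_ (h2.trans (Finset.prod_congr rfl fun i _ => ?_))
      · refine integral_congr_ae (ae_of_all _ fun w => ?_)
        simp [PiLp.inner_apply]
      · rw [← charFun_map_cast_poissonMeasure, ← map_measureReal_law (hB i) (hμ i)]
    exact (h1.comp (fun _ => ENNReal.ofReal) fun _ => ENNReal.measurable_ofReal).congr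
      fun i => ae_eq_ofReal (hB i) (hμ i)

lemma charFunctional_law (f : C_c(ℝ, ℝ)) :
    LocFinMeasure.charFunctional (law μ) f =
      Complex.exp (∫ x, (Complex.exp ((f x : ℂ) * Complex.I) - 1) ∂μ) := by
  have hf := LocFinMeasure.continuous_integral f
  have h2 : Measurable fun m : LocFinMeasure =>
    Complex.exp (((∫ x, f x ∂m.1 : ℝ) : ℂ) * Complex.I) := Continuous.measurable (by fun_prop)
  exact (integral_law h2).trans (integral_cexp_process f.continuous.measurable
    (f.continuous.integrable_of_hasCompactSupport f.hasCompactSupport))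

end PoissonProcess

/-! ### Gaussian integration by parts -/

namespace Gaussian

lemma hasDerivAt_gaussianPDFReal (x : ℝ) :
    HasDerivAt (gaussianPDFReal 0 1) (-x * gaussianPDFReal 0 1 x) x := by
  have h1 : HasDerivAt (fun y : ℝ => -(y - 0) ^ 2 / (2 * (1 : ℝ≥0))) (-x) x := by
    have := (((hasDerivAt_id x).sub_const 0).pow 2).neg.div_const (2 * ((1 : ℝ≥0) : ℝ))
    refine this.congr_deriv ?_
    simp
    ring
  have h2 := (h1.exp.const_mul (√(2 * Real.pi * (1 : ℝ≥0)))⁻¹)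
  rw [gaussianPDFReal_def]
  refine h2.congr_deriv ?_
  simp only
  ring

/-- Stein's identity for a standard Gaussian variable. -/
lemma integral_mul_gaussianReal {k k' : ℝ → ℂ} (hk : ∀ x, HasDerivAt k (k' x) x)
    (hk' : Measurable k') {C C' : ℝ} (hC : ∀ x, ‖k x‖ ≤ C) (hC' : ∀ x, ‖k' x‖ ≤ C') :
    ∫ x, (x : ℂ) * k x ∂gaussianReal 0 1 = ∫ x, k' x ∂gaussianReal 0 1 := by
  have hkc : Continuous k := continuous_iff_continuousAt.2 fun x => (hk x).continuousAt
  have hφ := integrable_gaussianPDFReal 0 1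
  have hφx : Integrable fun x => x * gaussianPDFReal 0 1 x := by
    have h1 : Integrable (fun x : ℝ => x) (gaussianReal 0 1) :=
      (memLp_id_gaussianReal 1).integrable le_rfl
    rw [gaussianReal_of_var_ne_zero _ one_ne_zero, gaussianPDF_def,
      integrable_withDensity_iff (by fun_prop) (by simp)] at h1
    refine h1.congr (ae_of_all _ fun x => ?_)
    simp [ENNReal.toReal_ofReal (gaussianPDFReal_nonneg 0 1 x)]
  have e1 : Integrable ((fun x => (gaussianPDFReal 0 1 x : ℂ)) * k') :=
    (hφ.ofReal (𝕜 := ℂ)).mul_bdd (c := C') hk'.aestronglyMeasurable (ae_of_all _ hC')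
  have e2 : Integrable ((fun x => ((-x * gaussianPDFReal 0 1 x : ℝ) : ℂ)) * k) := by
    refine Integrable.mul_bdd (c := C) ?_ hkc.aestronglyMeasurable (ae_of_all _ hC)
    have hneg : Integrable fun x => -x * gaussianPDFReal 0 1 x :=
      hφx.neg.congr (ae_of_all _ fun x => by simp)
    exact hneg.ofReal
  have e3 : Integrable ((fun x => (gaussianPDFReal 0 1 x : ℂ)) * k) :=
    (hφ.ofReal (𝕜 := ℂ)).mul_bdd (c := C) hkc.aestronglyMeasurable (ae_of_all _ hC)
  have h := integral_mul_deriv_eq_deriv_mul_of_integrable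
    (fun x _ => (hasDerivAt_gaussianPDFReal x).ofReal_comp) (fun x _ => hk x) e1 e2 e3
  rw [integral_gaussianReal_eq_integral_smul one_ne_zero,
    integral_gaussianReal_eq_integral_smul one_ne_zero]
  simp only [Complex.real_smul]
  rw [h, ← integral_neg]
  refine integral_congr_ae (ae_of_all _ fun x => ?_)
  simp only [Complex.ofReal_mul, Complex.ofReal_neg]
  ring

variable {Ω : Type*} [MeasurableSpace Ω] {P : Measure Ω}

/-- Gaussian integration by parts: `E (V K(U)) = ∑ j, cov(V, U j) E (∂ⱼK)(U)` for jointly Gaussian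
`V`, `U` with `V` standard. The variable `U - cov(V, U) V` is independent of `V`. -/
lemma integral_mul_comp {ι : Type*} [Fintype ι] {V : Ω → ℝ} {U : ι → Ω → ℝ}
    (hG : HasGaussianLaw (fun w => (V w, fun i => U i w)) P) (hV0 : ∫ w, V w ∂P = 0)
    (hV1 : Var[V; P] = 1) {K : (ι → ℝ) → ℂ} {K' : ι → (ι → ℝ) → ℂ}
    (hK : ∀ (x c : ι → ℝ) (s : ℝ), HasDerivAt (fun s : ℝ => K (s • c + x))
      (∑ j, c j * K' j (s • c + x)) s)
    (hKm : Measurable K) (hK'm : ∀ j, Measurable (K' j)) {C : ℝ} (hC : ∀ x, ‖K x‖ ≤ C)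
    (hC' : ∀ j x, ‖K' j x‖ ≤ C) :
    ∫ w, (V w : ℂ) * K (fun i => U i w) ∂P =
      ∑ j, (cov[V, U j; P] : ℂ) * ∫ w, K' j (fun i => U i w) ∂P := by
  have hP := hG.isProbabilityMeasure
  have hVG : HasGaussianLaw V P := hG.fst
  have hUG : HasGaussianLaw (fun w i => U i w) P := hG.snd
  have hU2 : ∀ j, MemLp (U j) 2 P := fun j => (hUG.eval j).memLp_two
  set c : ι → ℝ := fun j => cov[V, U j; P] with hc
  set W : ι → Ω → ℝ := fun j w => U j w - c j * V w with hW
  have hind : IndepFun V (fun w j => W j w) P := by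
    let L : ℝ × (ι → ℝ) →L[ℝ] (Unit → ℝ) × (ι → ℝ) :=
      (ContinuousLinearMap.pi fun _ => ContinuousLinearMap.fst ℝ ℝ (ι → ℝ)).prod
        (ContinuousLinearMap.pi fun j =>
          (ContinuousLinearMap.proj j).comp (ContinuousLinearMap.snd ℝ ℝ (ι → ℝ)) -
            c j • ContinuousLinearMap.fst ℝ ℝ (ι → ℝ))
    have h1 : HasGaussianLaw (fun w => ((fun _ : Unit => V w), fun j => W j w)) P :=
      hG.map_fun L
    have h2 := h1.indepFun_of_covariance_eval (X := fun _ : Unit => V) (Y := W) fun _ j => by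
      rw [hW]
      rw [covariance_fun_sub_right hVG.memLp_two (hU2 j) (hVG.memLp_two.const_mul _),
        covariance_const_mul_right, covariance_self hVG.aemeasurable, hV1, hc]
      ring
    exact h2.comp (measurable_pi_apply ()) measurable_id
  have hWm : AEMeasurable (fun w j => W j w) P :=
    aemeasurable_pi_lambda _ fun j => (hU2 j).aemeasurable.sub (hVG.aemeasurable.const_mul _)
  have hVlaw : P.map V = gaussianReal 0 1 := by
    rw [hVG.map_eq_gaussianReal, hV0, hV1, Real.toNNReal_one]
  have hmap : P.map (fun w => (V w, fun j => W j w)) =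
      (gaussianReal 0 1).prod (P.map fun w j => W j w) := by
    rw [← hVlaw]
    exact (indepFun_iff_map_prod_eq_prod_map_map hVG.aemeasurable hWm).1 hind
  have hWprob : IsProbabilityMeasure (P.map fun w j => W j w) :=
    Measure.isProbabilityMeasure_map hWm
  have hVW : AEMeasurable (fun w => (V w, fun j => W j w)) P := hVG.aemeasurable.prodMk hWm
  have hUVW : ∀ w, (fun i => U i w) = V w • c + fun j => W j w := by
    intro w
    funext j
    simp [hW, mul_comm]
  have hm : Measurable fun p : ℝ × (ι → ℝ) => p.1 • c + p.2 := by fun_prop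
  have hI : ∀ {F : ℝ × (ι → ℝ) → ℂ}, Measurable F →
      Integrable F ((gaussianReal 0 1).prod (P.map fun w j => W j w)) →
      ∫ w, F (V w, fun j => W j w) ∂P =
        ∫ x, ∫ v, F (v, x) ∂gaussianReal 0 1 ∂(P.map fun w j => W j w) := by
    intro F hF hi
    rw [← integral_prod_symm _ hi, ← hmap, integral_map hVW hF.aestronglyMeasurable]
  have hint : ∀ j, Integrable (fun p : ℝ × (ι → ℝ) => K' j (p.1 • c + p.2))
      ((gaussianReal 0 1).prod (P.map fun w j => W j w)) := fun j =>
    Integrable.of_bound ((hK'm j).comp hm).aestronglyMeasurable C (ae_of_all _ fun p => hC' j _)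
  calc ∫ w, (V w : ℂ) * K (fun i => U i w) ∂P
      = ∫ x, ∫ v, (v : ℂ) * K (v • c + x) ∂gaussianReal 0 1 ∂(P.map fun w j => W j w) := by
        simp_rw [hUVW]
        refine hI (F := fun p => (p.1 : ℂ) * K (p.1 • c + p.2)) (by fun_prop) ?_
        refine Integrable.mul_bdd (c := C) ?_ (hKm.comp hm).aestronglyMeasurable
          (ae_of_all _ fun p => hC _)
        exact (((memLp_id_gaussianReal 1).integrable le_rfl).ofReal (𝕜 := ℂ)).comp_fst _
    _ = ∫ x, ∫ v, ∑ j, c j * K' j (v • c + x) ∂gaussianReal 0 1 ∂(P.map fun w j => W j w) := by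
        refine integral_congr_ae (ae_of_all _ fun x => ?_)
        refine integral_mul_gaussianReal (hK x c) ?_ (fun v => hC _)
          (C' := ∑ j, |c j| * C) fun v => ?_
        · refine Finset.measurable_fun_sum _ fun j _ => ?_
          have := hK'm j
          fun_prop
        · refine (norm_sum_le _ _).trans (Finset.sum_le_sum fun j _ => ?_)
          rw [norm_mul, Complex.norm_real]
          exact mul_le_mul_of_nonneg_left (hC' j _) (abs_nonneg _)
    _ = ∫ w, ∑ j, c j * K' j (fun i => U i w) ∂P := by
        simp_rw [hUVW]
        refine (hI (F := fun p => ∑ j, c j * K' j (p.1 • c + p.2)) ?_ ?_).symm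
        · refine Finset.measurable_fun_sum _ fun j _ => ?_
          have := hK'm j
          fun_prop
        · exact integrable_finsetSum _ fun j _ => (hint j).const_mul _
    _ = _ := by
        rw [integral_finsetSum]
        · simp_rw [integral_const_mul]
          rfl
        · intro j _
          refine Integrable.const_mul ?_ _
          exact Integrable.of_bound
            ((hK'm j).comp_aemeasurable hUG.aemeasurable).aestronglyMeasurable C
            (ae_of_all _ fun p => hC' j _)

/-! ### A bound for two correlated Gaussian variables -/

/-- The joint density of two standard Gaussian variables with correlation `ρ` is at most
`exp (-u² / (1 + |ρ|))` on `[u, ∞)²`. Written with `a` and the residual `y - ρ a`. -/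
lemma gaussianPDFReal_mul_le {ρ u a y : ℝ} (hρ : |ρ| ≤ 1 / 2) (hu : 0 ≤ u) (ha : u ≤ a)
    (hy : u ≤ y) :
    gaussianPDFReal 0 1 a * gaussianPDFReal 0 (1 - ρ ^ 2).toNNReal (y - ρ * a) ≤
      Real.exp (-(u ^ 2 / (1 + |ρ|))) := by
  have hρ2 : ρ ^ 2 ≤ 1 / 4 := by
    rw [← sq_abs]
    nlinarith [abs_nonneg ρ]
  have hs : 0 < 1 - ρ ^ 2 := by linarith
  have hc : ((1 - ρ ^ 2).toNNReal : ℝ) = 1 - ρ ^ 2 := Real.coe_toNNReal _ hs.le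
  simp only [gaussianPDFReal, hc, NNReal.coe_one, sub_zero, mul_one]
  have hpi := Real.pi_gt_three
  have h1 : (√(2 * Real.pi))⁻¹ ≤ 1 := inv_le_one_of_one_le₀ (Real.one_le_sqrt.2 (by linarith))
  have h2 : (√(2 * Real.pi * (1 - ρ ^ 2)))⁻¹ ≤ 1 :=
    inv_le_one_of_one_le₀ (Real.one_le_sqrt.2 (by nlinarith))
  have hpos : 0 < 1 + |ρ| := by positivity
  have hneg : 0 < 1 - |ρ| := by linarith
  have key : u ^ 2 / (1 + |ρ|) ≤ a ^ 2 / 2 + (y - ρ * a) ^ 2 / (2 * (1 - ρ ^ 2)) := by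
    have e1 : a ^ 2 / 2 + (y - ρ * a) ^ 2 / (2 * (1 - ρ ^ 2)) =
        (a ^ 2 + y ^ 2 - 2 * ρ * (a * y)) / (2 * (1 - ρ ^ 2)) := by
      field_simp
      ring
    have e2 : u ^ 2 / (1 + |ρ|) = (2 * (1 - |ρ|) * u ^ 2) / (2 * (1 - ρ ^ 2)) := by
      rw [← sq_abs ρ]
      have : 1 - |ρ| ^ 2 = (1 - |ρ|) * (1 + |ρ|) := by ring
      rw [this]
      field_simp
    rw [e1, e2]
    have hay : u ^ 2 ≤ a * y := by nlinarith
    have hay0 : 0 ≤ a * y := (sq_nonneg u).trans hay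
    have e3 : ρ * (a * y) ≤ |ρ| * (a * y) := mul_le_mul_of_nonneg_right (le_abs_self ρ) hay0
    have e4 : (1 - |ρ|) * u ^ 2 ≤ (1 - |ρ|) * (a * y) := mul_le_mul_of_nonneg_left hay hneg.le
    refine div_le_div_of_nonneg_right ?_ (by positivity)
    nlinarith [sq_nonneg (a - y)]
  calc _ = ((√(2 * Real.pi))⁻¹ * (√(2 * Real.pi * (1 - ρ ^ 2)))⁻¹) *
        Real.exp (-(a ^ 2 / 2 + (y - ρ * a) ^ 2 / (2 * (1 - ρ ^ 2)))) := by
        rw [neg_add, Real.exp_add, ← neg_div, ← neg_div]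
        ring
    _ ≤ 1 * Real.exp (-(u ^ 2 / (1 + |ρ|))) := by
        refine mul_le_mul ?_ (Real.exp_le_exp.2 (neg_le_neg key)) (Real.exp_pos _).le zero_le_one
        exact mul_le_one₀ h1 (by positivity) h2
    _ = _ := one_mul _

/-- Two standard jointly Gaussian variables with correlation `ρ` both fall into `[u, u + δ]` with
probability at most `δ² exp (-u² / (1 + |ρ|))`. -/
lemma measureReal_window_le {A B : Ω → ℝ} (hG : HasGaussianLaw (fun w => (A w, B w)) P)
    (hA0 : ∫ w, A w ∂P = 0) (hB0 : ∫ w, B w ∂P = 0) (hA1 : Var[A; P] = 1) (hB1 : Var[B; P] = 1)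
    (hρ : |cov[A, B; P]| ≤ 1 / 2) {u δ : ℝ} (hu : 0 ≤ u) (hδ : 0 ≤ δ) :
    P.real {w | A w ∈ Set.Icc u (u + δ) ∧ B w ∈ Set.Icc u (u + δ)} ≤
      δ ^ 2 * Real.exp (-(u ^ 2 / (1 + |cov[A, B; P]|))) := by
  have hP := hG.isProbabilityMeasure
  set ρ := cov[A, B; P] with hρdef
  have hAG : HasGaussianLaw A P := hG.fst
  have hBG : HasGaussianLaw B P := hG.snd
  set W : Ω → ℝ := fun w => B w - ρ * A w with hW
  have hGW : HasGaussianLaw (fun w => (A w, W w)) P :=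
    hG.map_fun ((ContinuousLinearMap.fst ℝ ℝ ℝ).prod
      (ContinuousLinearMap.snd ℝ ℝ ℝ - ρ • ContinuousLinearMap.fst ℝ ℝ ℝ))
  have hAA : cov[A, A; P] = 1 := by rw [covariance_self hAG.aemeasurable, hA1]
  have hBB : cov[B, B; P] = 1 := by rw [covariance_self hBG.aemeasurable, hB1]
  have hρA := hAG.memLp_two.const_mul ρ
  have hind : IndepFun A W P := by
    refine hGW.indepFun_of_covariance_eq_zero ?_
    rw [hW, covariance_fun_sub_right hAG.memLp_two hBG.memLp_two hρA,
      covariance_const_mul_right, hAA, ← hρdef]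
    ring
  have hWG : HasGaussianLaw W P := hGW.snd
  have hW0 : ∫ w, W w ∂P = 0 := by
    rw [hW, integral_sub hBG.integrable (hAG.integrable.const_mul _), integral_const_mul, hA0, hB0]
    ring
  have hW1 : Var[W; P] = 1 - ρ ^ 2 := by
    rw [← covariance_self hWG.aemeasurable, hW, covariance_fun_sub_fun_sub hBG.memLp_two hρA
      hBG.memLp_two hρA, covariance_const_mul_left, covariance_const_mul_left,
      covariance_const_mul_right, covariance_const_mul_right, hAA, hBB, covariance_comm B A,
      ← hρdef]
    ring
  have hρ2 : ρ ^ 2 ≤ 1 / 4 := by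
    rw [← sq_abs]
    nlinarith [abs_nonneg ρ]
  have hs : (1 - ρ ^ 2).toNNReal ≠ 0 := by
    rw [Ne, Real.toNNReal_eq_zero]
    linarith
  have hmap : P.map (fun w => (A w, W w)) =
      (gaussianReal 0 1).prod (gaussianReal 0 (1 - ρ ^ 2).toNNReal) := by
    rw [(indepFun_iff_map_prod_eq_prod_map_map hAG.aemeasurable hWG.aemeasurable).1 hind,
      hAG.map_eq_gaussianReal, hWG.map_eq_gaussianReal, hA0, hA1, hW0, hW1, Real.toNNReal_one]
  set I := Set.Icc u (u + δ) with hI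
  set S : Set (ℝ × ℝ) := {p | p.1 ∈ I ∧ p.2 + ρ * p.1 ∈ I} with hS
  have hSm : MeasurableSet S :=
    (measurable_fst measurableSet_Icc).inter
      ((by fun_prop : Measurable fun p : ℝ × ℝ => p.2 + ρ * p.1) measurableSet_Icc)
  have hset : {w | A w ∈ I ∧ B w ∈ I} = (fun w => (A w, W w)) ⁻¹' S := by
    ext w
    simp [hS, hW]
  set c := Real.exp (-(u ^ 2 / (1 + |ρ|))) with hcdef
  have hbound : P {w | A w ∈ I ∧ B w ∈ I} ≤ ENNReal.ofReal (δ ^ 2 * c) := by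
    rw [hset, ← Measure.map_apply_of_aemeasurable (hAG.aemeasurable.prodMk hWG.aemeasurable) hSm,
      hmap, Measure.prod_apply hSm, gaussianReal_of_var_ne_zero 0 one_ne_zero,
      lintegral_withDensity_eq_lintegral_mul _ (measurable_gaussianPDF 0 1)
        (measurable_measure_prodMk_left hSm)]
    have hle : ∀ a : ℝ, (gaussianPDF 0 1 * fun a : ℝ =>
        gaussianReal 0 (1 - ρ ^ 2).toNNReal (Prod.mk a ⁻¹' S)) a ≤
        I.indicator (fun _ => ENNReal.ofReal (c * δ)) a := by
      intro a
      by_cases ha : a ∈ I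
      · have hpre : Prod.mk a ⁻¹' S = Set.Icc (u - ρ * a) (u + δ - ρ * a) := by
          ext y
          simp only [hS, Set.mem_preimage, Set.mem_ofPred_eq, hI, Set.mem_Icc,
            sub_le_iff_le_add, le_sub_iff_add_le]
          exact and_iff_right ha
        rw [Set.indicator_of_mem ha, Pi.mul_apply, gaussianReal_apply 0 hs, hpre,
          ← lintegral_const_mul _ (measurable_gaussianPDF 0 _)]
        calc ∫⁻ y in Set.Icc (u - ρ * a) (u + δ - ρ * a),
              gaussianPDF 0 1 a * gaussianPDF 0 (1 - ρ ^ 2).toNNReal y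
            ≤ ∫⁻ y in Set.Icc (u - ρ * a) (u + δ - ρ * a), ENNReal.ofReal c := by
              refine setLIntegral_mono measurable_const fun y hy => ?_
              rw [gaussianPDF, gaussianPDF, ← ENNReal.ofReal_mul (gaussianPDFReal_nonneg _ _ _)]
              refine ENNReal.ofReal_le_ofReal ?_
              have := gaussianPDFReal_mul_le (y := y + ρ * a) hρ hu ha.1 (by linarith [hy.1])
              rwa [add_sub_cancel_right] at this
          _ = ENNReal.ofReal (c * δ) := by
              rw [setLIntegral_const, Real.volume_Icc, ← ENNReal.ofReal_mul (Real.exp_pos _).le]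
              congr 2
              ring
      · have hpre : Prod.mk a ⁻¹' S = ∅ :=
          Set.eq_empty_of_forall_notMem fun y hy => ha hy.1
        rw [Pi.mul_apply, hpre, measure_empty, mul_zero]
        exact zero_le
    refine (lintegral_mono hle).trans ?_
    rw [lintegral_indicator_const measurableSet_Icc, Real.volume_Icc,
      ← ENNReal.ofReal_mul (by positivity)]
    refine ENNReal.ofReal_le_ofReal (le_of_eq ?_)
    ring
  exact ENNReal.toReal_le_of_le_ofReal (by positivity) hbound

end Gaussian

/-! ### Gaussian interpolation -/

namespace Gaussian

variable {Ω : Type*} [MeasurableSpace Ω] {P : Measure Ω}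

lemma covariance_linearCombination [IsFiniteMeasure P] {X Y Z W : Ω → ℝ} (hX : MemLp X 2 P)
    (hY : MemLp Y 2 P) (hZ : MemLp Z 2 P) (hW : MemLp W 2 P) (a b c d : ℝ) :
    cov[fun w => a * X w + b * Y w, fun w => c * Z w + d * W w; P] =
      a * c * cov[X, Z; P] + a * d * cov[X, W; P] + b * c * cov[Y, Z; P] +
        b * d * cov[Y, W; P] := by
  have h1 := covariance_add_left (hX.const_mul a) (hY.const_mul b)
    ((hZ.const_mul c).add (hW.const_mul d))
  have h2 := covariance_add_right (hX.const_mul a) (hZ.const_mul c) (hW.const_mul d)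
  have h3 := covariance_add_right (hY.const_mul b) (hZ.const_mul c) (hW.const_mul d)
  rw [h2, h3] at h1
  simp only [covariance_const_mul_left, covariance_const_mul_right] at h1
  refine Eq.trans h1 ?_
  ring

variable {ι : Type*} [Fintype ι]

/-- The phase `exp (i ∑ j, g (x j))`. -/
noncomputable def phase (g : ℝ → ℝ) (x : ι → ℝ) : ℂ :=
  Complex.exp (((∑ j, g (x j) : ℝ) : ℂ) * Complex.I)

lemma norm_phase (g : ℝ → ℝ) (x : ι → ℝ) : ‖phase g x‖ = 1 :=
  Complex.norm_exp_ofReal_mul_I _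

lemma measurable_phase {g : ℝ → ℝ} (hg : Measurable g) :
    Measurable (phase g : (ι → ℝ) → ℂ) := by
  unfold phase
  have : Measurable fun x : ι → ℝ => ∑ j, g (x j) :=
    Finset.measurable_fun_sum _ fun j _ => hg.comp (measurable_pi_apply j)
  fun_prop

/-- The first partial derivatives of the phase, where `g'` stands for the derivative of `g`. -/
noncomputable def phaseDeriv (g g' : ℝ → ℝ) (i : ι) (x : ι → ℝ) : ℂ :=
  (g' (x i) : ℂ) * Complex.I * phase g x

lemma hasDerivAt_phase {g g' : ℝ → ℝ} (hg : ∀ x, HasDerivAt g (g' x) x) {γ : ℝ → ι → ℝ}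
    {γ' : ι → ℝ} {s : ℝ} (hγ : ∀ j, HasDerivAt (fun s => γ s j) (γ' j) s) :
    HasDerivAt (fun s => phase g (γ s)) (∑ j, (γ' j : ℂ) * phaseDeriv g g' j (γ s)) s := by
  have h1 : HasDerivAt (fun s => ∑ j, g (γ s j)) (∑ j, g' (γ s j) * γ' j) s :=
    HasDerivAt.fun_sum fun j _ => (hg (γ s j)).comp s (hγ j)
  have h2 := (h1.ofReal_comp.mul_const Complex.I).cexp
  refine h2.congr_deriv ?_
  rw [mul_comm, Complex.ofReal_sum, Finset.sum_mul, Finset.sum_mul]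
  refine Finset.sum_congr rfl fun j _ => ?_
  rw [phaseDeriv, phase]
  push_cast
  ring

lemma norm_phaseDeriv (g g' : ℝ → ℝ) (i : ι) (x : ι → ℝ) :
    ‖phaseDeriv g g' i x‖ = |g' (x i)| := by
  rw [phaseDeriv, norm_mul, norm_mul, norm_phase, Complex.norm_I, Complex.norm_real, mul_one,
    mul_one, Real.norm_eq_abs]

variable [DecidableEq ι]

/-- The second partial derivatives of the phase, where `g'` and `g''` stand for the derivatives of
`g`. -/
noncomputable def phaseDeriv₂ (g g' g'' : ℝ → ℝ) (i j : ι) (x : ι → ℝ) : ℂ :=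
  (if i = j then (g'' (x i) : ℂ) * Complex.I * phase g x else 0) +
    (g' (x i) : ℂ) * Complex.I * phaseDeriv g g' j x

lemma hasDerivAt_phaseDeriv {g g' g'' : ℝ → ℝ} (hg : ∀ x, HasDerivAt g (g' x) x)
    (hg' : ∀ x, HasDerivAt g' (g'' x) x) (i : ι) {γ : ℝ → ι → ℝ} {γ' : ι → ℝ} {s : ℝ}
    (hγ : ∀ j, HasDerivAt (fun s => γ s j) (γ' j) s) :
    HasDerivAt (fun s => phaseDeriv g g' i (γ s))
      (∑ j, (γ' j : ℂ) * phaseDeriv₂ g g' g'' i j (γ s)) s := by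
  have h1 : HasDerivAt (fun s => g' (γ s i)) (g'' (γ s i) * γ' i) s :=
    (hg' (γ s i)).comp s (hγ i)
  have h2 := (h1.ofReal_comp.mul_const Complex.I).mul (hasDerivAt_phase hg hγ)
  refine h2.congr_deriv ?_
  simp only [phaseDeriv₂, mul_add, Finset.sum_add_distrib, mul_ite, mul_zero]
  rw [Finset.sum_ite_eq Finset.univ i, if_pos (Finset.mem_univ i), Finset.mul_sum]
  congr 1
  · push_cast
    ring
  · refine Finset.sum_congr rfl fun j _ => ?_
    ring

/-- Comparison of two jointly Gaussian families, the second one i.i.d.: interpolating along a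
quarter circle and integrating by parts, only the pairs of distinct indices contribute, each with
its covariance and the probability that both variables visit the support of `g'`. -/
theorem norm_integral_phase_sub_le {X Z : ι → Ω → ℝ} {C : ι → ι → ℝ}
    (hG : HasGaussianLaw (fun w => ((fun i => X i w), (fun i => Z i w))) P)
    (hX0 : ∀ i, ∫ w, X i w ∂P = 0) (hZ0 : ∀ i, ∫ w, Z i w ∂P = 0)
    (hXX : ∀ i j, cov[X i, X j; P] = C i j) (hC1 : ∀ i, C i i = 1)
    (hZZ : ∀ i j, cov[Z i, Z j; P] = if i = j then 1 else 0)
    (hXZ : ∀ i j, cov[X i, Z j; P] = 0)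
    (hC : ∀ i j, i ≠ j → |C i j| ≤ 1 / 2)
    {g g' g'' : ℝ → ℝ} (hg : ∀ x, HasDerivAt g (g' x) x) (hg' : ∀ x, HasDerivAt g' (g'' x) x)
    (hg''m : Measurable g'') {D D' : ℝ} (hD : ∀ x, |g' x| ≤ D) (hD' : ∀ x, |g'' x| ≤ D')
    {u δ : ℝ} (hu : 0 ≤ u) (hδ : 0 ≤ δ) (hsupp : ∀ x, g' x ≠ 0 → x ∈ Set.Icc u (u + δ)) :
    ‖∫ w, phase g (fun i => X i w) ∂P - ∫ w, phase g (fun i => Z i w) ∂P‖ ≤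
      2 * ∑ i, ∑ j, if i = j then 0 else
        |C i j| * (D ^ 2 * (δ ^ 2 * Real.exp (-(u ^ 2 / (1 + |C i j|))))) := by
  have hP := hG.isProbabilityMeasure
  have hXG : HasGaussianLaw (fun w i => X i w) P := hG.fst
  have hZG : HasGaussianLaw (fun w i => Z i w) P := hG.snd
  have hX2 : ∀ i, MemLp (X i) 2 P := fun i => (hXG.eval i).memLp_two
  have hZ2 : ∀ i, MemLp (Z i) 2 P := fun i => (hZG.eval i).memLp_two
  have hXi : ∀ i, Integrable (X i) P := fun i => (hXG.eval i).integrable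
  have hZi : ∀ i, Integrable (Z i) P := fun i => (hZG.eval i).integrable
  have hgm : Measurable g := (continuous_iff_continuousAt.2 fun x => (hg x).continuousAt).measurable
  have hg'm : Measurable g' :=
    (continuous_iff_continuousAt.2 fun x => (hg' x).continuousAt).measurable
  have hD0 : 0 ≤ D := (abs_nonneg _).trans (hD 0)
  have hD'0 : 0 ≤ D' := (abs_nonneg _).trans (hD' 0)
  have hphm : Measurable (phase g : (ι → ℝ) → ℂ) := measurable_phase hgm
  have hK1m : ∀ i : ι, Measurable (phaseDeriv g g' i) := fun i => by
    unfold phaseDeriv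
    fun_prop
  have hK2m : ∀ i j : ι, Measurable (phaseDeriv₂ g g' g'' i j) := fun i j => by
    unfold phaseDeriv₂
    have := hK1m j
    by_cases hij : i = j
    · simp only [if_pos hij]
      fun_prop
    · simp only [if_neg hij]
      fun_prop
  -- `U` turns from `Z` to `X` and `V` is its derivative in the angle. As `X` and `Z` are
  -- independent with unit variances, `U θ i` and `V θ i` are standard Gaussian for every `θ`.
  let U : ℝ → ι → Ω → ℝ := fun θ i w => Real.sin θ * X i w + Real.cos θ * Z i w
  let V : ℝ → ι → Ω → ℝ := fun θ i w => Real.cos θ * X i w + -Real.sin θ * Z i w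
  have hUV : ∀ θ i, HasGaussianLaw (fun w => (V θ i w, fun j => U θ j w)) P := by
    intro θ i
    let p : (ι → ℝ) →L[ℝ] ℝ := ContinuousLinearMap.proj i
    let p₁ := ContinuousLinearMap.fst ℝ (ι → ℝ) (ι → ℝ)
    let p₂ := ContinuousLinearMap.snd ℝ (ι → ℝ) (ι → ℝ)
    exact hG.map_fun ((Real.cos θ • p.comp p₁ + (-Real.sin θ) • p.comp p₂).prod
      (Real.sin θ • p₁ + Real.cos θ • p₂))
  have hUG : ∀ θ, HasGaussianLaw (fun w j => U θ j w) P := by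
    intro θ
    exact hG.map_fun (Real.sin θ • ContinuousLinearMap.fst ℝ (ι → ℝ) (ι → ℝ) +
      Real.cos θ • ContinuousLinearMap.snd ℝ (ι → ℝ) (ι → ℝ))
  have hUm : ∀ θ, AEMeasurable (fun w j => U θ j w) P := fun θ => (hUG θ).aemeasurable
  have hU0 : ∀ θ i, ∫ w, U θ i w ∂P = 0 := fun θ i => by
    simp only [U]
    rw [integral_add ((hXi i).const_mul _) ((hZi i).const_mul _), integral_const_mul,
      integral_const_mul, hX0, hZ0]
    ring
  have hV0 : ∀ θ i, ∫ w, V θ i w ∂P = 0 := fun θ i => by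
    simp only [V]
    rw [integral_add ((hXi i).const_mul _) ((hZi i).const_mul _), integral_const_mul,
      integral_const_mul, hX0, hZ0]
    ring
  have hZX : ∀ i j, cov[Z i, X j; P] = 0 := fun i j => by rw [covariance_comm, hXZ]
  have hUU : ∀ θ i j, cov[U θ i, U θ j; P] =
      Real.sin θ ^ 2 * C i j + Real.cos θ ^ 2 * if i = j then 1 else 0 := fun θ i j => by
    rw [covariance_linearCombination (hX2 i) (hZ2 i) (hX2 j) (hZ2 j), hXX, hXZ, hZX, hZZ]
    ring
  have hVU : ∀ θ i j, cov[V θ i, U θ j; P] =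
      Real.cos θ * Real.sin θ * (C i j - if i = j then 1 else 0) := fun θ i j => by
    rw [covariance_linearCombination (hX2 i) (hZ2 i) (hX2 j) (hZ2 j), hXX, hXZ, hZX, hZZ]
    ring
  have hVar : ∀ θ i, Var[U θ i; P] = 1 := fun θ i => by
    rw [← covariance_self ((hUG θ).eval i).aemeasurable, hUU, hC1, if_pos rfl, mul_one, mul_one,
      Real.sin_sq_add_cos_sq]
  have hVarV : ∀ θ i, Var[V θ i; P] = 1 := fun θ i => by
    rw [← covariance_self (hUV θ i).fst.aemeasurable,
      covariance_linearCombination (hX2 i) (hZ2 i) (hX2 i) (hZ2 i), hXX, hXZ, hZX, hZZ, hC1,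
      if_pos rfl]
    linear_combination Real.sin_sq_add_cos_sq θ
  let Ψ : ℝ → ℂ := fun θ => ∫ w, phase g (fun i => U θ i w) ∂P
  let Ψ' : ℝ → ℂ := fun θ => ∫ w, ∑ i, (V θ i w : ℂ) * phaseDeriv g g' i (fun j => U θ j w) ∂P
  have hVm : ∀ θ i, AEMeasurable (V θ i) P := fun θ i => (hUV θ i).fst.aemeasurable
  have hderiv : ∀ θ, HasDerivAt Ψ (Ψ' θ) θ := by
    intro θ
    refine (hasDerivAt_integral_of_dominated_loc_of_deriv_le (s := Set.univ) (μ := P)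
      (F := fun θ w => phase g (fun i => U θ i w))
      (F' := fun θ w => ∑ i, (V θ i w : ℂ) * phaseDeriv g g' i (fun j => U θ j w))
      (bound := fun w => ∑ i, D * (|X i w| + |Z i w|)) Filter.univ_mem
      (Eventually.of_forall fun θ => (hphm.comp_aemeasurable (hUm θ)).aestronglyMeasurable)
      ?_ ?_ (ae_of_all _ fun w θ _ => ?_) ?_ (ae_of_all _ fun w θ _ => ?_)).2
    · exact Integrable.of_bound (hphm.comp_aemeasurable (hUm θ)).aestronglyMeasurable 1
        (ae_of_all _ fun w => (norm_phase g _).le)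
    · refine AEMeasurable.aestronglyMeasurable (Finset.aemeasurable_fun_sum _ fun i _ => ?_)
      have h1 := (hK1m i).comp_aemeasurable (hUm θ)
      have h2 := hVm θ i
      exact (Complex.measurable_ofReal.comp_aemeasurable h2).mul h1
    · refine (norm_sum_le _ _).trans (Finset.sum_le_sum fun i _ => ?_)
      rw [norm_mul, norm_phaseDeriv, Complex.norm_real, Real.norm_eq_abs, mul_comm]
      refine mul_le_mul (hD _) ?_ (abs_nonneg _) hD0
      refine (abs_add_le _ _).trans ?_
      rw [abs_mul, abs_mul, abs_neg]
      exact add_le_add (mul_le_of_le_one_left (abs_nonneg _) (Real.abs_cos_le_one _))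
        (mul_le_of_le_one_left (abs_nonneg _) (Real.abs_sin_le_one _))
    · exact integrable_finsetSum _ fun i _ => ((hXi i).abs.add (hZi i).abs).const_mul D
    · refine hasDerivAt_phase hg (γ := fun θ i => U θ i w) fun i => ?_
      have := ((Real.hasDerivAt_sin θ).mul_const (X i w)).add
        ((Real.hasDerivAt_cos θ).mul_const (Z i w))
      exact this
  -- Integration by parts produces the covariances of `V θ i` and `U θ j`, which vanish for `i = j`.
  have hbound : ∀ θ, ‖Ψ' θ‖ ≤ ∑ i, ∑ j, if i = j then 0 else
        |C i j| * (D ^ 2 * (δ ^ 2 * Real.exp (-(u ^ 2 / (1 + |C i j|))))) := by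
    intro θ
    -- A common bound for the first and the second derivatives.
    have hK1b : ∀ (i : ι) (x : ι → ℝ), ‖phaseDeriv g g' i x‖ ≤ D' + D * D + D := fun i x => by
      rw [norm_phaseDeriv]
      have := hD (x i)
      nlinarith
    have hK2b : ∀ (i j : ι) (x : ι → ℝ), ‖phaseDeriv₂ g g' g'' i j x‖ ≤ D' + D * D + D := by
      intro i j x
      rw [phaseDeriv₂]
      refine (norm_add_le _ _).trans ?_
      have h1 : ‖(if i = j then (g'' (x i) : ℂ) * Complex.I * phase g x else 0)‖ ≤ D' := by
        split_ifs
        · rw [norm_mul, norm_mul, norm_phase, Complex.norm_I, Complex.norm_real, mul_one, mul_one]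
          exact hD' _
        · simpa using hD'0
      have h2 : ‖(g' (x i) : ℂ) * Complex.I * phaseDeriv g g' j x‖ ≤ D * D := by
        rw [norm_mul, norm_mul, norm_phaseDeriv, Complex.norm_I, Complex.norm_real, mul_one]
        exact mul_le_mul (hD _) (hD _) (abs_nonneg _) hD0
      linarith
    have hsum : Ψ' θ = ∑ i, ∑ j, (cov[V θ i, U θ j; P] : ℂ) *
        ∫ w, phaseDeriv₂ g g' g'' i j (fun k => U θ k w) ∂P := by
      simp only [Ψ']
      rw [integral_finsetSum]
      · refine Finset.sum_congr rfl fun i _ => ?_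
        refine integral_mul_comp (hUV θ i) (hV0 θ i) (hVarV θ i) (fun x c s => ?_) (hK1m i)
          (hK2m i) (hK1b i) (hK2b i)
        refine hasDerivAt_phaseDeriv hg hg' i (γ := fun s => s • c + x) fun j => ?_
        simpa using ((hasDerivAt_id s).mul_const (c j)).add_const (x j)
      · intro i _
        refine Integrable.mul_bdd (c := D) ?_
          ((hK1m i).comp_aemeasurable (hUm θ)).aestronglyMeasurable
          (ae_of_all _ fun w => by rw [norm_phaseDeriv]; exact hD _)
        exact ((hUV θ i).fst.integrable).ofReal
    rw [hsum]
    refine (norm_sum_le _ _).trans (Finset.sum_le_sum fun i _ => ?_)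
    refine (norm_sum_le _ _).trans (Finset.sum_le_sum fun j _ => ?_)
    rw [norm_mul, Complex.norm_real, Real.norm_eq_abs, hVU]
    split_ifs with hij
    · subst hij
      simp [hC1]
    · have hcs : |Real.cos θ * Real.sin θ * (C i j - 0)| ≤ |C i j| := by
        rw [sub_zero, abs_mul, abs_mul]
        refine mul_le_of_le_one_left (abs_nonneg _) ?_
        exact mul_le_one₀ (Real.abs_cos_le_one _) (abs_nonneg _) (Real.abs_sin_le_one _)
      refine mul_le_mul hcs ?_ (norm_nonneg _) (abs_nonneg _)
      set S : Set Ω := {w | U θ i w ∈ Set.Icc u (u + δ) ∧ U θ j w ∈ Set.Icc u (u + δ)} with hS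
      have hSm : NullMeasurableSet S P :=
        ((((hUG θ).eval i).aemeasurable.nullMeasurable measurableSet_Icc).inter
          (((hUG θ).eval j).aemeasurable.nullMeasurable measurableSet_Icc))
      have h1 : ∀ w, ‖phaseDeriv₂ g g' g'' i j (fun k => U θ k w)‖ ≤
          S.indicator (fun _ => D ^ 2) w := by
        intro w
        rw [phaseDeriv₂, if_neg hij, zero_add, norm_mul, norm_mul, norm_phaseDeriv, Complex.norm_I,
          Complex.norm_real, mul_one, Real.norm_eq_abs]
        by_cases hw : w ∈ S
        · rw [Set.indicator_of_mem hw, sq]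
          exact mul_le_mul (hD _) (hD _) (abs_nonneg _) hD0
        · rw [Set.indicator_of_notMem hw]
          have : g' (U θ i w) = 0 ∨ g' (U θ j w) = 0 := by
            by_contra! h
            exact hw ⟨hsupp _ h.1, hsupp _ h.2⟩
          rcases this with h | h <;> simp [h]
      have h2 : ‖∫ w, phaseDeriv₂ g g' g'' i j (fun k => U θ k w) ∂P‖ ≤ D ^ 2 * P.real S := by
        refine (norm_integral_le_of_norm_le ?_ (ae_of_all _ h1)).trans ?_
        · exact (integrable_const _).indicator₀ hSm
        · rw [integral_indicator₀ hSm, setIntegral_const, smul_eq_mul, mul_comm]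
      refine h2.trans (mul_le_mul_of_nonneg_left ?_ (sq_nonneg D))
      have hcov : |cov[U θ i, U θ j; P]| ≤ |C i j| := by
        rw [hUU, if_neg hij, mul_zero, add_zero, abs_mul, abs_of_nonneg (sq_nonneg _)]
        exact mul_le_of_le_one_left (abs_nonneg _) (Real.sin_sq_le_one θ)
      have h3 := measureReal_window_le ((hUG θ).prodMk i j) (hU0 θ i) (hU0 θ j) (hVar θ i)
        (hVar θ j) (hcov.trans (hC i j hij)) hu hδ
      refine h3.trans (mul_le_mul_of_nonneg_left (Real.exp_le_exp.2 (neg_le_neg ?_)) (sq_nonneg δ))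
      exact div_le_div_of_nonneg_left (sq_nonneg u) (by positivity) (by linarith)
  have hmv := convex_univ.norm_image_sub_le_of_norm_hasDerivWithin_le
    (fun θ _ => (hderiv θ).hasDerivWithinAt) (fun θ _ => hbound θ) (Set.mem_univ 0)
    (Set.mem_univ (Real.pi / 2))
  have e1 : Ψ (Real.pi / 2) = ∫ w, phase g (fun i => X i w) ∂P := by simp [Ψ, U]
  have e0 : Ψ 0 = ∫ w, phase g (fun i => Z i w) ∂P := by simp [Ψ, U]
  rw [e1, e0, sub_zero, Real.norm_of_nonneg (by positivity)] at hmv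
  refine hmv.trans ?_
  rw [mul_comm]
  refine mul_le_mul_of_nonneg_right (by linarith [Real.pi_le_four]) ?_
  exact (norm_nonneg _).trans (hbound 0)

end Gaussian

/-! ### Asymptotics of the rescaled Gaussian density -/

lemma scaleB_pos {M : ℝ} (hM : 0 < M) : 0 < scaleB M := Real.sqrt_pos.2 (by positivity)

lemma scaleB_sq {M : ℝ} (hM : 0 < M) : scaleB M ^ 2 = 1 / M := Real.sq_sqrt (by positivity)

lemma two_mul_log_scaleB {M : ℝ} (hM : 0 < M) : 2 * Real.log (scaleB M) = -Real.log M := by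
  rw [scaleB, Real.log_sqrt (by positivity), one_div, Real.log_inv]
  ring

/-- For `M ≥ 1` the quantity under the square root defining `a_N` is nonnegative, so that no junk
value interferes. -/
lemma centerA_sq {M : ℝ} (hM : 1 ≤ M) :
    centerA M ^ 2 = 2 * M * Real.log 2 - Real.log M - Real.log 2 := by
  have hM0 : 0 < M := by linarith
  have h1 := Real.log_le_sub_one_of_pos hM0
  have h2 := Real.log_two_gt_d9
  have h3 := Real.log_two_lt_d9
  rw [centerA, two_mul_log_scaleB hM0, Real.sq_sqrt (by nlinarith)]
  ring

lemma centerA_nonneg (M : ℝ) : 0 ≤ centerA M := Real.sqrt_nonneg _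

lemma exp_neg_centerA_sq {M : ℝ} (hM : 1 ≤ M) :
    Real.exp (-centerA M ^ 2) = 2 * M * ((2 : ℝ) ^ M)⁻¹ ^ 2 := by
  have hM0 : 0 < M := by linarith
  have h1 : -centerA M ^ 2 = Real.log 2 + Real.log M + -(Real.log 2 * M) + -(Real.log 2 * M) := by
    rw [centerA_sq hM]
    ring
  rw [h1, Real.exp_add, Real.exp_add, Real.exp_add, Real.exp_log two_pos, Real.exp_log hM0,
    Real.exp_neg, ← Real.rpow_def_of_pos two_pos]
  ring

/-- The density of the rescaled process, which is exactly `2 ^ M` times a Gaussian density. -/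
noncomputable def rescaledDensity (M t : ℝ) : ℝ :=
  1 / √Real.pi * Real.exp (-t * (centerA M * scaleB M) - t ^ 2 * scaleB M ^ 2 / 2)

lemma rescaledDensity_eq {M : ℝ} (hM : 1 ≤ M) (t : ℝ) :
    (2 : ℝ) ^ M * (scaleB M * gaussianPDFReal 0 1 (centerA M + scaleB M * t)) =
      rescaledDensity M t := by
  have hM0 : 0 < M := by linarith
  have hb := scaleB_pos hM0
  have h2M : (0 : ℝ) < 2 ^ M := by positivity
  have h1 : Real.exp (-centerA M ^ 2 / 2) = √2 * √M * ((2 : ℝ) ^ M)⁻¹ := by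
    rw [← Real.sqrt_mul_self (Real.exp_pos _).le, ← Real.exp_add, add_halves,
      exp_neg_centerA_sq hM, Real.sqrt_mul (by positivity), Real.sqrt_mul (by positivity),
      Real.sqrt_sq (by positivity)]
  have h2 : √M * scaleB M = 1 := by
    rw [scaleB, ← Real.sqrt_mul hM0.le, mul_one_div_cancel hM0.ne', Real.sqrt_one]
  rw [gaussianPDFReal, rescaledDensity]
  have h3 : -(centerA M + scaleB M * t - 0) ^ 2 / (2 * ((1 : ℝ≥0) : ℝ)) =
      -centerA M ^ 2 / 2 + (-t * (centerA M * scaleB M) - t ^ 2 * scaleB M ^ 2 / 2) := by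
    simp only [NNReal.coe_one]
    ring
  rw [h3, Real.exp_add, h1]
  simp only [NNReal.coe_one, mul_one]
  rw [Real.sqrt_mul (by norm_num)]
  have h4 : √(2 : ℝ) ≠ 0 := by positivity
  have h5 : √Real.pi ≠ 0 := (Real.sqrt_pos.2 Real.pi_pos).ne'
  field_simp
  linear_combination h2

lemma two_rpow_mul_integral {M : ℝ} (hM : 1 ≤ M) (h : ℝ → ℂ) :
    ((2 : ℝ) ^ M : ℝ) * ∫ x, h ((x - centerA M) / scaleB M) ∂gaussianReal 0 1 =
      ∫ t, rescaledDensity M t • h t := by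
  have hb := scaleB_pos (by linarith : 0 < M)
  rw [integral_gaussianReal_eq_integral_smul one_ne_zero]
  have h1 := integral_sub_right_eq_self (μ := volume)
    (fun x => gaussianPDFReal 0 1 (centerA M + x) • h (x / scaleB M)) (centerA M)
  have h2 := Measure.integral_comp_div
    (fun t => gaussianPDFReal 0 1 (centerA M + scaleB M * t) • h t) (scaleB M)
  simp only [add_sub_cancel] at h1
  simp only [mul_div_cancel₀ _ hb.ne'] at h2
  rw [h1, h2, abs_of_pos hb, Complex.real_smul, ← mul_assoc, ← Complex.ofReal_mul,
    ← integral_const_mul]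
  refine integral_congr_ae (ae_of_all _ fun t => ?_)
  simp only
  rw [← rescaledDensity_eq hM, Complex.real_smul, Complex.real_smul]
  push_cast
  ring

lemma tendsto_scaleB : Tendsto scaleB atTop (𝓝 0) := by
  have h1 : Tendsto (fun M : ℝ => 1 / M) atTop (𝓝 0) := by
    simpa only [one_div] using tendsto_inv_atTop_zero (𝕜 := ℝ)
  have h2 := (Real.continuous_sqrt.tendsto 0).comp h1
  rw [Real.sqrt_zero] at h2
  exact h2

lemma tendsto_centerA_mul_scaleB :
    Tendsto (fun M => centerA M * scaleB M) atTop (𝓝 √(2 * Real.log 2)) := by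
  have h1 : Tendsto (fun M : ℝ => Real.log M / M) atTop (𝓝 0) :=
    Real.isLittleO_log_id_atTop.tendsto_div_nhds_zero
  have h2 : Tendsto (fun M : ℝ => Real.log 2 / M) atTop (𝓝 0) :=
    tendsto_const_nhds.div_atTop tendsto_id
  have h3 : Tendsto (fun M : ℝ => √(2 * Real.log 2 - Real.log M / M - Real.log 2 / M)) atTop
      (𝓝 √(2 * Real.log 2)) := by
    refine (Real.continuous_sqrt.tendsto _).comp ?_
    simpa using (tendsto_const_nhds.sub h1).sub h2
  refine h3.congr' ?_
  filter_upwards [eventually_ge_atTop 1] with M hM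
  have hM0 : 0 < M := by linarith
  rw [← Real.sqrt_sq (mul_nonneg (centerA_nonneg M) (scaleB_pos hM0).le), mul_pow,
    centerA_sq hM, scaleB_sq hM0]
  congr 1
  field_simp

lemma limitIntensity_integral (h : ℝ → ℂ) :
    ∫ t, h t ∂limitIntensity =
      ∫ t, (1 / √Real.pi * Real.exp (-t * √(2 * Real.log 2))) • h t := by
  rw [limitIntensity, integral_withDensity_eq_integral_toReal_smul (by fun_prop)
    (ae_of_all _ fun t => ENNReal.ofReal_lt_top)]
  refine integral_congr_ae (ae_of_all _ fun t => ?_)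
  simp only
  rw [ENNReal.toReal_ofReal (by positivity)]

instance : IsLocallyFiniteMeasure limitIntensity :=
  IsLocallyFiniteMeasure.withDensity_ofReal (by fun_prop)

/-- The rescaled Gaussian law, multiplied by `2 ^ M`, converges vaguely to the limit intensity. -/
lemma tendsto_two_rpow_mul_integral {h : ℝ → ℂ} (hc : Continuous h) {K : ℝ}
    (hK : ∀ t, h t ≠ 0 → |t| ≤ K) :
    Tendsto (fun M : ℝ => (((2 : ℝ) ^ M : ℝ) : ℂ) *
      ∫ x, h ((x - centerA M) / scaleB M) ∂gaussianReal 0 1) atTop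
      (𝓝 (∫ t, h t ∂limitIntensity)) := by
  have hlim : Tendsto (fun M : ℝ => ∫ t, rescaledDensity M t • h t) atTop
      (𝓝 (∫ t, h t ∂limitIntensity)) := by
    rw [limitIntensity_integral]
    set c := √(2 * Real.log 2) + 1 with hcdef
    have hint : Integrable h := by
      refine hc.integrable_of_hasCompactSupport
        (HasCompactSupport.intro (K := Set.Icc (-K) K) isCompact_Icc fun t ht => ?_)
      by_contra h0
      exact ht (abs_le.1 (hK t h0))
    have hle : ∀ᶠ M : ℝ in atTop, centerA M * scaleB M ≤ c :=
      (tendsto_centerA_mul_scaleB.eventually_lt_const (lt_add_one _)).mono fun _ h => h.le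
    refine tendsto_integral_filter_of_dominated_convergence
      (fun t => Real.exp (K * c) * ‖h t‖) ?_ ?_ (hint.norm.const_mul _) (ae_of_all _ fun t => ?_)
    · refine Eventually.of_forall fun M => ?_
      unfold rescaledDensity
      exact Continuous.aestronglyMeasurable (by fun_prop)
    · filter_upwards [hle, eventually_gt_atTop 0] with M hM hM0
      refine ae_of_all _ fun t => ?_
      rw [norm_smul]
      by_cases h0 : h t = 0
      · simp [h0]
      · refine mul_le_mul_of_nonneg_right ?_ (norm_nonneg _)
        have hab : 0 ≤ centerA M * scaleB M := mul_nonneg (centerA_nonneg M) (scaleB_pos hM0).le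
        have h1 : -t * (centerA M * scaleB M) ≤ K * c := by
          calc -t * (centerA M * scaleB M) ≤ |t| * (centerA M * scaleB M) :=
                mul_le_mul_of_nonneg_right (neg_le_abs t) hab
            _ ≤ K * c := mul_le_mul (hK t h0) hM hab ((abs_nonneg t).trans (hK t h0))
        have h2 : 1 / √Real.pi ≤ 1 := by
          rw [div_le_one (Real.sqrt_pos.2 Real.pi_pos)]
          exact Real.one_le_sqrt.2 (by linarith [Real.pi_gt_three])
        rw [rescaledDensity, Real.norm_of_nonneg (by positivity)]
        refine (mul_le_of_le_one_left (Real.exp_pos _).le h2).trans (Real.exp_le_exp.2 ?_)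
        have : 0 ≤ t ^ 2 * scaleB M ^ 2 / 2 := by positivity
        linarith
    · refine Tendsto.smul_const ?_ _
      unfold rescaledDensity
      refine Tendsto.const_mul _ ((Real.continuous_exp.tendsto _).comp ?_)
      have h1 := (tendsto_centerA_mul_scaleB.const_mul (-t)).sub
        (((tendsto_scaleB.pow 2).const_mul (t ^ 2)).div_const 2)
      simpa using h1
  refine hlim.congr' ?_
  filter_upwards [eventually_ge_atTop 1] with M hM
  exact (two_rpow_mul_integral hM h).symm

/-! ### The limit for independent energies -/

lemma norm_pow_sub_pow_le {a b : ℂ} (ha : ‖a‖ ≤ 1) (hb : ‖b‖ ≤ 1) (n : ℕ) :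
    ‖a ^ n - b ^ n‖ ≤ n * ‖a - b‖ := by
  induction n with
  | zero => simp
  | succ n ih =>
    have h1 : a ^ (n + 1) - b ^ (n + 1) = a ^ n * (a - b) + (a ^ n - b ^ n) * b := by ring
    rw [h1]
    refine (norm_add_le _ _).trans ?_
    rw [norm_mul, norm_mul, norm_pow]
    have h2 : ‖a‖ ^ n * ‖a - b‖ ≤ 1 * ‖a - b‖ :=
      mul_le_mul_of_nonneg_right (pow_le_one₀ (norm_nonneg _) ha) (norm_nonneg _)
    have h3 : ‖a ^ n - b ^ n‖ * ‖b‖ ≤ n * ‖a - b‖ * 1 :=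
      mul_le_mul ih hb (norm_nonneg _) (by positivity)
    push_cast
    linarith

/-- A version of `(1 + z / n) ^ n → exp z` with arbitrary exponents; `1 + z N` is a mean of phases,
so that both `1 + z N` and `exp (z N)` lie in the closed unit disc. -/
lemma tendsto_one_add_pow_exp {z : ℕ → ℂ} {n : ℕ → ℕ} {c : ℂ} (hn : Tendsto n atTop atTop)
    (hz : Tendsto (fun N => (n N : ℂ) * z N) atTop (𝓝 c)) (h1 : ∀ N, ‖1 + z N‖ ≤ 1) :
    Tendsto (fun N => (1 + z N) ^ n N) atTop (𝓝 (Complex.exp c)) := by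
  have hn' : Tendsto (fun N => ((n N : ℝ))⁻¹) atTop (𝓝 0) :=
    tendsto_inv_atTop_zero.comp (tendsto_natCast_atTop_atTop.comp hn)
  have hnz : Tendsto (fun N => (n N : ℝ) * ‖z N‖) atTop (𝓝 ‖c‖) := by
    refine hz.norm.congr fun N => ?_
    rw [norm_mul, Complex.norm_natCast]
  have hz0 : Tendsto (fun N => ‖z N‖) atTop (𝓝 0) := by
    have := hn'.mul hnz
    rw [zero_mul] at this
    refine this.congr' ?_
    filter_upwards [hn.eventually_ge_atTop 1] with N hN
    have : (n N : ℝ) ≠ 0 := by positivity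
    field_simp
  have hexp : Tendsto (fun N => Complex.exp (z N) ^ n N) atTop (𝓝 (Complex.exp c)) := by
    refine ((Complex.continuous_exp.tendsto c).comp hz).congr fun N => ?_
    simp only [Function.comp_apply, Complex.exp_nat_mul]
  have hdiff : Tendsto (fun N => (1 + z N) ^ n N - Complex.exp (z N) ^ n N) atTop (𝓝 0) := by
    have hlim := hnz.mul hz0
    rw [mul_zero] at hlim
    refine squeeze_zero_norm' ?_ hlim
    filter_upwards [hz0.eventually_le_const one_pos] with N hN
    have hre : ‖Complex.exp (z N)‖ ≤ 1 := by
      rw [Complex.norm_exp, Real.exp_le_one_iff]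
      have h2 := (Complex.re_le_norm (1 + z N)).trans (h1 N)
      simp only [Complex.add_re, Complex.one_re] at h2
      linarith
    refine (norm_pow_sub_pow_le (h1 N) hre (n N)).trans ?_
    have h3 := Complex.norm_exp_sub_one_sub_id_le hN
    have h4 : ‖1 + z N - Complex.exp (z N)‖ = ‖Complex.exp (z N) - 1 - z N‖ := by
      rw [← norm_neg]
      congr 1
      ring
    rw [h4, mul_assoc]
    refine mul_le_mul_of_nonneg_left ?_ (Nat.cast_nonneg _)
    rw [← sq]
    exact h3
  simpa using hdiff.add hexp

/-- A test function of the normalized energies, read as a function of the energies themselves. -/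
noncomputable def rescale (M : ℝ) (f : ℝ → ℝ) (x : ℝ) : ℝ := f ((x - centerA M) / scaleB M)

/-- The characteristic functional of the level process of independent energies converges to that of
the Poisson process. -/
lemma tendsto_integral_phase_iid {ι : ℕ → Type*} [∀ N, Fintype (ι N)] {M : ℕ → ℝ}
    (hM : Tendsto M atTop atTop)
    (hn : Tendsto (fun N => (Fintype.card (ι N) : ℝ) / (2 : ℝ) ^ M N) atTop (𝓝 1))
    (f : C_c(ℝ, ℝ)) :
    Tendsto (fun N => ∫ z, Gaussian.phase (rescale (M N) f) z
      ∂Measure.pi fun _ : ι N => gaussianReal 0 1) atTop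
      (𝓝 (Complex.exp (∫ t, (Complex.exp ((f t : ℂ) * Complex.I) - 1) ∂limitIntensity))) := by
  set h : ℝ → ℂ := fun t => Complex.exp ((f t : ℂ) * Complex.I) - 1 with hh
  have hc : Continuous h := by fun_prop
  obtain ⟨K, hK⟩ := LocFinMeasure.exists_abs_le_of_ne_zero f
  have hKh : ∀ t, h t ≠ 0 → |t| ≤ K := fun t ht => hK t fun h0 => ht (by simp [hh, h0])
  set z : ℕ → ℂ := fun N => ∫ x, h ((x - centerA (M N)) / scaleB (M N)) ∂gaussianReal 0 1 with hz
  have hfm : Measurable f := f.continuous.measurable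
  have hrm : ∀ N, Measurable (rescale (M N) f) := fun N => by
    unfold rescale
    fun_prop
  have hz1 : ∀ N, 1 + z N = ∫ x, Complex.exp ((rescale (M N) f x : ℂ) * Complex.I)
      ∂gaussianReal 0 1 := by
    intro N
    have h1 := PoissonProcess.integrable_cexp_ofReal_mul_I (P := gaussianReal 0 1)
      (hrm N).aemeasurable
    have h2 : z N = ∫ x, (Complex.exp ((rescale (M N) f x : ℂ) * Complex.I) - 1)
      ∂gaussianReal 0 1 := rfl
    rw [h2, integral_sub h1 (integrable_const _)]
    simp
  have hprod : ∀ N, ∫ w, Gaussian.phase (rescale (M N) f) w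
      ∂Measure.pi (fun _ : ι N => gaussianReal 0 1) = (1 + z N) ^ Fintype.card (ι N) := by
    intro N
    rw [hz1, ← integral_fintype_prod_eq_pow]
    refine integral_congr_ae (ae_of_all _ fun x => ?_)
    simp only [Gaussian.phase]
    rw [← Complex.exp_sum, Complex.ofReal_sum, Finset.sum_mul]
  simp_rw [hprod]
  have h2M : Tendsto (fun N => (2 : ℝ) ^ M N) atTop atTop :=
    (tendsto_rpow_atTop_of_base_gt_one 2 one_lt_two).comp hM
  have hcard : Tendsto (fun N => Fintype.card (ι N)) atTop atTop := by
    rw [← tendsto_natCast_atTop_iff (R := ℝ)]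
    refine (hn.pos_mul_atTop one_pos h2M).congr fun N => ?_
    have : (2 : ℝ) ^ M N ≠ 0 := by positivity
    field_simp
  refine tendsto_one_add_pow_exp hcard ?_ fun N => ?_
  · have h1 := (tendsto_two_rpow_mul_integral hc hKh).comp hM
    have h2 := ((Complex.continuous_ofReal.tendsto _).comp hn).mul h1
    rw [Complex.ofReal_one, one_mul] at h2
    refine h2.congr fun N => ?_
    have : (((2 : ℝ) ^ M N : ℝ) : ℂ) ≠ 0 := by
      rw [Complex.ofReal_ne_zero]
      positivity
    simp only [Function.comp_apply, hz]
    rw [Complex.ofReal_div, Complex.ofReal_natCast]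
    field_simp
  · rw [hz1]
    refine (norm_integral_le_of_norm_le_const (C := 1) (ae_of_all _ fun x => ?_)).trans (by simp)
    rw [Complex.norm_exp_ofReal_mul_I]

/-! ### Weakly correlated Gaussian energies -/

namespace Gaussian

variable {Ω : Type*} [MeasurableSpace Ω] {P : Measure Ω} {ι : Type*} [Fintype ι]

/-- The comparison with an independent standard Gaussian family, realized on the product of the
given probability space with `ℝ ^ ι`. -/
lemma norm_integral_phase_sub_iid_le [DecidableEq ι] {X : ι → Ω → ℝ} {C : ι → ι → ℝ}
    (hG : HasGaussianLaw (fun w i => X i w) P) (hX0 : ∀ i, ∫ w, X i w ∂P = 0)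
    (hXX : ∀ i j, cov[X i, X j; P] = C i j) (hC1 : ∀ i, C i i = 1)
    (hC : ∀ i j, i ≠ j → |C i j| ≤ 1 / 2)
    {g g' g'' : ℝ → ℝ} (hg : ∀ x, HasDerivAt g (g' x) x) (hg' : ∀ x, HasDerivAt g' (g'' x) x)
    (hg''m : Measurable g'') {D D' : ℝ} (hD : ∀ x, |g' x| ≤ D) (hD' : ∀ x, |g'' x| ≤ D')
    {u δ : ℝ} (hu : 0 ≤ u) (hδ : 0 ≤ δ) (hsupp : ∀ x, g' x ≠ 0 → x ∈ Set.Icc u (u + δ)) :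
    ‖∫ w, phase g (fun i => X i w) ∂P -
        ∫ z, phase g z ∂Measure.pi fun _ : ι => gaussianReal 0 1‖ ≤
      2 * ∑ i, ∑ j, if i = j then 0 else
        |C i j| * (D ^ 2 * (δ ^ 2 * Real.exp (-(u ^ 2 / (1 + |C i j|))))) := by
  have hP := hG.isProbabilityMeasure
  set ρ : Measure (ι → ℝ) := Measure.pi fun _ : ι => gaussianReal 0 1 with hρ
  have hfst : MeasurePreserving Prod.fst (P.prod ρ) P := measurePreserving_fst
  have hsnd : MeasurePreserving Prod.snd (P.prod ρ) ρ := measurePreserving_snd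
  have heval : ∀ i, HasLaw (fun z : ι → ℝ => z i) (gaussianReal 0 1) ρ :=
    fun i => (measurePreserving_eval (fun _ : ι => gaussianReal 0 1) i).hasLaw
  have hind : iIndepFun (fun (i : ι) (z : ι → ℝ) => z i) ρ :=
    iIndepFun_pi (X := fun _ : ι => (id : ℝ → ℝ)) fun _ => aemeasurable_id
  have hZG : HasGaussianLaw (fun z : ι → ℝ => z) ρ :=
    iIndepFun.hasGaussianLaw (fun i => (heval i).hasGaussianLaw) hind
  have hgm : Measurable g :=
    (continuous_iff_continuousAt.2 fun x => (hg x).continuousAt).measurable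
  have hXm : AEMeasurable (fun w i => X i w) P := hG.aemeasurable
  have hXL : ∀ i, MemLp (X i) 2 P := fun i => (hG.eval i).memLp_two
  have hZL : ∀ i, MemLp (fun z : ι → ℝ => z i) 2 ρ := fun i => (heval i).hasGaussianLaw.memLp_two
  have hjoint : HasGaussianLaw (fun p : Ω × (ι → ℝ) => ((fun i => X i p.1), (fun i => p.2 i)))
      (P.prod ρ) := by
    refine IndepFun.hasGaussianLaw ⟨?_⟩ ⟨?_⟩ (indepFun_prod₀ hXm aemeasurable_id)
    · have := hG.isGaussian_map
      rw [← hfst.map_eq, AEMeasurable.map_map_of_aemeasurable (by rwa [hfst.map_eq])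
        hfst.aemeasurable] at this
      exact this
    · have := hZG.isGaussian_map
      rw [← hsnd.map_eq, AEMeasurable.map_map_of_aemeasurable (by rw [hsnd.map_eq]; fun_prop)
        hsnd.aemeasurable] at this
      exact this
  have hcov1 : ∀ i j, cov[fun p : Ω × (ι → ℝ) => X i p.1, fun p => X j p.1; P.prod ρ] =
      cov[X i, X j; P] := by
    intro i j
    conv_rhs => rw [← hfst.map_eq]
    rw [covariance_map_fun (by rw [hfst.map_eq]; exact (hXL i).1)
      (by rw [hfst.map_eq]; exact (hXL j).1) hfst.aemeasurable]
  have hcov2 : ∀ i j, cov[fun p : Ω × (ι → ℝ) => p.2 i, fun p => p.2 j; P.prod ρ] =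
      if i = j then 1 else 0 := by
    intro i j
    have h1 : cov[fun p : Ω × (ι → ℝ) => p.2 i, fun p => p.2 j; P.prod ρ] =
        cov[fun z : ι → ℝ => z i, fun z => z j; ρ] := by
      conv_rhs => rw [← hsnd.map_eq]
      rw [covariance_map_fun (by rw [hsnd.map_eq]; exact (hZL i).1)
        (by rw [hsnd.map_eq]; exact (hZL j).1) hsnd.aemeasurable]
    rw [h1]
    split_ifs with hij
    · subst hij
      rw [covariance_self (heval i).aemeasurable, (heval i).variance_eq]
      simp
    · exact (hind.indepFun hij).covariance_eq_zero (hZL i) (hZL j)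
  have key := norm_integral_phase_sub_le hjoint (C := C) ?_ ?_ (fun i j => by rw [hcov1, hXX])
    hC1 hcov2 (fun i j => covariance_fst_snd_prod (hXL i) (hZL j)) hC hg hg' hg''m hD hD' hu hδ
    hsupp
  · have h1 : ∫ p, phase g (fun i => X i p.1) ∂(P.prod ρ) = ∫ w, phase g (fun i => X i w) ∂P := by
      conv_rhs => rw [← hfst.map_eq]
      rw [integral_map hfst.aemeasurable]
      rw [hfst.map_eq]
      exact ((measurable_phase hgm).comp_aemeasurable hXm).aestronglyMeasurable
    have h2 : ∫ p, phase g (fun i => p.2 i) ∂(P.prod ρ) = ∫ z, phase g z ∂ρ := by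
      conv_rhs => rw [← hsnd.map_eq]
      rw [integral_map hsnd.aemeasurable]
      rw [hsnd.map_eq]
      exact (measurable_phase hgm).aestronglyMeasurable
    rw [h1, h2] at key
    exact key
  · intro i
    rw [← hX0 i]
    conv_rhs => rw [← hfst.map_eq]
    rw [integral_map hfst.aemeasurable]
    rw [hfst.map_eq]
    exact (hXL i).1
  · intro i
    have h0 : ∫ z : ι → ℝ, z i ∂ρ = 0 := by
      rw [(heval i).integral_eq]
      simp
    rw [← h0]
    conv_rhs => rw [← hsnd.map_eq]
    rw [integral_map hsnd.aemeasurable]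
    rw [hsnd.map_eq]
    exact (hZL i).1

lemma norm_integral_phase_sub_le_of_abs_sub_le [IsProbabilityMeasure P] {X : ι → Ω → ℝ}
    {γ : Measure ℝ} (hX : ∀ i, HasLaw (X i) γ P) {g h k : ℝ → ℝ} (hg : Measurable g)
    (hh : Measurable h) (hk : Integrable k γ) (hgh : ∀ x, |g x - h x| ≤ k x) :
    ‖∫ w, phase g (fun i => X i w) ∂P - ∫ w, phase h (fun i => X i w) ∂P‖ ≤
      Fintype.card ι * ∫ x, k x ∂γ := by
  have hXm : AEMeasurable (fun w i => X i w) P :=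
    aemeasurable_pi_lambda _ fun i => (hX i).aemeasurable
  have hint : ∀ f : ℝ → ℝ, Measurable f → Integrable (fun w => phase f fun i => X i w) P := by
    intro f hf
    refine Integrable.of_bound (C := 1)
      ((measurable_phase hf).comp_aemeasurable hXm).aestronglyMeasurable (ae_of_all _ fun w => ?_)
    rw [norm_phase]
  have hki : ∀ i, Integrable (fun w => k (X i w)) P := by
    intro i
    have h1 := hk
    rw [← (hX i).map_eq] at h1
    exact h1.comp_aemeasurable (hX i).aemeasurable
  have hsum : ∫ w, ∑ i, k (X i w) ∂P = Fintype.card ι * ∫ x, k x ∂γ := by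
    rw [integral_finsetSum _ fun i _ => hki i]
    have : ∀ i, ∫ w, k (X i w) ∂P = ∫ x, k x ∂γ := by
      intro i
      have h1 := hk.1
      rw [← (hX i).map_eq] at h1 ⊢
      rw [integral_map (hX i).aemeasurable h1]
    simp [this]
  rw [← integral_sub (hint g hg) (hint h hh), ← hsum]
  refine norm_integral_le_of_norm_le (integrable_finsetSum _ fun i _ => hki i)
    (ae_of_all _ fun w => ?_)
  have hphase : ∀ s t : ℝ, ‖Complex.exp ((s : ℂ) * Complex.I) - Complex.exp ((t : ℂ) * Complex.I)‖
      ≤ |s - t| := by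
    intro s t
    have h1 : Complex.exp ((s : ℂ) * Complex.I) - Complex.exp ((t : ℂ) * Complex.I) =
        Complex.exp ((t : ℂ) * Complex.I) *
          (Complex.exp (Complex.I * ((s - t : ℝ) : ℂ)) - 1) := by
      rw [mul_sub, ← Complex.exp_add]
      congr 2
      · push_cast
        ring
      · rw [mul_one]
    rw [h1, norm_mul, Complex.norm_exp_ofReal_mul_I, one_mul]
    exact Real.norm_exp_I_mul_ofReal_sub_one_le
  refine (hphase _ _).trans ?_
  rw [← Finset.sum_sub_distrib]
  exact (Finset.abs_sum_le_sum_abs _ _).trans (Finset.sum_le_sum fun i _ => hgh _)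

end Gaussian

/-- The total interaction energy `2 ^ (-2 M) ∑_{i ≠ j} M |C i j| exp (2 log 2 M |C i j|)` of a
correlation matrix, which controls the distance to the independent case. -/
noncomputable def interaction {ι : Type*} [Fintype ι] [DecidableEq ι] (M : ℝ) (C : ι → ι → ℝ) : ℝ :=
  ((2 : ℝ) ^ M)⁻¹ ^ 2 * ∑ i, ∑ j, if i = j then 0 else
    M * |C i j| * Real.exp (2 * Real.log 2 * (M * |C i j|))

/-- The probability that two energies with covariance `c` both lie in a window of the scale of the
level process is `2 ^ (-2 M) exp (2 log 2 M c)`, up to the scaling factor `M` and constants, since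
`exp (-a_N ^ 2) = 2 M 2 ^ (-2 M)` and `u ^ 2 ≥ a_N ^ 2 - 2 K a_N b_N`. -/
lemma exp_neg_sq_div_le {M K c : ℝ} (hM : 1 ≤ M) (hc : 0 ≤ c) (hK : 0 ≤ K)
    (hu : 0 ≤ centerA M - scaleB M * K) :
    Real.exp (-((centerA M - scaleB M * K) ^ 2 / (1 + c))) ≤
      2 * M * ((2 : ℝ) ^ M)⁻¹ ^ 2 * Real.exp (2 * K * (centerA M * scaleB M)) *
        Real.exp (2 * Real.log 2 * (M * c)) := by
  have hb := scaleB_pos (by linarith : 0 < M)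
  rw [← exp_neg_centerA_sq hM, ← Real.exp_add, ← Real.exp_add, Real.exp_le_exp]
  have ha := centerA_sq hM
  have hlogM := Real.log_nonneg hM
  have hlog2 := Real.log_pos one_lt_two
  set a := centerA M
  set b := scaleB M
  set u := a - b * K with hudef
  have hbK : 0 ≤ b * K := mul_nonneg hb.le hK
  have h1 : u ^ 2 * (1 - c) ≤ u ^ 2 / (1 + c) := by
    rw [le_div_iff₀ (by linarith)]
    nlinarith [mul_nonneg (sq_nonneg u) (sq_nonneg c)]
  have h2 : u ^ 2 ≤ a ^ 2 := pow_le_pow_left₀ hu (by linarith) 2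
  have h3 : u ^ 2 * c ≤ 2 * M * Real.log 2 * c :=
    mul_le_mul_of_nonneg_right (by linarith) hc
  have h4 : u ^ 2 = a ^ 2 - 2 * K * (a * b) + (b * K) ^ 2 := by
    rw [hudef]
    ring
  nlinarith [sq_nonneg (b * K)]

lemma tendsto_phase_sub_of_contDiff {ι : ℕ → Type*} [∀ N, Fintype (ι N)] [∀ N, DecidableEq (ι N)]
    {Ω : ℕ → Type*} [∀ N, MeasurableSpace (Ω N)] {Q : (N : ℕ) → Measure (Ω N)}
    {X : (N : ℕ) → ι N → Ω N → ℝ} {C : (N : ℕ) → ι N → ι N → ℝ} {M : ℕ → ℝ}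
    (hG : ∀ N, HasGaussianLaw (fun w i => X N i w) (Q N))
    (hX0 : ∀ N i, ∫ w, X N i w ∂Q N = 0) (hXX : ∀ N i j, cov[X N i, X N j; Q N] = C N i j)
    (hC1 : ∀ N i, C N i i = 1) (hC : ∀ᶠ N in atTop, ∀ i j, i ≠ j → |C N i j| ≤ 1 / 2)
    (hM : Tendsto M atTop atTop)
    (hint : Tendsto (fun N => interaction (M N) (C N)) atTop (𝓝 0))
    {f : ℝ → ℝ} (hf : ContDiff ℝ 2 f) (hfc : HasCompactSupport f) :
    Tendsto (fun N => ∫ w, Gaussian.phase (rescale (M N) f) (fun i => X N i w) ∂Q N -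
      ∫ z, Gaussian.phase (rescale (M N) f) z ∂Measure.pi fun _ : ι N => gaussianReal 0 1)
      atTop (𝓝 0) := by
  have hf1 : ContDiff ℝ 1 (deriv f) := hf.iterate_deriv' 1 1
  have hd : ∀ x, HasDerivAt f (deriv f x) x :=
    fun x => (hf.differentiable (by norm_num) x).hasDerivAt
  have hd' : ∀ x, HasDerivAt (deriv f) (deriv (deriv f) x) x :=
    fun x => (hf1.differentiable (by norm_num) x).hasDerivAt
  have hc1 := hfc.deriv
  have hc2 := hc1.deriv
  have hcont2 : Continuous (deriv (deriv f)) := hf1.continuous_deriv le_rfl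
  obtain ⟨D, hD⟩ := hc1.exists_bound_of_continuous hf1.continuous
  obtain ⟨D', hD'⟩ := hc2.exists_bound_of_continuous hcont2
  obtain ⟨K, hK0, hK⟩ := hc1.isCompact.isBounded.exists_pos_norm_le
  have hK' : ∀ x, deriv f x ≠ 0 → |x| ≤ K := fun x hx => hK x (subset_tsupport _ hx)
  have hab := tendsto_centerA_mul_scaleB.comp hM
  set c := √(2 * Real.log 2) with hcdef
  have hc0 : 0 < c := Real.sqrt_pos.2 (by have := Real.log_pos one_lt_two; positivity)
  have hev1 : ∀ᶠ N in atTop, centerA (M N) * scaleB (M N) ≤ c + 1 :=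
    (hab.eventually_lt_const (lt_add_one _)).mono fun _ h => h.le
  -- The window `[a - b K, a + b K]` eventually lies on the positive half-line, as `b → 0` and
  -- `a b` has a positive limit.
  have hev2 : ∀ᶠ N in atTop, 0 ≤ centerA (M N) - scaleB (M N) * K := by
    have h1 := hab.sub (((tendsto_scaleB.comp hM).pow 2).mul_const K)
    simp only [ne_eq, OfNat.ofNat_ne_zero, not_false_eq_true, zero_pow, zero_mul, sub_zero] at h1
    filter_upwards [h1.eventually_const_lt hc0, hM.eventually_gt_atTop 0] with N h2 h3
    have hb := scaleB_pos h3
    simp only [Function.comp_apply] at h2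
    by_contra h4
    nlinarith [mul_neg_of_pos_of_neg hb (not_le.1 h4)]
  have hlim := hint.const_mul (2 * (D ^ 2 * (2 * K) ^ 2 * (2 * Real.exp (2 * K * (c + 1)))))
  rw [mul_zero] at hlim
  refine squeeze_zero_norm' ?_ hlim
  filter_upwards [hC, hev1, hev2, hM.eventually_ge_atTop 1] with N hCN h1 h2 h3
  set a := centerA (M N) with ha
  set b := scaleB (M N) with hbdef
  have hb : 0 < b := scaleB_pos (by linarith)
  have hlin : ∀ x : ℝ, HasDerivAt (fun x => (x - a) / b) (1 / b) x := fun x =>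
    ((hasDerivAt_id x).sub_const a).div_const b
  have hkey := Gaussian.norm_integral_phase_sub_iid_le (hG N) (hX0 N) (hXX N) (hC1 N) hCN
    (g := rescale (M N) f) (g' := fun x => deriv f ((x - a) / b) * (1 / b))
    (g'' := fun x => deriv (deriv f) ((x - a) / b) * (1 / b) * (1 / b))
    (fun x => (hd ((x - a) / b)).comp x (hlin x))
    (fun x => ((hd' ((x - a) / b)).comp x (hlin x)).mul_const _)
    (by have := hcont2.measurable; fun_prop) (D := D * (1 / b)) (D' := D' * (1 / b) * (1 / b))
    (fun x => by
      rw [abs_mul, abs_of_pos (one_div_pos.2 hb)]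
      exact mul_le_mul_of_nonneg_right (hD _) (by positivity))
    (fun x => by
      rw [abs_mul, abs_mul, abs_of_pos (one_div_pos.2 hb)]
      exact mul_le_mul_of_nonneg_right
        (mul_le_mul_of_nonneg_right (hD' _) (by positivity)) (by positivity))
    (u := a - b * K) (δ := 2 * (b * K)) h2 (by positivity)
    (fun x hx => by
      have h4 := hK' _ (left_ne_zero_of_mul hx)
      rw [abs_le, le_div_iff₀ hb, div_le_iff₀ hb] at h4
      constructor <;> linarith)
  refine hkey.trans ?_
  rw [interaction, mul_assoc 2 (D ^ 2 * (2 * K) ^ 2 * (2 * Real.exp (2 * K * (c + 1))))]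
  refine mul_le_mul_of_nonneg_left ?_ zero_le_two
  rw [Finset.mul_sum, Finset.mul_sum]
  refine Finset.sum_le_sum fun i _ => ?_
  rw [Finset.mul_sum, Finset.mul_sum]
  refine Finset.sum_le_sum fun j _ => ?_
  split_ifs with hij
  · simp
  · have h5 := exp_neg_sq_div_le h3 (abs_nonneg (C N i j)) hK0.le h2
    have h6 : Real.exp (2 * K * (a * b)) ≤ Real.exp (2 * K * (c + 1)) :=
      Real.exp_le_exp.2 (mul_le_mul_of_nonneg_left h1 (by positivity))
    calc |C N i j| * ((D * (1 / b)) ^ 2 *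
          ((2 * (b * K)) ^ 2 * Real.exp (-((a - b * K) ^ 2 / (1 + |C N i j|)))))
        = |C N i j| * (D ^ 2 * (2 * K) ^ 2) *
            Real.exp (-((a - b * K) ^ 2 / (1 + |C N i j|))) := by
          field_simp
      _ ≤ |C N i j| * (D ^ 2 * (2 * K) ^ 2) * (2 * M N * ((2 : ℝ) ^ M N)⁻¹ ^ 2 *
            Real.exp (2 * K * (c + 1)) * Real.exp (2 * Real.log 2 * (M N * |C N i j|))) := by
          refine mul_le_mul_of_nonneg_left (h5.trans ?_) (by positivity)
          gcongr
      _ = _ := by ring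

/-- Weakly correlated standard Gaussian energies have the same limiting characteristic functional
as independent ones. The passage from smooth to continuous test functions costs at most the uniform
distance times the expected number of points in a compact set. -/
theorem tendsto_integral_phase {ι : ℕ → Type*} [∀ N, Fintype (ι N)] [∀ N, DecidableEq (ι N)]
    {Ω : ℕ → Type*} [∀ N, MeasurableSpace (Ω N)] {Q : (N : ℕ) → Measure (Ω N)}
    {X : (N : ℕ) → ι N → Ω N → ℝ} {C : (N : ℕ) → ι N → ι N → ℝ} {M : ℕ → ℝ}
    (hG : ∀ N, HasGaussianLaw (fun w i => X N i w) (Q N))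
    (hX0 : ∀ N i, ∫ w, X N i w ∂Q N = 0) (hXX : ∀ N i j, cov[X N i, X N j; Q N] = C N i j)
    (hC1 : ∀ N i, C N i i = 1) (hC : ∀ᶠ N in atTop, ∀ i j, i ≠ j → |C N i j| ≤ 1 / 2)
    (hM : Tendsto M atTop atTop)
    (hn : Tendsto (fun N => (Fintype.card (ι N) : ℝ) / (2 : ℝ) ^ M N) atTop (𝓝 1))
    (hint : Tendsto (fun N => interaction (M N) (C N)) atTop (𝓝 0)) (f : C_c(ℝ, ℝ)) :
    Tendsto (fun N => ∫ w, Gaussian.phase (rescale (M N) f) (fun i => X N i w) ∂Q N) atTop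
      (𝓝 (Complex.exp (∫ t, (Complex.exp ((f t : ℂ) * Complex.I) - 1) ∂limitIntensity))) := by
  have hiid := tendsto_integral_phase_iid hM hn f
  suffices h : Tendsto (fun N => ∫ w, Gaussian.phase (rescale (M N) f) (fun i => X N i w) ∂Q N -
      ∫ z, Gaussian.phase (rescale (M N) f) z ∂Measure.pi fun _ : ι N => gaussianReal 0 1)
      atTop (𝓝 0) by
    simpa using h.add hiid
  obtain ⟨n, hfn⟩ := LocFinMeasure.exists_abs_le_of_ne_zero f
  set k : ℝ → ℝ := fun x => LocFinMeasure.plateau n x with hk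
  have hkc : Continuous k := (LocFinMeasure.plateau n).continuous
  obtain ⟨n', hn'⟩ := LocFinMeasure.exists_abs_le_of_ne_zero (LocFinMeasure.plateau n)
  set J : ℕ → ℝ := fun N => Fintype.card (ι N) * ∫ x, rescale (M N) k x ∂gaussianReal 0 1 with hJ
  -- The expected number of points in a compact set stays bounded.
  obtain ⟨B, hB⟩ : ∃ B, ∀ᶠ N in atTop, J N ≤ B := by
    have h1 := (tendsto_two_rpow_mul_integral (h := fun t => (k t : ℂ)) (by fun_prop) (K := n')
      (fun t ht => hn' t (by simpa [hk] using ht))).comp hM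
    have h2 := (Complex.continuous_re.tendsto _).comp h1
    have h3 := hn.mul h2
    refine ⟨_, (h3.eventually_lt_const (lt_add_one _)).mono fun N hN =>
      le_trans (le_of_eq ?_) hN.le⟩
    simp only [Function.comp_apply, hJ, rescale]
    rw [integral_complex_ofReal, Complex.re_ofReal_mul, Complex.ofReal_re]
    have : (2 : ℝ) ^ M N ≠ 0 := by positivity
    field_simp
  have hB0 : 0 ≤ max B 0 := le_max_right _ _
  rw [Metric.tendsto_nhds]
  intro ε hε
  set η : ℝ := ε / (4 * (max B 0 + 1)) with hη
  have hη0 : 0 < η := by positivity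
  obtain ⟨g, hgd, hgf, hgs⟩ := f.continuous.exists_contDiff_approx 2 (ε := fun _ => η)
    continuous_const fun _ => hη0
  have hgc : HasCompactSupport g := f.hasCompactSupport.mono hgs
  have hgh : ∀ t, |f t - g t| ≤ η * k t := by
    intro t
    by_cases ht : f t = 0
    · have h0 : g t = 0 := by
        by_contra h1
        exact hgs h1 ht
      rw [ht, h0, sub_zero, abs_zero]
      exact mul_nonneg hη0.le (LocFinMeasure.plateau_nonneg n t)
    · have h1 : k t = 1 := LocFinMeasure.plateau_eq_one (hfn t ht)
      rw [h1, mul_one, abs_sub_comm]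
      exact (hgf t).le
  have hlim := tendsto_phase_sub_of_contDiff hG hX0 hXX hC1 hC hM hint
    (f := g) (by exact_mod_cast hgd) hgc
  rw [Metric.tendsto_nhds] at hlim
  filter_upwards [hlim (ε / 2) (half_pos hε), hB] with N h1 h2
  have hP := (hG N).isProbabilityMeasure
  have hXlaw : ∀ i, HasLaw (X N i) (gaussianReal 0 1) (Q N) := by
    intro i
    have h3 := (hG N).eval i
    refine ⟨h3.aemeasurable, ?_⟩
    rw [h3.map_eq_gaussianReal, hX0, ← covariance_self h3.aemeasurable, hXX, hC1]
    simp
  have hZlaw : ∀ i, HasLaw (fun z : ι N → ℝ => z i) (gaussianReal 0 1)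
      (Measure.pi fun _ : ι N => gaussianReal 0 1) :=
    fun i => (measurePreserving_eval (fun _ : ι N => gaussianReal 0 1) i).hasLaw
  have hfm : Measurable (rescale (M N) f) := by
    have := f.continuous.measurable
    unfold rescale
    fun_prop
  have hgm : Measurable (rescale (M N) g) := by
    have := hgd.continuous.measurable
    unfold rescale
    fun_prop
  obtain ⟨B', hB'⟩ := (LocFinMeasure.plateau n).hasCompactSupport.exists_bound_of_continuous hkc
  have hki : Integrable (fun x => η * rescale (M N) k x) (gaussianReal 0 1) := by
    refine Integrable.const_mul (Integrable.of_bound (C := B') ?_ (ae_of_all _ fun x => hB' _)) _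
    exact Continuous.aestronglyMeasurable (by fun_prop)
  have h4 := Gaussian.norm_integral_phase_sub_le_of_abs_sub_le hXlaw hfm hgm hki fun x => hgh _
  have h5 := Gaussian.norm_integral_phase_sub_le_of_abs_sub_le hZlaw hfm hgm hki fun x => hgh _
  have h6 : (Fintype.card (ι N) : ℝ) * ∫ x, η * rescale (M N) k x ∂gaussianReal 0 1 ≤ ε / 4 := by
    rw [integral_const_mul, mul_left_comm]
    calc η * J N ≤ η * (max B 0 + 1) :=
          mul_le_mul_of_nonneg_left (by linarith [le_max_left B 0]) hη0.le
      _ = ε / 4 := by rw [hη]; field_simp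
  rw [dist_zero_right] at h1 ⊢
  set A1 := ∫ w, Gaussian.phase (rescale (M N) f) (fun i => X N i w) ∂Q N
  set A2 := ∫ w, Gaussian.phase (rescale (M N) g) (fun i => X N i w) ∂Q N
  set B1 := ∫ z, Gaussian.phase (rescale (M N) f) z ∂Measure.pi fun _ : ι N => gaussianReal 0 1
  set B2 := ∫ z, Gaussian.phase (rescale (M N) g) z ∂Measure.pi fun _ : ι N => gaussianReal 0 1
  have h5' : ‖B1 - B2‖ ≤ ε / 4 := h5.trans h6
  have h4' : ‖A1 - A2‖ ≤ ε / 4 := h4.trans h6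
  calc ‖A1 - B1‖ = ‖(A1 - A2) + (A2 - B2) - (B1 - B2)‖ := by
        congr 1
        ring
    _ ≤ ‖A1 - A2‖ + ‖A2 - B2‖ + ‖B1 - B2‖ :=
        (norm_sub_le _ _).trans (add_le_add_left (norm_add_le _ _) _)
    _ < ε := by linarith

/-! ### Overlaps on the hypercube -/

section Overlap

variable {N : ℕ}

lemma overlap_self (hN : 1 ≤ N) (σ : Hypercube N) : overlap σ σ = 1 := by
  have h1 : ∀ i, (((σ i : ℤˣ) : ℤ) : ℝ) * (((σ i : ℤˣ) : ℤ) : ℝ) = 1 := fun i => by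
    rcases Int.units_eq_one_or (σ i) with h | h <;> simp [h]
  have : (N : ℝ) ≠ 0 := by positivity
  simp [overlap, h1, this]

lemma abs_overlap_le_one (σ σ' : Hypercube N) : |overlap σ σ'| ≤ 1 := by
  have h1 : ∀ i, |(((σ i : ℤˣ) : ℤ) : ℝ) * (((σ' i : ℤˣ) : ℤ) : ℝ)| ≤ 1 := fun i => by
    rcases Int.units_eq_one_or (σ i) with h | h <;>
      rcases Int.units_eq_one_or (σ' i) with h' | h' <;> simp [h, h']
  rw [overlap, abs_mul, abs_of_nonneg (by positivity)]
  have h2 : |∑ i, (((σ i : ℤˣ) : ℤ) : ℝ) * (((σ' i : ℤˣ) : ℤ) : ℝ)| ≤ N := by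
    refine (Finset.abs_sum_le_sum_abs _ _).trans ((Finset.sum_le_sum fun i _ => h1 i).trans ?_)
    simp
  rcases Nat.eq_zero_or_pos N with h | h
  · simp [h]
  · have : (0 : ℝ) < N := by exact_mod_cast h
    rw [one_div, inv_mul_le_iff₀ this, mul_one]
    exact h2

lemma integral_exp_sq_div_four : ∫ x, Real.exp (x ^ 2 / 4) ∂gaussianReal 0 1 = √2 := by
  rw [integral_gaussianReal_eq_integral_smul one_ne_zero]
  have h1 : ∀ x : ℝ, gaussianPDFReal 0 1 x • Real.exp (x ^ 2 / 4) =
      (√(2 * Real.pi))⁻¹ * Real.exp (-(1 / 4) * x ^ 2) := by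
    intro x
    rw [gaussianPDFReal, smul_eq_mul, mul_assoc, ← Real.exp_add]
    simp only [NNReal.coe_one, mul_one, sub_zero]
    congr 2
    ring
  simp_rw [h1]
  rw [integral_const_mul, integral_gaussian, inv_mul_eq_div, ← Real.sqrt_div (by positivity)]
  congr 1
  field_simp
  norm_num

/-- Exponential moment of the overlap with a fixed configuration, by linearizing the square with an
auxiliary Gaussian variable. -/
lemma sum_exp_overlap_sq_le (hN : 1 ≤ N) (σ : Hypercube N) :
    ∑ σ', Real.exp (N * overlap σ σ' ^ 2 / 4) ≤ √2 * 2 ^ N := by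
  have hN0 : (0 : ℝ) < N := by exact_mod_cast hN
  set r : ℝ := √(2 * N) with hr
  have hr0 : 0 < r := Real.sqrt_pos.2 (by positivity)
  have hr2 : r ^ 2 = 2 * N := Real.sq_sqrt (by positivity)
  set s : Hypercube N → Fin N → ℝ :=
    fun σ' i => (((σ i : ℤˣ) : ℤ) : ℝ) * (((σ' i : ℤˣ) : ℤ) : ℝ) with hs
  have h1 : ∀ σ', Real.exp (N * overlap σ σ' ^ 2 / 4) =
      ∫ x, Real.exp ((∑ i, s σ' i) / r * x) ∂gaussianReal 0 1 := by
    intro σ'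
    have h2 := mgf_gaussianReal (p := gaussianReal 0 1) (X := id) (μ := 0) (v := 1)
      Measure.map_id ((∑ i, s σ' i) / r)
    rw [mgf] at h2
    simp only [id] at h2
    rw [h2, overlap]
    congr 1
    rw [div_pow, hr2]
    simp only [NNReal.coe_one, hs]
    field_simp
    ring
  have h3 : ∀ x : ℝ, ∑ σ', Real.exp ((∑ i, s σ' i) / r * x) = (2 * Real.cosh (x / r)) ^ N := by
    intro x
    have h4 : ∀ σ', Real.exp ((∑ i, s σ' i) / r * x) =
        ∏ i, Real.exp ((((σ i : ℤˣ) : ℤ) : ℝ) * (((σ' i : ℤˣ) : ℤ) : ℝ) * (x / r)) := by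
      intro σ'
      rw [← Real.exp_sum, ← Finset.sum_mul]
      congr 1
      ring
    have h5 : ∀ i, ∑ u : ℤˣ, Real.exp ((((σ i : ℤˣ) : ℤ) : ℝ) * ((u : ℤ) : ℝ) * (x / r)) =
        2 * Real.cosh (x / r) := by
      intro i
      have hu : (Finset.univ : Finset ℤˣ) = {1, -1} := rfl
      rw [hu, Finset.sum_pair (by decide), Real.cosh_eq]
      rcases Int.units_eq_one_or (σ i) with h | h
      · simp only [h]
        push_cast
        ring_nf
      · simp only [h]
        push_cast
        ring_nf
    have h6 := Finset.prod_univ_sum (fun _ : Fin N => (Finset.univ : Finset ℤˣ))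
      (fun i u => Real.exp ((((σ i : ℤˣ) : ℤ) : ℝ) * ((u : ℤ) : ℝ) * (x / r)))
    rw [Fintype.piFinset_univ] at h6
    simp_rw [h4]
    rw [← h6, Finset.prod_congr rfl fun i _ => h5 i, Finset.prod_const, Finset.card_univ,
      Fintype.card_fin]
  have hint : ∀ c : ℝ, Integrable (fun x => Real.exp (c * x)) (gaussianReal 0 1) :=
    fun c => integrable_exp_mul_gaussianReal c
  simp_rw [h1]
  rw [← integral_finsetSum _ fun σ' _ => hint _, ← integral_exp_sq_div_four, ← integral_mul_const]
  refine integral_mono (integrable_finsetSum _ fun σ' _ => hint _) (Integrable.mul_const ?_ _)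
    fun x => ?_
  · refine Integrable.of_integral_ne_zero ?_
    rw [integral_exp_sq_div_four]
    positivity
  · simp only
    rw [h3, mul_pow, mul_comm]
    refine mul_le_mul_of_nonneg_right ?_ (by positivity)
    refine (pow_le_pow_left₀ (Real.cosh_pos _).le (Real.cosh_le_exp_half_sq _) N).trans_eq ?_
    rw [← Real.exp_nat_mul, div_pow, hr2]
    congr 1
    field_simp
    norm_num

end Overlap

/-! ### Moments of the random cloud -/

section Cloud

variable {N : ℕ} {Ω : Type*} {X : Hypercube N → Ω → Bool}

/-- The indicator that a configuration belongs to the cloud. -/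
noncomputable def occupation (X : Hypercube N → Ω → Bool) (σ : Hypercube N) (w : Ω) : ℝ :=
  if X σ w = true then 1 else 0

lemma occupation_nonneg (σ : Hypercube N) (w : Ω) : 0 ≤ occupation X σ w := by
  unfold occupation
  split_ifs <;> norm_num

lemma occupation_le_one (σ : Hypercube N) (w : Ω) : occupation X σ w ≤ 1 := by
  unfold occupation
  split_ifs <;> norm_num

lemma occupation_sq (σ : Hypercube N) (w : Ω) : occupation X σ w ^ 2 = occupation X σ w := by
  unfold occupation
  split_ifs <;> norm_num

lemma sum_cloud (w : Ω) (f : Hypercube N → ℝ) :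
    ∑ σ ∈ cloud X w, f σ = ∑ σ, occupation X σ w * f σ := by
  simp [cloud, occupation, Finset.sum_filter]

lemma card_cloud (w : Ω) : ((cloud X w).card : ℝ) = ∑ σ, occupation X σ w := by
  have := sum_cloud (X := X) w fun _ => 1
  simpa using this

namespace IsBernoulliCloud

variable [MeasurableSpace Ω] {P : Measure Ω} {p : ℝ} (hX : IsBernoulliCloud P p X)

include hX

lemma measurable_occupation (σ : Hypercube N) : Measurable (occupation X σ) :=
  Measurable.ite (hX.measurable σ (measurableSet_singleton true)) measurable_const
    measurable_const

lemma prob_nonneg : 0 ≤ p := by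
  rw [← hX.prob fun _ => 1]
  exact measureReal_nonneg

lemma iIndepFun_occupation : iIndepFun (occupation X) P :=
  hX.indep.comp (fun _ (b : Bool) => if b = true then (1 : ℝ) else 0)
    fun _ => measurable_of_finite _

lemma integrable_occupation_mul (σ : Hypercube N) {f : Ω → ℝ} (hf : Integrable f P) :
    Integrable (fun w => occupation X σ w * f w) P :=
  hf.bdd_mul (hX.measurable_occupation σ).aestronglyMeasurable (c := 1) (ae_of_all _ fun w => by
    rw [Real.norm_of_nonneg (occupation_nonneg σ w)]
    exact occupation_le_one σ w)

lemma integral_occupation (σ : Hypercube N) : ∫ w, occupation X σ w ∂P = p := by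
  have h1 : occupation X σ = Set.indicator {w | X σ w = true} 1 := by
    ext w
    simp [occupation, Set.indicator]
  have h2 : MeasurableSet {w | X σ w = true} := hX.measurable σ (measurableSet_singleton true)
  rw [h1, integral_indicator_one h2, hX.prob]

lemma integral_occupation_mul_occupation {σ σ' : Hypercube N} (h : σ ≠ σ') :
    ∫ w, occupation X σ w * occupation X σ' w ∂P = p ^ 2 := by
  rw [(hX.iIndepFun_occupation.indepFun h).integral_fun_mul_eq_mul_integral
    (hX.measurable_occupation σ).aestronglyMeasurable
    (hX.measurable_occupation σ').aestronglyMeasurable, hX.integral_occupation,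
    hX.integral_occupation, sq]

variable [IsProbabilityMeasure P]

lemma integrable_occupation (σ : Hypercube N) : Integrable (occupation X σ) P := by
  simpa using hX.integrable_occupation_mul σ (integrable_const (1 : ℝ))

lemma memLp_occupation (σ : Hypercube N) : MemLp (occupation X σ) 2 P := by
  refine MemLp.of_bound (hX.measurable_occupation σ).aestronglyMeasurable 1
    (ae_of_all _ fun w => ?_)
  rw [Real.norm_of_nonneg (occupation_nonneg σ w)]
  exact occupation_le_one σ w

lemma prob_le_one : p ≤ 1 := by
  rw [← hX.prob fun _ => 1]
  exact measureReal_le_one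

lemma mgf_card_le (t : ℝ) :
    Integrable (fun w => Real.exp (t * ((cloud X w).card : ℝ))) P ∧
      mgf (fun w => ((cloud X w).card : ℝ)) P t ≤ Real.exp (2 ^ N * p * (Real.exp t - 1)) := by
  have h1 : (fun w => ((cloud X w).card : ℝ)) = ∑ σ, occupation X σ := by
    ext w
    rw [card_cloud, Finset.sum_apply]
  have hexp : ∀ σ w, Real.exp (t * occupation X σ w) =
      1 + occupation X σ w * (Real.exp t - 1) := by
    intro σ w
    unfold occupation
    split_ifs <;> simp
  have hi : ∀ σ, Integrable (fun w => Real.exp (t * occupation X σ w)) P := by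
    intro σ
    simp_rw [hexp]
    exact (integrable_const _).add ((hX.integrable_occupation σ).mul_const _)
  refine ⟨?_, ?_⟩
  · have := hX.iIndepFun_occupation.integrable_exp_mul_sum (s := Finset.univ) (t := t)
      hX.measurable_occupation fun σ _ => hi σ
    rwa [← h1] at this
  · rw [h1, hX.iIndepFun_occupation.mgf_sum hX.measurable_occupation]
    have h2 : ∀ σ, mgf (occupation X σ) P t = 1 + p * (Real.exp t - 1) := by
      intro σ
      rw [mgf]
      simp_rw [hexp]
      rw [integral_add (integrable_const _) ((hX.integrable_occupation σ).mul_const _),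
        integral_mul_const, hX.integral_occupation]
      simp
    have h3 : 0 ≤ 1 + p * (Real.exp t - 1) := by
      nlinarith [hX.prob_le_one, mul_nonneg hX.prob_nonneg (Real.exp_pos t).le]
    have h4 : 1 + p * (Real.exp t - 1) ≤ Real.exp (p * (Real.exp t - 1)) := by
      rw [add_comm]
      exact Real.add_one_le_exp _
    simp only [h2, Finset.prod_const, Finset.card_univ, Fintype.card_pi_const,
      Fintype.card_units_int]
    refine (pow_le_pow_left₀ h3 h4 _).trans_eq ?_
    rw [← Real.exp_nat_mul]
    push_cast
    ring_nf

/-- Chernoff's bound for the size of the cloud. -/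
lemma measureReal_card_le {ε : ℝ} (hε : 0 < ε) (hε1 : ε ≤ 1) :
    P.real {w | ε * (2 ^ N * p) ≤ |((cloud X w).card : ℝ) - 2 ^ N * p|} ≤
      2 * Real.exp (-(2 ^ N * p * ε ^ 2 / 4)) := by
  set m := 2 ^ N * p with hm
  have hm0 : 0 ≤ m := mul_nonneg (by positivity) hX.prob_nonneg
  have hexp : ∀ t : ℝ, |t| ≤ 1 → Real.exp t - 1 ≤ t + t ^ 2 := by
    intro t ht
    have := (abs_le.1 (Real.abs_exp_sub_one_sub_id_le ht)).2
    linarith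
  have h1 := measure_ge_le_exp_mul_mgf (μ := P) ((1 + ε) * m) (by positivity : 0 ≤ ε / 2)
    (hX.mgf_card_le (ε / 2)).1
  have h2 := measure_le_le_exp_mul_mgf (μ := P) ((1 - ε) * m) (by linarith : -(ε / 2) ≤ 0)
    (hX.mgf_card_le (-(ε / 2))).1
  have h3 : P.real {w | (1 + ε) * m ≤ ((cloud X w).card : ℝ)} ≤
      Real.exp (-(m * ε ^ 2 / 4)) := by
    refine h1.trans ((mul_le_mul_of_nonneg_left (hX.mgf_card_le _).2 (Real.exp_pos _).le).trans ?_)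
    rw [← Real.exp_add, Real.exp_le_exp]
    have := mul_le_mul_of_nonneg_left (hexp (ε / 2) (by rw [abs_of_pos] <;> linarith)) hm0
    nlinarith
  have h4 : P.real {w | ((cloud X w).card : ℝ) ≤ (1 - ε) * m} ≤ Real.exp (-(m * ε ^ 2 / 4)) := by
    refine h2.trans ((mul_le_mul_of_nonneg_left (hX.mgf_card_le _).2 (Real.exp_pos _).le).trans ?_)
    rw [← Real.exp_add, Real.exp_le_exp]
    have := mul_le_mul_of_nonneg_left
      (hexp (-(ε / 2)) (by rw [abs_neg, abs_of_pos] <;> linarith)) hm0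
    nlinarith
  have h5 : {w | ε * m ≤ |((cloud X w).card : ℝ) - m|} ⊆
      {w | (1 + ε) * m ≤ ((cloud X w).card : ℝ)} ∪
        {w | ((cloud X w).card : ℝ) ≤ (1 - ε) * m} := by
    intro w hw
    rcases le_abs'.1 (Set.mem_ofPred_eq ▸ hw) with h | h
    · right
      simp only [Set.mem_ofPred_eq]
      linarith
    · left
      simp only [Set.mem_ofPred_eq]
      linarith
  refine (measureReal_mono h5).trans ((measureReal_union_le _ _).trans ?_)
  linarith

/-- It is unlikely that the cloud contains two configurations with a large overlap. -/
lemma measureReal_exists_overlap_le (hN : 1 ≤ N) (y : ℝ) :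
    P.real {w | ∃ σ ∈ cloud X w, ∃ σ' ∈ cloud X w, σ ≠ σ' ∧ y ≤ N * overlap σ σ' ^ 2} ≤
      √2 * (2 ^ N * p) ^ 2 * Real.exp (-(y / 4)) := by
  set F : Ω → ℝ := fun w => ∑ σ, ∑ σ', if σ = σ' then 0 else
    (occupation X σ w * occupation X σ' w) * Real.exp (N * overlap σ σ' ^ 2 / 4) with hF
  have hterm : ∀ σ σ', Integrable (fun w => if σ = σ' then 0 else
      (occupation X σ w * occupation X σ' w) * Real.exp (N * overlap σ σ' ^ 2 / 4)) P := by
    intro σ σ'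
    split_ifs with h
    · exact integrable_const _
    · exact (hX.integrable_occupation_mul σ (hX.integrable_occupation σ')).mul_const _
  have hFi : Integrable F P := integrable_finsetSum _ fun σ _ => integrable_finsetSum _ fun σ' _ =>
    hterm σ σ'
  have hnn : ∀ σ σ' w, 0 ≤ if σ = σ' then 0 else
      (occupation X σ w * occupation X σ' w) * Real.exp (N * overlap σ σ' ^ 2 / 4) := by
    intro σ σ' w
    split_ifs with h
    · exact le_rfl
    · exact mul_nonneg (mul_nonneg (occupation_nonneg _ _) (occupation_nonneg _ _))
        (Real.exp_pos _).le
  have hF0 : ∀ w, 0 ≤ F w := fun w =>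
    Finset.sum_nonneg fun σ _ => Finset.sum_nonneg fun σ' _ => hnn σ σ' w
  have hint : ∫ w, F w ∂P ≤ √2 * (2 ^ N * p) ^ 2 := by
    rw [hF, integral_finsetSum _ fun σ _ => integrable_finsetSum _ fun σ' _ => hterm σ σ']
    have h1 : ∀ σ : Hypercube N, ∫ w, ∑ σ', (if σ = σ' then 0 else
        (occupation X σ w * occupation X σ' w) * Real.exp (N * overlap σ σ' ^ 2 / 4)) ∂P ≤
        p ^ 2 * (√2 * 2 ^ N) := by
      intro σ
      rw [integral_finsetSum _ fun σ' _ => hterm σ σ']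
      refine le_trans ?_ (mul_le_mul_of_nonneg_left (sum_exp_overlap_sq_le hN σ) (sq_nonneg p))
      rw [Finset.mul_sum]
      refine Finset.sum_le_sum fun σ' _ => ?_
      split_ifs with h
      · rw [integral_zero]
        positivity
      · rw [integral_mul_const, hX.integral_occupation_mul_occupation h]
    refine (Finset.sum_le_sum fun σ _ => h1 σ).trans_eq ?_
    simp only [Finset.sum_const, Finset.card_univ, Fintype.card_pi_const, Fintype.card_units_int,
      nsmul_eq_mul]
    push_cast
    ring
  have hsub : {w | ∃ σ ∈ cloud X w, ∃ σ' ∈ cloud X w, σ ≠ σ' ∧ y ≤ N * overlap σ σ' ^ 2} ⊆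
      {w | Real.exp (y / 4) ≤ F w} := by
    rintro w ⟨σ, hσ, σ', hσ', hne, hy⟩
    have h2 : ∀ τ ∈ cloud X w, occupation X τ w = 1 := fun τ hτ => by
      simpa [cloud, occupation] using hτ
    have h3 := Finset.single_le_sum (f := fun σ' => if σ = σ' then 0 else
      (occupation X σ w * occupation X σ' w) * Real.exp (N * overlap σ σ' ^ 2 / 4))
      (fun τ _ => hnn σ τ w) (Finset.mem_univ σ')
    have h4 := Finset.single_le_sum (f := fun σ => ∑ σ', if σ = σ' then 0 else
      (occupation X σ w * occupation X σ' w) * Real.exp (N * overlap σ σ' ^ 2 / 4))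
      (fun τ _ => Finset.sum_nonneg fun τ' _ => hnn τ τ' w) (Finset.mem_univ σ)
    have h6 : (if σ = σ' then 0 else (occupation X σ w * occupation X σ' w) *
        Real.exp (N * overlap σ σ' ^ 2 / 4)) = Real.exp (N * overlap σ σ' ^ 2 / 4) := by
      rw [if_neg hne, h2 σ hσ, h2 σ' hσ', one_mul, one_mul]
    have h5 : Real.exp (y / 4) ≤ Real.exp (N * overlap σ σ' ^ 2 / 4) :=
      Real.exp_le_exp.2 (by linarith)
    exact h5.trans (h6.ge.trans (h3.trans h4))
  have hmarkov := mul_meas_ge_le_integral_of_nonneg (ae_of_all _ hF0) hFi (Real.exp (y / 4))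
  have h6 := measureReal_mono (μ := P) hsub
  rw [Real.exp_neg, ← div_eq_mul_inv, le_div_iff₀ (Real.exp_pos _)]
  calc _ ≤ P.real {w | Real.exp (y / 4) ≤ F w} * Real.exp (y / 4) :=
        mul_le_mul_of_nonneg_right h6 (Real.exp_pos _).le
    _ ≤ _ := by linarith

/-- A configuration of the cloud is independent of the weighted number of its companions, whose
variance is that of a sum of independent variables. -/
lemma integral_occupation_mul_sq_le (σ : Hypercube N) (g : Hypercube N → ℝ) :
    Integrable (fun w => occupation X σ w *
      (∑ σ' ∈ Finset.univ.erase σ, occupation X σ' w * g σ' -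
        p * ∑ σ' ∈ Finset.univ.erase σ, g σ') ^ 2) P ∧
    ∫ w, occupation X σ w * (∑ σ' ∈ Finset.univ.erase σ, occupation X σ' w * g σ' -
      p * ∑ σ' ∈ Finset.univ.erase σ, g σ') ^ 2 ∂P ≤ p * (p * ∑ σ', g σ' ^ 2) := by
  set T : Finset (Hypercube N) := Finset.univ.erase σ with hT
  set V : Ω → ℝ := fun w => ∑ σ' ∈ T, occupation X σ' w * g σ' with hV
  have hVs : V = ∑ σ' ∈ T, fun w => occupation X σ' w * g σ' := by
    ext w
    rw [Finset.sum_apply]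
  have hL : ∀ σ', MemLp (fun w => occupation X σ' w * g σ') 2 P := fun σ' =>
    (hX.memLp_occupation σ').mul_const _
  have hVL : MemLp V 2 P := hVs ▸ memLp_finsetSum' _ fun σ' _ => hL σ'
  have hVm : Measurable V := by
    have := hX.measurable_occupation
    fun_prop
  have hmean : ∫ w, V w ∂P = p * ∑ σ' ∈ T, g σ' := by
    rw [hV, integral_finsetSum _ fun σ' _ => (hX.integrable_occupation σ').mul_const _,
      Finset.mul_sum]
    refine Finset.sum_congr rfl fun σ' _ => ?_
    rw [integral_mul_const, hX.integral_occupation]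
  have hvar : Var[V; P] ≤ p * ∑ σ', g σ' ^ 2 := by
    rw [hVs, IndepFun.variance_sum (fun σ' _ => hL σ') fun i _ j _ hij =>
      (hX.iIndepFun_occupation.indepFun hij).comp (measurable_id.mul_const (g i))
        (measurable_id.mul_const (g j)), Finset.mul_sum]
    refine (Finset.sum_le_sum fun σ' _ => ?_).trans (Finset.sum_le_sum_of_subset_of_nonneg
      (Finset.subset_univ T) fun _ _ _ => mul_nonneg hX.prob_nonneg (sq_nonneg _))
    refine (variance_le_expectation_sq (hL σ').1).trans_eq ?_
    have h1 : ∀ w, ((fun w => occupation X σ' w * g σ') ^ 2) w = occupation X σ' w * g σ' ^ 2 := by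
      intro w
      rw [Pi.pow_apply, mul_pow, occupation_sq]
    simp_rw [h1]
    rw [integral_mul_const, hX.integral_occupation]
  have hind : IndepFun (occupation X σ) (fun w => (V w - p * ∑ σ' ∈ T, g σ') ^ 2) P := by
    have h1 := hX.indep.indepFun_finset {σ} T (by simp [hT]) hX.measurable
    have h2 := h1.comp (φ := fun x : ({σ} : Finset (Hypercube N)) → Bool =>
        if x ⟨σ, Finset.mem_singleton_self σ⟩ = true then (1 : ℝ) else 0)
      (ψ := fun x : T → Bool => (∑ σ' : T, (if x σ' = true then (1 : ℝ) else 0) * g σ' -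
        p * ∑ σ' ∈ T, g σ') ^ 2) (measurable_of_finite _) (measurable_of_finite _)
    have h3 : (fun w => (V w - p * ∑ σ' ∈ T, g σ') ^ 2) =
        (fun x : T → Bool => (∑ σ' : T, (if x σ' = true then (1 : ℝ) else 0) * g σ' -
          p * ∑ σ' ∈ T, g σ') ^ 2) ∘ fun w i => X i w := by
      ext w
      have h4 := Finset.sum_coe_sort T fun σ' => occupation X σ' w * g σ'
      simp only [Function.comp_apply, hV]
      rw [← h4]
      rfl
    rw [h3]
    exact h2
  have hsq : Integrable (fun w => (V w - p * ∑ σ' ∈ T, g σ') ^ 2) P :=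
    (hVL.sub (memLp_const _)).integrable_sq
  refine ⟨hX.integrable_occupation_mul σ hsq, ?_⟩
  rw [hind.integral_fun_mul_eq_mul_integral (hX.measurable_occupation σ).aestronglyMeasurable
    hsq.1, hX.integral_occupation, ← hmean, ← variance_eq_integral hVm.aemeasurable]
  exact mul_le_mul_of_nonneg_left hvar hX.prob_nonneg

end IsBernoulliCloud

end Cloud

/-! ### Almost sure properties of the random clouds -/

section Asymptotics

variable {M : ℕ → ℝ}

lemma eventually_mul_log_le (hM : (fun N : ℕ => Real.log N) =o[atTop] fun N : ℕ => (2 : ℝ) ^ M N)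
    (c : ℝ) : ∀ᶠ N : ℕ in atTop, c * Real.log N ≤ 2 ^ M N := by
  have hc : 0 < |c| + 1 := by positivity
  filter_upwards [hM.def (inv_pos.2 hc)] with N hN
  rw [Real.norm_of_nonneg (by positivity : (0 : ℝ) ≤ 2 ^ M N), inv_mul_eq_div,
    le_div_iff₀ hc] at hN
  have h1 := Real.log_natCast_nonneg N
  rw [Real.norm_of_nonneg h1] at hN
  nlinarith [le_abs_self c]

lemma tendsto_two_rpow (hM : (fun N : ℕ => Real.log N) =o[atTop] fun N : ℕ => (2 : ℝ) ^ M N) :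
    Tendsto (fun N => (2 : ℝ) ^ M N) atTop atTop :=
  tendsto_atTop_mono' _ ((eventually_mul_log_le hM 1).mono fun N h => by rwa [one_mul] at h)
    (Real.tendsto_log_atTop.comp tendsto_natCast_atTop_atTop)

lemma tendsto_exponent (hM : (fun N : ℕ => Real.log N) =o[atTop] fun N : ℕ => (2 : ℝ) ^ M N) :
    Tendsto M atTop atTop := by
  have h1 := (Real.tendsto_log_atTop.comp (tendsto_two_rpow hM)).atTop_div_const
    (Real.log_pos one_lt_two)
  refine h1.congr fun N => ?_
  rw [Function.comp_apply, Real.log_rpow two_pos, mul_div_cancel_right₀ _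
    (Real.log_pos one_lt_two).ne']

end Asymptotics

section AlmostSure

variable {Ω : Type*} [MeasurableSpace Ω] {P : Measure Ω} [IsProbabilityMeasure P]

lemma ae_eventually_notMem_of_le {A : ℕ → Set Ω} {c : ℝ}
    (h : ∀ᶠ N : ℕ in atTop, P.real (A N) ≤ c * ((N : ℝ) ^ 2)⁻¹) :
    ∀ᵐ w ∂P, ∀ᶠ N in atTop, w ∉ A N := by
  obtain ⟨n, hn⟩ := eventually_atTop.1 h
  have hc : Summable fun N : ℕ => c * ((N : ℝ) ^ 2)⁻¹ :=
    (Real.summable_nat_pow_inv.2 one_lt_two).mul_left c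
  have hsum : ∑' N, P (if n ≤ N then A N else ∅) ≠ ⊤ := by
    refine ne_top_of_le_ne_top hc.tsum_ofReal_ne_top (ENNReal.tsum_le_tsum fun N => ?_)
    split_ifs with hN
    · rw [← ofReal_measureReal]
      exact ENNReal.ofReal_le_ofReal (hn N hN)
    · simp
  filter_upwards [ae_eventually_notMem hsum] with w hw
  filter_upwards [hw, eventually_ge_atTop n] with N h1 h2
  rwa [if_pos h2] at h1

variable {M : ℕ → ℝ} {X : (N : ℕ) → Hypercube N → Ω → Bool}
  (hX : ∀ N, 1 ≤ N → IsBernoulliCloud P ((2 : ℝ) ^ M N / (2 : ℝ) ^ N) (X N))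

include hX

lemma ae_tendsto_card_cloud
    (hM : (fun N : ℕ => Real.log N) =o[atTop] fun N : ℕ => (2 : ℝ) ^ M N) :
    ∀ᵐ w ∂P, Tendsto (fun N => ((cloud (X N) w).card : ℝ) / (2 : ℝ) ^ M N) atTop (𝓝 1) := by
  have h1 : ∀ k : ℕ, ∀ᵐ w ∂P, ∀ᶠ N in atTop,
      w ∉ {w | 1 / ((k : ℝ) + 1) * 2 ^ M N ≤ |((cloud (X N) w).card : ℝ) - 2 ^ M N|} := by
    intro k
    have hk : (0 : ℝ) < (k : ℝ) + 1 := by positivity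
    set ε : ℝ := 1 / ((k : ℝ) + 1) with hε
    have hε0 : 0 < ε := by positivity
    have hε1 : ε ≤ 1 := by
      rw [hε, div_le_one hk]
      linarith [Nat.cast_nonneg (α := ℝ) k]
    refine ae_eventually_notMem_of_le (c := 2) ?_
    filter_upwards [eventually_mul_log_le hM (8 / ε ^ 2), eventually_ge_atTop 1] with N h2 h3
    have h4 := (hX N h3).measureReal_card_le hε0 hε1
    have hN : (0 : ℝ) < N := by exact_mod_cast h3
    have h5 : (2 : ℝ) ^ N * ((2 : ℝ) ^ M N / (2 : ℝ) ^ N) = 2 ^ M N := by field_simp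
    rw [h5] at h4
    refine h4.trans (mul_le_mul_of_nonneg_left ?_ zero_le_two)
    rw [← Real.exp_log (by positivity : (0 : ℝ) < ((N : ℝ) ^ 2)⁻¹), Real.exp_le_exp, Real.log_inv,
      Real.log_pow]
    rw [div_mul_eq_mul_div, div_le_iff₀ (by positivity)] at h2
    push_cast
    linarith
  filter_upwards [ae_all_iff.2 h1] with w hw
  rw [Metric.tendsto_nhds]
  intro ε hε
  obtain ⟨k, hk⟩ := exists_nat_one_div_lt hε
  filter_upwards [hw k] with N hN
  have h2 : (0 : ℝ) < 2 ^ M N := by positivity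
  simp only [not_le] at hN
  rw [Real.dist_eq, div_sub_one h2.ne', abs_div, abs_of_pos h2]
  exact ((div_lt_iff₀ h2).2 hN).trans hk

lemma ae_eventually_overlap_lt :
    ∀ᵐ w ∂P, ∀ᶠ N : ℕ in atTop, ∀ σ ∈ cloud (X N) w, ∀ σ' ∈ cloud (X N) w, σ ≠ σ' →
      N * overlap σ σ' ^ 2 < 8 * (M N * Real.log 2 + Real.log N) := by
  have h1 : ∀ᵐ w ∂P, ∀ᶠ N : ℕ in atTop, w ∉ {w | ∃ σ ∈ cloud (X N) w, ∃ σ' ∈ cloud (X N) w,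
      σ ≠ σ' ∧ 8 * (M N * Real.log 2 + Real.log N) ≤ N * overlap σ σ' ^ 2} := by
    refine ae_eventually_notMem_of_le (c := √2) ?_
    filter_upwards [eventually_ge_atTop 1] with N hN
    refine ((hX N hN).measureReal_exists_overlap_le hN _).trans_eq ?_
    have hN0 : (0 : ℝ) < N := by exact_mod_cast hN
    -- With this threshold the first moment bound is exactly `√2 / N ^ 2`.
    have h2 : -(8 * (M N * Real.log 2 + Real.log N) / 4) =
        -(Real.log 2 * M N) + -(Real.log 2 * M N) + -(Real.log N) + -(Real.log N) := by ring
    rw [h2, Real.exp_add, Real.exp_add, Real.exp_add, Real.exp_neg, Real.exp_neg,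
      Real.exp_log hN0, ← Real.rpow_def_of_pos two_pos]
    field_simp
  filter_upwards [h1] with w hw
  filter_upwards [hw] with N hN σ hσ σ' hσ' hne
  by_contra h2
  exact hN ⟨σ, hσ, σ', hσ', hne, not_lt.1 h2⟩

/-- When the clouds grow fast enough, the exponential moment of the overlaps over pairs of the
cloud is of the order of its mean. -/
lemma ae_eventually_sum_exp_le :
    ∀ᵐ w ∂P, ∀ᶠ N : ℕ in atTop, (N : ℝ) ^ 4 < 2 ^ M N →
      ∑ σ ∈ cloud (X N) w, ∑ σ' ∈ cloud (X N) w,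
        (if σ = σ' then 0 else Real.exp (N * overlap σ σ' ^ 2 / 8)) ≤
      3 * (cloud (X N) w).card * 2 ^ M N + (2 ^ M N) ^ 2 := by
  set g : (N : ℕ) → Hypercube N → Hypercube N → ℝ :=
    fun N σ σ' => Real.exp (N * overlap σ σ' ^ 2 / 8) with hg
  set D : (N : ℕ) → Hypercube N → Ω → ℝ := fun N σ w =>
    ∑ σ' ∈ Finset.univ.erase σ, occupation (X N) σ' w * g N σ σ' -
      2 ^ M N / 2 ^ N * ∑ σ' ∈ Finset.univ.erase σ, g N σ σ' with hD
  have hg2 : ∀ N σ σ', g N σ σ' ^ 2 = Real.exp (N * overlap σ σ' ^ 2 / 4) := by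
    intro N σ σ'
    rw [hg, ← Real.exp_nat_mul]
    congr 1
    push_cast
    ring
  have h1 : ∀ᵐ w ∂P, ∀ᶠ N : ℕ in atTop, w ∉ {w | (N : ℝ) ^ 4 < 2 ^ M N ∧
      ((2 : ℝ) ^ M N) ^ 3 ≤ ∑ σ, occupation (X N) σ w * D N σ w ^ 2} := by
    refine ae_eventually_notMem_of_le (c := √2) ?_
    filter_upwards [eventually_ge_atTop 1] with N hN
    have hN1 : (1 : ℝ) ≤ N := by exact_mod_cast hN
    have hA : (0 : ℝ) < 2 ^ M N := by positivity
    by_cases hbig : (N : ℝ) ^ 4 < 2 ^ M N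
    · have hi := fun σ => (hX N hN).integral_occupation_mul_sq_le σ (g N σ)
      have hmean : ∫ w, ∑ σ, occupation (X N) σ w * D N σ w ^ 2 ∂P ≤ √2 * (2 ^ M N) ^ 2 := by
        rw [integral_finsetSum _ fun σ _ => (hi σ).1]
        have h2 : ∀ σ, ∫ w, occupation (X N) σ w * D N σ w ^ 2 ∂P ≤
            2 ^ M N / 2 ^ N * (2 ^ M N / 2 ^ N * (√2 * 2 ^ N)) := by
          intro σ
          refine (hi σ).2.trans ?_
          simp_rw [hg2]
          have := sum_exp_overlap_sq_le hN σ
          gcongr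
        refine (Finset.sum_le_sum fun σ _ => h2 σ).trans_eq ?_
        simp only [Finset.sum_const, Finset.card_univ, Fintype.card_pi_const,
          Fintype.card_units_int, nsmul_eq_mul]
        push_cast
        field_simp
      have h3 := mul_meas_ge_le_integral_of_nonneg (μ := P)
        (f := fun w => ∑ σ, occupation (X N) σ w * D N σ w ^ 2)
        (ae_of_all _ fun w => Finset.sum_nonneg fun σ _ =>
          mul_nonneg (occupation_nonneg σ w) (sq_nonneg _))
        (integrable_finsetSum _ fun σ _ => (hi σ).1) (((2 : ℝ) ^ M N) ^ 3)
      have h4 : P.real {w | (N : ℝ) ^ 4 < 2 ^ M N ∧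
          ((2 : ℝ) ^ M N) ^ 3 ≤ ∑ σ, occupation (X N) σ w * D N σ w ^ 2} ≤
          P.real {w | ((2 : ℝ) ^ M N) ^ 3 ≤ ∑ σ, occupation (X N) σ w * D N σ w ^ 2} :=
        measureReal_mono fun w hw => hw.2
      refine h4.trans ?_
      have h5 : (N : ℝ) ^ 2 ≤ 2 ^ M N :=
        (pow_le_pow_right₀ hN1 (by norm_num)).trans hbig.le
      rw [← div_eq_mul_inv, le_div_iff₀ (by positivity)]
      have h6 := h3.trans hmean
      have h7 : P.real {w | ((2 : ℝ) ^ M N) ^ 3 ≤ ∑ σ, occupation (X N) σ w * D N σ w ^ 2} *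
          2 ^ M N ≤ √2 := by
        refine le_of_mul_le_mul_right ?_ (pow_pos hA 2)
        calc _ = _ := by ring
          _ ≤ _ := h6
      exact (mul_le_mul_of_nonneg_left h5 measureReal_nonneg).trans h7
    · simp only [hbig, false_and, Set.ofPred_false, measureReal_empty]
      positivity
  filter_upwards [h1] with w hw
  filter_upwards [hw, eventually_ge_atTop 1] with N hN hN1 hbig
  set A : ℝ := 2 ^ M N with hAdef
  have hA : 0 < A := by positivity
  have hsum : ∑ σ, occupation (X N) σ w * D N σ w ^ 2 ≤ A ^ 3 := by
    by_contra h2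
    exact hN ⟨hbig, (not_le.1 h2).le⟩
  have hmean : ∀ σ, A / 2 ^ N * ∑ σ' ∈ Finset.univ.erase σ, g N σ σ' ≤ 2 * A := by
    intro σ
    have h2 : ∑ σ' ∈ Finset.univ.erase σ, g N σ σ' ≤ √2 * 2 ^ N := by
      refine le_trans ?_ (sum_exp_overlap_sq_le hN1 σ)
      refine (Finset.sum_le_sum fun σ' _ => ?_).trans (Finset.sum_le_sum_of_subset_of_nonneg
        (Finset.subset_univ _) fun _ _ _ => (Real.exp_pos _).le)
      refine Real.exp_le_exp.2 ?_
      have : 0 ≤ N * overlap σ σ' ^ 2 := by positivity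
      linarith
    have h3 : √2 ≤ 2 := by
      rw [Real.sqrt_le_left zero_le_two]
      norm_num
    calc A / 2 ^ N * ∑ σ' ∈ Finset.univ.erase σ, g N σ σ' ≤ A / 2 ^ N * (√2 * 2 ^ N) := by gcongr
      _ = √2 * A := by field_simp
      _ ≤ 2 * A := by gcongr
  have hV : ∀ σ, ∑ σ' ∈ cloud (X N) w, (if σ = σ' then 0 else g N σ σ') ≤
      3 * A + D N σ w ^ 2 / A := by
    intro σ
    have h2 : ∑ σ' ∈ cloud (X N) w, (if σ = σ' then 0 else g N σ σ') =
        D N σ w + A / 2 ^ N * ∑ σ' ∈ Finset.univ.erase σ, g N σ σ' := by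
      have h3 : D N σ w + A / 2 ^ N * ∑ σ' ∈ Finset.univ.erase σ, g N σ σ' =
          ∑ σ' ∈ Finset.univ.erase σ, occupation (X N) σ' w * g N σ σ' := sub_add_cancel _ _
      rw [h3, sum_cloud, ← Finset.add_sum_erase Finset.univ _ (Finset.mem_univ σ), if_pos rfl,
        mul_zero, zero_add]
      refine Finset.sum_congr rfl fun σ' hσ' => ?_
      rw [if_neg (Finset.ne_of_mem_erase hσ').symm]
    -- The deviation is compared with `A` and its square, which avoids absolute moments.
    have h3 : D N σ w ≤ A + D N σ w ^ 2 / A := by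
      rw [← sub_le_iff_le_add', le_div_iff₀ hA]
      nlinarith [sq_nonneg (D N σ w - A), sq_nonneg (D N σ w + A)]
    rw [h2]
    linarith [hmean σ]
  calc ∑ σ ∈ cloud (X N) w, ∑ σ' ∈ cloud (X N) w, (if σ = σ' then 0 else g N σ σ')
      ≤ ∑ σ ∈ cloud (X N) w, (3 * A + D N σ w ^ 2 / A) := Finset.sum_le_sum fun σ _ => hV σ
    _ = 3 * (cloud (X N) w).card * A + (∑ σ, occupation (X N) σ w * D N σ w ^ 2) / A := by
        rw [Finset.sum_add_distrib, Finset.sum_const, nsmul_eq_mul, sum_cloud, Finset.sum_div]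
        simp only [mul_div_assoc]
        ring
    _ ≤ 3 * (cloud (X N) w).card * A + A ^ 2 := by
        gcongr
        rw [div_le_iff₀ hA]
        exact hsum.trans_eq (by ring)

end AlmostSure

/-! ### Decay of the interaction energy -/

lemma exists_abs_sub_le_mul_abs {f : ℝ → ℝ} (hf : ContDiffOn ℝ 1 f (Set.Icc (-1) 1)) :
    ∃ L, 0 ≤ L ∧ ∀ x ∈ Set.Icc (-1 : ℝ) 1, |f x - f 0| ≤ L * |x| := by
  have hu : UniqueDiffOn ℝ (Set.Icc (-1 : ℝ) 1) := uniqueDiffOn_Icc (by norm_num)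
  obtain ⟨L, hL⟩ := isCompact_Icc.exists_bound_of_continuousOn
    (hf.continuousOn_derivWithin hu le_rfl)
  have h0 : (0 : ℝ) ∈ Set.Icc (-1 : ℝ) 1 := by norm_num
  refine ⟨L, (norm_nonneg _).trans (hL 0 h0), fun x hx => ?_⟩
  have h1 := (convex_Icc (-1 : ℝ) 1).norm_image_sub_le_of_norm_derivWithin_le
    (hf.differentiableOn one_ne_zero) hL h0 hx
  rwa [sub_zero, Real.norm_eq_abs, Real.norm_eq_abs] at h1

lemma exists_abs_le_mul_sq {f : ℝ → ℝ} (hf : ContDiffOn ℝ 2 f (Set.Icc (-1) 1)) (h0 : f 0 = 0)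
    (hd : deriv f 0 = 0) : ∃ L, 0 ≤ L ∧ ∀ x ∈ Set.Icc (-1 : ℝ) 1, |f x| ≤ L * x ^ 2 := by
  have hu : UniqueDiffOn ℝ (Set.Icc (-1 : ℝ) 1) := uniqueDiffOn_Icc (by norm_num)
  obtain ⟨L, hL0, hL⟩ := exists_abs_sub_le_mul_abs
    (hf.derivWithin hu (m := 1) (by norm_num))
  have hd0 : derivWithin f (Set.Icc (-1) 1) 0 = 0 := by
    rw [derivWithin_of_mem_nhds (Icc_mem_nhds (by norm_num) (by norm_num)), hd]
  refine ⟨L, hL0, fun x hx => ?_⟩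
  have hsub : Set.Icc (-|x|) |x| ⊆ Set.Icc (-1 : ℝ) 1 := by
    have := abs_le.2 hx
    exact Set.Icc_subset_Icc (by linarith) this
  have h1 := (convex_Icc (-|x|) |x|).norm_image_sub_le_of_norm_hasDerivWithin_le
    (f := f) (f' := derivWithin f (Set.Icc (-1) 1)) (C := L * |x|) (x := 0) (y := x)
    (fun y hy => ((hf.differentiableOn two_ne_zero y (hsub hy)).hasDerivWithinAt).mono hsub)
    (fun y hy => by
      have h2 := hL y (hsub hy)
      rw [hd0, sub_zero] at h2
      exact h2.trans (mul_le_mul_of_nonneg_left (abs_le.2 hy) hL0))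
    (by simp) (abs_le.1 le_rfl)
  rw [h0, sub_zero, sub_zero, Real.norm_eq_abs, Real.norm_eq_abs] at h1
  rw [← sq_abs x, sq, ← mul_assoc]
  exact h1

/-- Under either growth condition, `M |ν x|` is at most `1 + N x ^ 2` times a vanishing rate: `ν` is
of first order at `0` in the first case and of second order in the second case. -/
lemma exists_rate {ν : ℝ → ℝ} (hν : ContDiffOn ℝ ∞ ν (Set.Icc (-1) 1)) (hν0 : ν 0 = 0) {M : ℕ → ℝ}
    (hM1 : deriv ν 0 ≠ 0 → M =o[atTop] fun N : ℕ => √(N : ℝ))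
    (hM2 : deriv ν 0 = 0 → M =o[atTop] fun N : ℕ => (N : ℝ)) :
    ∃ μ : ℕ → ℝ, Tendsto μ atTop (𝓝 0) ∧ (∀ N, 0 ≤ μ N) ∧
      ∀ N : ℕ, 1 ≤ N → ∀ x, |x| ≤ 1 → |M N| * |ν x| ≤ μ N * (1 + N * x ^ 2) := by
  by_cases hd : deriv ν 0 = 0
  · obtain ⟨L, hL0, hL⟩ := exists_abs_le_mul_sq (f := ν)
      (by exact_mod_cast contDiffOn_infty.1 hν 2) hν0 hd
    refine ⟨fun N => L * |M N / N|, ?_, fun N => by positivity, fun N hN x hx => ?_⟩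
    · have := ((hM2 hd).tendsto_div_nhds_zero.abs).const_mul L
      rwa [abs_zero, mul_zero] at this
    · have hN0 : (0 : ℝ) < N := by exact_mod_cast hN
      beta_reduce
      rw [abs_div, abs_of_pos hN0]
      calc |M N| * |ν x| ≤ |M N| * (L * x ^ 2) := by
            gcongr
            exact hL x (abs_le.1 hx)
        _ = L * (|M N| / N) * (N * x ^ 2) := by field_simp
        _ ≤ L * (|M N| / N) * (1 + N * x ^ 2) := by
            gcongr
            linarith
  · obtain ⟨L, hL0, hL⟩ := exists_abs_sub_le_mul_abs
      (hν.of_le (m := 1) (by exact_mod_cast le_top))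
    refine ⟨fun N => L * |M N / √N|, ?_, fun N => by positivity, fun N hN x hx => ?_⟩
    · have := ((hM1 hd).tendsto_div_nhds_zero.abs).const_mul L
      rwa [abs_zero, mul_zero] at this
    · have hN0 : (0 : ℝ) < N := by exact_mod_cast hN
      have hs : 0 < √(N : ℝ) := Real.sqrt_pos.2 hN0
      have h1 := hL x (abs_le.1 hx)
      rw [hν0, sub_zero] at h1
      beta_reduce
      rw [abs_div, abs_of_pos hs]
      have h2 : √(N : ℝ) * |x| ≤ 1 + N * x ^ 2 := by
        have h3 : (√(N : ℝ) * |x|) ^ 2 = N * x ^ 2 := by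
          rw [mul_pow, Real.sq_sqrt hN0.le, sq_abs]
        nlinarith [sq_nonneg (√(N : ℝ) * |x| - 1), mul_nonneg hs.le (abs_nonneg x)]
      calc |M N| * |ν x| ≤ |M N| * (L * |x|) := by gcongr
        _ = L * (|M N| / √N) * (√N * |x|) := by field_simp
        _ ≤ L * (|M N| / √N) * (1 + N * x ^ 2) := by gcongr

lemma isLittleO_natCast {ν : ℝ → ℝ} {M : ℕ → ℝ}
    (hM1 : deriv ν 0 ≠ 0 → M =o[atTop] fun N : ℕ => √(N : ℝ))
    (hM2 : deriv ν 0 = 0 → M =o[atTop] fun N : ℕ => (N : ℝ)) :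
    M =o[atTop] fun N : ℕ => (N : ℝ) := by
  by_cases hd : deriv ν 0 = 0
  · exact hM2 hd
  · refine (hM1 hd).trans_isBigO (IsBigO.of_bound 1 ?_)
    filter_upwards [eventually_ge_atTop 1] with N hN
    have hN0 : (1 : ℝ) ≤ N := by exact_mod_cast hN
    rw [one_mul, Real.norm_of_nonneg (Real.sqrt_nonneg _), Real.norm_of_nonneg (by linarith)]
    exact (Real.sqrt_le_left (by linarith)).2 (by nlinarith)

/-- The energy of a pair is dominated by the exponential moment of its overlap, here with `x` for
`M |ν R|` and `y` for `N R ^ 2`. -/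
lemma mul_exp_le {μ x y : ℝ} (hμ0 : 0 ≤ μ) (hμ : μ ≤ 1 / 32) (hy : 0 ≤ y)
    (hx : x ≤ μ * (1 + y)) :
    x * Real.exp (2 * Real.log 2 * x) ≤ 32 * μ * Real.exp (y / 8) := by
  have hl0 := Real.log_two_gt_d9
  have hl1 := Real.log_two_lt_d9
  have h1 : 1 + y ≤ 16 * Real.exp ((1 + y) / 16) := by
    have := Real.add_one_le_exp ((1 + y) / 16)
    linarith
  have h2 : x ≤ (1 + y) / 32 := by nlinarith
  have h3 : 2 * Real.log 2 * x ≤ (1 + y) / 16 := by nlinarith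
  have h4 : Real.exp (1 / 8) ≤ 2 := by
    rw [← Real.le_log_iff_exp_le two_pos]
    linarith
  calc x * Real.exp (2 * Real.log 2 * x)
      ≤ μ * (1 + y) * Real.exp ((1 + y) / 16) :=
        mul_le_mul hx (Real.exp_le_exp.2 h3) (Real.exp_pos _).le (by positivity)
    _ ≤ μ * (16 * Real.exp ((1 + y) / 16)) * Real.exp ((1 + y) / 16) := by gcongr
    _ = 16 * μ * (Real.exp (1 / 8) * Real.exp (y / 8)) := by
        rw [← Real.exp_add, show 1 / 8 + y / 8 = (1 + y) / 16 + (1 + y) / 16 by ring, Real.exp_add]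
        ring
    _ ≤ 16 * μ * (2 * Real.exp (y / 8)) := by gcongr
    _ = 32 * μ * Real.exp (y / 8) := by ring

section Interaction

variable {ν : ℝ → ℝ} {M : ℕ → ℝ} {S : (N : ℕ) → Finset (Hypercube N)}

lemma eventually_abs_le_half (hν : ContDiffOn ℝ ∞ ν (Set.Icc (-1) 1)) (hν0 : ν 0 = 0)
    (hMN : M =o[atTop] fun N : ℕ => (N : ℝ))
    (hover : ∀ᶠ N : ℕ in atTop, ∀ σ ∈ S N, ∀ σ' ∈ S N, σ ≠ σ' →
      N * overlap σ σ' ^ 2 < 8 * (M N * Real.log 2 + Real.log N)) :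
    ∀ᶠ N : ℕ in atTop, ∀ σ ∈ S N, ∀ σ' ∈ S N, σ ≠ σ' → |ν (overlap σ σ')| ≤ 1 / 2 := by
  obtain ⟨L, hL0, hL⟩ := exists_abs_sub_le_mul_abs (hν.of_le (m := 1) (by exact_mod_cast le_top))
  have hlog : Tendsto (fun N : ℕ => Real.log N / N) atTop (𝓝 0) :=
    (Real.isLittleO_log_id_atTop.comp_tendsto tendsto_natCast_atTop_atTop).tendsto_div_nhds_zero
  have hlim : Tendsto (fun N : ℕ => 4 * L ^ 2 * (8 * (M N / N * Real.log 2 + Real.log N / N)))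
      atTop (𝓝 0) := by
    have := (((hMN.tendsto_div_nhds_zero.mul_const (Real.log 2)).add hlog).const_mul 8).const_mul
      (4 * L ^ 2)
    simpa using this
  filter_upwards [hover, hlim.eventually_le_const one_pos, eventually_ge_atTop 1] with
    N h1 h2 h3 σ hσ σ' hσ' hne
  have hN0 : (0 : ℝ) < N := by exact_mod_cast h3
  have h4 := h1 σ hσ σ' hσ' hne
  have h5 := hL _ (abs_le.1 (abs_overlap_le_one σ σ'))
  rw [hν0, sub_zero] at h5
  refine h5.trans ((sq_le_sq₀ (by positivity) (by norm_num)).1 ?_)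
  rw [mul_pow, sq_abs]
  have h6 : overlap σ σ' ^ 2 ≤ 8 * (M N / N * Real.log 2 + Real.log N / N) := by
    rw [← mul_le_mul_iff_of_pos_left hN0]
    refine h4.le.trans_eq ?_
    field_simp
  have h7 := mul_le_mul_of_nonneg_left h6 (by positivity : 0 ≤ 4 * L ^ 2)
  linarith

lemma interaction_eq (N : ℕ) (m : ℝ) (T : Finset (Hypercube N)) :
    interaction m (fun i j : T => ν (overlap i.1 j.1)) = ((2 : ℝ) ^ m)⁻¹ ^ 2 *
      ∑ σ ∈ T, ∑ σ' ∈ T, if σ = σ' then 0 else m * |ν (overlap σ σ')| *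
        Real.exp (2 * Real.log 2 * (m * |ν (overlap σ σ')|)) := by
  rw [interaction, ← Finset.sum_coe_sort T]
  congr 1
  refine Finset.sum_congr rfl fun i _ => ?_
  rw [← Finset.sum_coe_sort T]
  refine Finset.sum_congr rfl fun j _ => ?_
  simp only [Subtype.ext_iff]

/-- The interaction energy of the clouds vanishes in the limit. If `2 ^ M ≤ N ^ 4`, every pair
has an energy of at most `κ N → 0`; otherwise the exponential moment of the overlaps dominates. -/
theorem tendsto_interaction (hν : ContDiffOn ℝ ∞ ν (Set.Icc (-1) 1)) (hν0 : ν 0 = 0)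
    (hM : Tendsto M atTop atTop)
    (hM1 : deriv ν 0 ≠ 0 → M =o[atTop] fun N : ℕ => √(N : ℝ))
    (hM2 : deriv ν 0 = 0 → M =o[atTop] fun N : ℕ => (N : ℝ))
    (hcard : Tendsto (fun N => ((S N).card : ℝ) / (2 : ℝ) ^ M N) atTop (𝓝 1))
    (hover : ∀ᶠ N : ℕ in atTop, ∀ σ ∈ S N, ∀ σ' ∈ S N, σ ≠ σ' →
      N * overlap σ σ' ^ 2 < 8 * (M N * Real.log 2 + Real.log N))
    (hsum : ∀ᶠ N : ℕ in atTop, (N : ℝ) ^ 4 < 2 ^ M N →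
      ∑ σ ∈ S N, ∑ σ' ∈ S N, (if σ = σ' then 0 else Real.exp (N * overlap σ σ' ^ 2 / 8)) ≤
      3 * (S N).card * 2 ^ M N + (2 ^ M N) ^ 2) :
    Tendsto (fun N => interaction (M N) (fun i j : S N => ν (overlap i.1 j.1))) atTop (𝓝 0) := by
  obtain ⟨μ, hμ, hμ0, hμν⟩ := exists_rate hν hν0 hM1 hM2
  obtain ⟨L, hL0, hL⟩ := exists_abs_sub_le_mul_abs (hν.of_le (m := 1) (by exact_mod_cast le_top))
  set c : ℕ → ℝ := fun N => ((S N).card : ℝ) / (2 : ℝ) ^ M N with hc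
  set κ : ℕ → ℝ := fun N => √(2560 * L ^ 2 * (Real.log N ^ 3 / N)) with hκ
  have hκ0 : Tendsto κ atTop (𝓝 0) := by
    have h1 : Tendsto (fun N : ℕ => Real.log N ^ 3 / N) atTop (𝓝 0) :=
      ((Real.isLittleO_pow_log_id_atTop (n := 3)).comp_tendsto
        tendsto_natCast_atTop_atTop).tendsto_div_nhds_zero
    have h2 := (h1.const_mul (2560 * L ^ 2)).sqrt
    rwa [mul_zero, Real.sqrt_zero] at h2
  have hlim : Tendsto (fun N => 32 * μ N * (3 * c N + 1) +
      c N ^ 2 * (κ N * Real.exp (2 * Real.log 2 * κ N))) atTop (𝓝 0) := by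
    have h1 := (hμ.const_mul 32).mul ((hcard.const_mul 3).add_const 1)
    have h2 := (hcard.pow 2).mul
      (hκ0.mul ((Real.continuous_exp.tendsto _).comp (hκ0.const_mul (2 * Real.log 2))))
    have h3 := h1.add h2
    simp only [mul_zero, zero_mul, add_zero] at h3
    exact h3
  have hlog2 := Real.log_two_gt_d9
  refine squeeze_zero' ?_ ?_ hlim
  · filter_upwards [hM.eventually_ge_atTop 0] with N hN
    refine mul_nonneg (by positivity) (Finset.sum_nonneg fun i _ => Finset.sum_nonneg fun j _ => ?_)
    split_ifs <;> positivity
  · filter_upwards [hM.eventually_ge_atTop 0, hover, hsum, hμ.eventually_le_const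
      (by norm_num : (0 : ℝ) < 1 / 32), eventually_ge_atTop 1] with N hMN h1 h2 h3 hN
    have hN0 : (0 : ℝ) < N := by exact_mod_cast hN
    have hA : (0 : ℝ) < 2 ^ M N := by positivity
    have hc0 : 0 ≤ c N := by positivity
    have hlogN : 0 ≤ Real.log N := Real.log_natCast_nonneg N
    have hκN : 0 ≤ κ N := Real.sqrt_nonneg _
    have hμN := hμ0 N
    rw [interaction_eq]
    by_cases hbig : (N : ℝ) ^ 4 < 2 ^ M N
    · have h4 : ∑ σ ∈ S N, ∑ σ' ∈ S N, (if σ = σ' then 0 else M N * |ν (overlap σ σ')| *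
          Real.exp (2 * Real.log 2 * (M N * |ν (overlap σ σ')|))) ≤
          32 * μ N * (3 * (S N).card * 2 ^ M N + (2 ^ M N) ^ 2) := by
        refine le_trans ?_ (mul_le_mul_of_nonneg_left (h2 hbig) (by positivity))
        rw [Finset.mul_sum]
        refine Finset.sum_le_sum fun σ _ => ?_
        rw [Finset.mul_sum]
        refine Finset.sum_le_sum fun σ' _ => ?_
        split_ifs
        · simp
        · have h5 := hμν N hN _ (abs_overlap_le_one σ σ')
          rw [abs_of_nonneg hMN] at h5
          exact mul_exp_le hμN h3 (by positivity) h5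
      calc _ ≤ ((2 : ℝ) ^ M N)⁻¹ ^ 2 *
            (32 * μ N * (3 * (S N).card * 2 ^ M N + (2 ^ M N) ^ 2)) := by gcongr
        _ = 32 * μ N * (3 * c N + 1) := by
            simp only [hc]
            field_simp
        _ ≤ _ := le_add_of_nonneg_right (by positivity)
    · have hM4 : M N * Real.log 2 ≤ 4 * Real.log N := by
        have := Real.log_le_log hA (not_lt.1 hbig)
        rw [Real.log_rpow two_pos, Real.log_pow] at this
        exact_mod_cast this
      have hM8 : M N ≤ 8 * Real.log N := by nlinarith
      -- The overlap bound becomes `N R ^ 2 ≤ 8 (4 log N + log N) = 40 log N`.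
      have hpair : ∀ σ ∈ S N, ∀ σ' ∈ S N, σ ≠ σ' → M N * |ν (overlap σ σ')| ≤ κ N := by
        intro σ hσ σ' hσ' hne
        have h4 := h1 σ hσ σ' hσ' hne
        have h5 := hL _ (abs_le.1 (abs_overlap_le_one σ σ'))
        rw [hν0, sub_zero] at h5
        refine Real.le_sqrt_of_sq_le ?_
        have h6 : overlap σ σ' ^ 2 ≤ 40 * Real.log N / N := by
          rw [le_div_iff₀ hN0]
          linarith
        calc (M N * |ν (overlap σ σ')|) ^ 2
            ≤ (8 * Real.log N * (L * |overlap σ σ'|)) ^ 2 := by gcongr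
          _ = 64 * Real.log N ^ 2 * L ^ 2 * overlap σ σ' ^ 2 := by
              rw [mul_pow, mul_pow, mul_pow, sq_abs]
              ring
          _ ≤ 64 * Real.log N ^ 2 * L ^ 2 * (40 * Real.log N / N) := by gcongr
          _ = _ := by ring
      have h4 : ∑ σ ∈ S N, ∑ σ' ∈ S N, (if σ = σ' then 0 else M N * |ν (overlap σ σ')| *
          Real.exp (2 * Real.log 2 * (M N * |ν (overlap σ σ')|))) ≤
          ∑ σ ∈ S N, ∑ σ' ∈ S N, κ N * Real.exp (2 * Real.log 2 * κ N) := by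
        refine Finset.sum_le_sum fun σ hσ => Finset.sum_le_sum fun σ' hσ' => ?_
        split_ifs with hne
        · positivity
        · have h5 := hpair σ hσ σ' hσ' hne
          gcongr
      rw [Finset.sum_const, Finset.sum_const, nsmul_eq_mul, nsmul_eq_mul] at h4
      calc _ ≤ ((2 : ℝ) ^ M N)⁻¹ ^ 2 *
            ((S N).card * ((S N).card * (κ N * Real.exp (2 * Real.log 2 * κ N)))) := by gcongr
        _ = c N ^ 2 * (κ N * Real.exp (2 * Real.log 2 * κ N)) := by
            simp only [hc]
            field_simp
        _ ≤ _ := le_add_of_nonneg_left (by positivity)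

end Interaction

/-! ### The level process -/

lemma integral_pointMeasure {ι : Type*} (s : Finset ι) (x : ι → ℝ) (f : C_c(ℝ, ℝ)) :
    ∫ t, f t ∂(pointMeasure s x).1 = ∑ i ∈ s, f (x i) := by
  have h1 : (pointMeasure s x).1 = ∑ i ∈ s, Measure.dirac (x i) := rfl
  rw [h1, integral_finsetSum_measure fun i _ => integrable_dirac (by simp)]
  simp

section LevelProcess

variable {Ω : Type*} [MeasurableSpace Ω] {Q : Measure Ω} {ν : ℝ → ℝ} {N : ℕ}
  {H : Hypercube N → Ω → ℝ}

lemma aemeasurable_levelProcess (hH : ∀ σ, AEMeasurable (H σ) Q) (M : ℝ)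
    (S : Finset (Hypercube N)) : AEMeasurable (levelProcess M S H) Q := by
  refine ⟨levelProcess M S fun σ => (hH σ).mk (H σ), ?_, ?_⟩
  · refine LocFinMeasure.measurable_of_integral fun f => ?_
    simp only [levelProcess, integral_pointMeasure]
    have := f.continuous.measurable
    have := fun σ => (hH σ).measurable_mk
    fun_prop
  · filter_upwards [ae_all_iff.2 fun σ => (hH σ).ae_eq_mk] with w hw
    simp only [levelProcess, hw]

lemma charFunctional_levelProcess (hH : ∀ σ, AEMeasurable (H σ) Q) (M : ℝ)
    (S : Finset (Hypercube N)) (f : C_c(ℝ, ℝ)) :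
    LocFinMeasure.charFunctional (Q.map (levelProcess M S H)) f =
      ∫ w, Gaussian.phase (rescale M f) (fun i : S => H i w) ∂Q := by
  rw [LocFinMeasure.charFunctional, integral_map (aemeasurable_levelProcess hH M S)]
  · refine integral_congr_ae (ae_of_all _ fun w => ?_)
    simp only [levelProcess, integral_pointMeasure, Gaussian.phase, rescale]
    rw [← Finset.sum_coe_sort S]
  · have := LocFinMeasure.continuous_integral f
    exact Continuous.aestronglyMeasurable (by fun_prop)

end LevelProcess

end REM

theorem theorem1
    {ΩX : Type*} [MeasurableSpace ΩX] (P : Measure ΩX) [IsProbabilityMeasure P]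
    {ΩH : ℕ → Type*} [∀ N, MeasurableSpace (ΩH N)]
    (Q : (N : ℕ) → Measure (ΩH N)) [∀ N, IsProbabilityMeasure (Q N)]
    (ν : ℝ → ℝ) (hν : ContDiffOn ℝ ∞ ν (Set.Icc (-1) 1)) (hν0 : ν 0 = 0) (hν1 : ν 1 = 1)
    (H : (N : ℕ) → REM.Hypercube N → ΩH N → ℝ)
    (hH : ∀ N, REM.IsGaussianHamiltonian (Q N) ν (H N))
    (M : ℕ → ℝ)
    (X : (N : ℕ) → REM.Hypercube N → ΩX → Bool)
    (hX : ∀ N, 1 ≤ N → REM.IsBernoulliCloud P ((2 : ℝ) ^ (M N) / (2 : ℝ) ^ N) (X N))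
    (hM : (fun N : ℕ => Real.log N) =o[atTop] fun N : ℕ => (2 : ℝ) ^ (M N))
    (hM1 : deriv ν 0 ≠ 0 → M =o[atTop] fun N : ℕ => √(N : ℝ))
    (hM2 : deriv ν 0 = 0 → M =o[atTop] fun N : ℕ => (N : ℝ)) :
    ∃ L : ProbabilityMeasure REM.LocFinMeasure,
      REM.IsPoissonPointProcessLaw REM.limitIntensity (L : Measure REM.LocFinMeasure) ∧
      ∀ᵐ w ∂P, TendstoInDistribution
        (fun N => REM.levelProcess (M N) (REM.cloud (X N) w) (H N)) atTop
        (id : REM.LocFinMeasure → REM.LocFinMeasure) Q (L : Measure REM.LocFinMeasure) := by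
  have hMtop := REM.tendsto_exponent hM
  obtain ⟨L, hL⟩ : ∃ L : ProbabilityMeasure REM.LocFinMeasure,
      (L : Measure REM.LocFinMeasure) = REM.PoissonProcess.law REM.limitIntensity :=
    ⟨⟨REM.PoissonProcess.law REM.limitIntensity, inferInstance⟩, rfl⟩
  refine ⟨L, hL ▸ REM.PoissonProcess.isPoissonPointProcessLaw_law, ?_⟩
  filter_upwards [REM.ae_tendsto_card_cloud hX hM, REM.ae_eventually_overlap_lt hX,
    REM.ae_eventually_sum_exp_le hX] with w hcard hover hsum
  have hHm : ∀ N σ, AEMeasurable (H N σ) (Q N) := fun N σ => (hH N).gaussian.aemeasurable σ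
  have hmeas : ∀ N, AEMeasurable (REM.levelProcess (M N) (REM.cloud (X N) w) (H N)) (Q N) :=
    fun N => REM.aemeasurable_levelProcess (hHm N) _ _
  refine ⟨hmeas, aemeasurable_id, ?_⟩
  refine REM.LocFinMeasure.tendsto_of_charFunctional fun f => ?_
  simp only [ProbabilityMeasure.coe_mk, Measure.map_id, hL, REM.PoissonProcess.charFunctional_law,
    REM.charFunctional_levelProcess (hHm _)]
  have hint := REM.tendsto_interaction hν hν0 hMtop hM1 hM2 hcard hover hsum
  have hhalf := REM.eventually_abs_le_half hν hν0 (REM.isLittleO_natCast hM1 hM2) hover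
  -- The overlap of a configuration with itself is `1` only for `N ≥ 1`, so `N = 0` is skipped.
  have hshift := tendsto_add_atTop_nat 1
  rw [← tendsto_add_atTop_iff_nat 1]
  refine REM.tendsto_integral_phase
    (X := fun N (i : REM.cloud (X (N + 1)) w) => H (N + 1) i)
    (C := fun N i j => ν (REM.overlap i.1 j.1)) (fun N => (hH (N + 1)).gaussian.hasGaussianLaw _)
    (fun N i => (hH (N + 1)).centered i) (fun N i j => (hH (N + 1)).covariance_eq i j)
    (fun N i => by rw [REM.overlap_self (Nat.le_add_left 1 N), hν1]) ?_ (hMtop.comp hshift) ?_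
    (hint.comp hshift) f
  · filter_upwards [hshift.eventually hhalf] with N hN i j hij
    exact hN i.1 i.2 j.1 j.2 fun h => hij (Subtype.ext h)
  · simp only [Fintype.card_coe]
    exact hcard.comp hshift
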